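/- Conventions. $\lambda$ is an infinite cardinal. $(K,\preceq)$ is an abstract elementary class (AEC) with $LST(K,\preceq)\le\lambda$; $K_\mu$ denotes the models in $K$ of cardinality $\mu$. For $M\preceq N_1$, $M\preceq N_2$, $a_i\in N_i\setminus M$ write $(M,N_1,a_1)E^*(M,N_2,a_2)$ if there are $M_3\in K$ and $\preceq$-embeddings $f_i:N_i\to M_3$ fixing $M$ pointwise with $f_1(a_1)=f_2(a_2)$; the (Galois) type $tp(a,M,N)$ is the class of $(M,N,a)$ under the transitive closure of $E^*$, and $S(M)$ is the set of these types. All types below are computed in $(K,\preceq)$. Frames. A semi-good non-forking $\lambda$-frame $\mathfrak s=(K,\preceq,S^{bs},\mathop{\smile})$ consists of an AEC $(K,\preceq)$ with $LST(K,\preceq)\le\lambda$ such that $K_\lambda$ has joint embedding, amalgamation and no maximal model; for each $M\in K_\lambda$ a set $S^{bs}(M)\subseteq S(M)$ of basic types, closed under isomorphisms, with density (if $M\prec N$ in $K_\lambda$, some $a\in N\setminus M$ has $tp(a,M,N)\in S^{bs}(M)$) and $|S^{bs}(M)|\le\lambda^+$; and a relation $\smile(M_0,a,M_1,M_2)$ on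 $M_0\preceq M_1\preceq M_2$ in $K_\lambda$, $a\in M_2\setminus M_1$, with $tp(a,M_0,M_2)$, $tp(a,M_1,M_2)$ basic (one says that $tp(a,M_1,M_2)$ does not fork over $M_0$ if some triple in this type satisfies the relation), which is closed under isomorphisms and satisfies * Monotonicity: if $\smile(M_0,a,M_1,M_2)$, $M_0\preceq M_0'\preceq M_1'\preceq M_1$, $M_2\preceq N$ and $M_1'\cup\{a\}\subseteq M_2'\preceq N$, then $\smile(M_0',a,M_1',M_2')$. * Local character: for a limit $\delta<\lambda^+$ and an increasing continuous $\langle M_\alpha:\alpha\le\delta\rangle$, every basic type over $M_\delta$ does not fork over $M_\alpha$ for some $\alpha<\delta$. * Uniqueness: if $M\preceq N$, $p,q\in S(N)$ do not fork over $M$ and $p\restriction M=q\restriction M$, then $p=q$. * Symmetry: if $M_0\preceq M_1\preceq M_2$, $a_1\in M_1$, $tp(a_1,M_0,M_1)$ is basic and $tp(a_2,M_1,M_2)$ does not fork over $M_0$, then there are $M_3,M_4$ with $M_0\preceq M_3\preceq M_4$, $M_2\preceq M_4$, $a_2\in M_3$ such that $tp(a_1,M_3,M_4)$ does not fork over $M_0$.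 * Extension: if $M\preceq N$, every $p\in S^{bs}(M)$ extends to some $q\in S^{bs}(N)$ that does not fork over $M$. * Continuity: if $\langle M_\alpha:\alpha\le\delta\rangle$ is increasing continuous, $\delta<\lambda^+$ limit, $p\in S(M_\delta)$ and $p\restriction M_\alpha$ does not fork over $M_0$ for all $\alpha<\delta$, then $p$ is basic and does not fork over $M_0$. A good non-forking $\kappa$-frame (of the second version) is defined in the same way with $\kappa$ for $\lambda$, except that the class is an AEC in $\kappa$ (all models have cardinality $\kappa$, only sequences of length $<\kappa^+$ are considered, no LST-number is required) and $|S^{bs}(M)|\le\kappa$ is required. "Minus" a property means that this property is not required. Derived frames. For $M_0\preceq M_1\preceq M_2$ of cardinality at least $\lambda$ and $a\in M_2\setminus M_1$, let $\smile^{\ge\lambda}(M_0,a,M_1,M_2)$ hold if for some $N_0\in K_\lambda$ with $N_0\preceq M_0$, for every $N\in K_\lambda$ with $N_0\preceq N\preceq M_1$, $tp(a,N,M_2)$ does not fork over $N_0$. A type $p\in S(M_1)$ does not fork over $M_0$ if $\smile^{\ge\lambda}(M_0,a,M_1,M_2)$ for some $(M_1,M_2,a)\in p$. For $M\in K_{\lambda^+}$,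 $S^{bs}_{\lambda^+}(M)$ is the set of $p\in S(M)$ that do not fork over some $N\preceq M$, $N\in K_\lambda$. Let $\mathfrak s_{\lambda^+}=(K_{\lambda^+},\preceq\restriction K_{\lambda^+},S^{bs}_{\lambda^+},\smile_{\lambda^+})$, where $\smile_{\lambda^+}$ is $\smile^{\ge\lambda}$ restricted to models in $K_{\lambda^+}$. A model $M\in K_{\lambda^+}$ is saturated in $\lambda^+$ over $\lambda$ if for every $N\in K_\lambda$ with $N\preceq M$, every $p\in S(N)$ is realized in $M$; $K^{sat}$ is the class of these models, and $\mathfrak s^{sat}$ is the restriction of $\mathfrak s_{\lambda^+}$ to $K^{sat}$. Tameness. $(\lambda,\lambda^+)$-tameness for non-forking types: for all $M_0,M_1,M_2\in K_{\lambda^+}$ with $M_0\preceq M_1$, $M_0\preceq M_2$ and $a_i\in M_i\setminus M_0$ ($i=1,2$), if for some $M_0^-\in K_\lambda$ with $M_0^-\preceq M_0$ we have $tp(a_1,M_0^-,M_1)=tp(a_2,M_0^-,M_2)$ and both $tp(a_i,M_0,M_i)$ do not fork over $M_0^-$, then $tp(a_1,M_0,M_1)=tp(a_2,M_0,M_2)$.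 The version over saturated models requires this only for $M_0\in K^{sat}$. Theorem. Let $\mathfrak s$ be a semi-good non-forking $\lambda$-frame. (1) If $(\lambda,\lambda^+)$-tameness for non-forking types holds and $\mathfrak s_{\lambda^+}$ satisfies symmetry, then $\mathfrak s_{\lambda^+}$ is a good non-forking $\lambda^+$-frame minus the joint embedding and amalgamation properties. (2) If $(K^{sat},\preceq\restriction K^{sat})$ is an AEC in $\lambda^+$, $(\lambda,\lambda^+)$-tameness for non-forking types over saturated models holds and $\mathfrak s^{sat}$ satisfies symmetry, then $\mathfrak s^{sat}$ is a good non-forking $\lambda^+$-frame minus the amalgamation property (in particular $K^{sat}$ has joint embedding). -/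

import Mathlib

open scoped FirstOrder

universe u

namespace AECFrames

/-! ### Models

Models are literally sets with structure: the carrier is a small set of elements of the universe of
sets, so that inclusion of models, unions of chains of models and elements `a ∈ N \ M` have their
usual set-theoretic meaning, and every model has room for extensions. -/

/-- A model for the vocabulary `L`, whose carrier is a set. -/
structure Model (L : FirstOrder.Language.{u, u}) where
  carrier : Set ZFSet.{u}
  small : Small.{u} carrier
  str : L.Structure carrier

instance Model.instStructure {L : FirstOrder.Language.{u, u}} (M : Model L) : L.Structure M.carrier := M.str

/-- `M` has cardinality `κ`. -/
def Model.HasCard {L : FirstOrder.Language.{u, u}} (M : Model L) (κ : Cardinal.{u}) : Prop :=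
  Cardinal.mk M.carrier = Cardinal.lift.{u + 1} κ

/-- `κ ≤ ‖M‖`. -/
def Model.CardGe {L : FirstOrder.Language.{u, u}} (M : Model L) (κ : Cardinal.{u}) : Prop :=
  Cardinal.lift.{u + 1} κ ≤ Cardinal.mk M.carrier

/-- `M ⊆ N`: `M` is a submodel of `N`, i.e. the inclusion map is an embedding of structures. -/
def Model.IsSub {L : FirstOrder.Language.{u, u}} (M N : Model L) : Prop :=
  ∃ f : M.carrier ↪[L] N.carrier, ∀ x, (f x : ZFSet.{u}) = x

/-- `U` is the union `⋃_{α < δ} M α` (as a model extending all the `M α`). -/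
def IsUnion {L : FirstOrder.Language.{u, u}} (M : Ordinal.{u} → Model L) (δ : Ordinal.{u}) (U : Model L) :
    Prop :=
  U.carrier = {x | ∃ α < δ, x ∈ (M α).carrier} ∧ ∀ α < δ, (M α).IsSub U

/-- For a map `f` between (carriers of) models `N`, `N'`, and `M ⊆ N`, `M' ⊆ N'`:
`f[M] = M'`. -/
def ImageEq {L : FirstOrder.Language.{u, u}} {N N' : Model L} (f : N.carrier → N'.carrier)
    (M M' : Model L) : Prop :=
  M'.carrier = {y | ∃ x : N.carrier, (x : ZFSet.{u}) ∈ M.carrier ∧ (f x : ZFSet.{u}) = y}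

/-! ### Classes of models with a strong-submodel relation; abstract elementary classes -/

/-- A pair `(K, ≼)`: a class of models and a binary relation on models. -/
structure AClass (L : FirstOrder.Language.{u, u}) where
  Mem : Model L → Prop
  le : Model L → Model L → Prop

/-- The pair `(K ∩ P, ≼ ↾ (K ∩ P))`. -/
def AClass.restrict {L : FirstOrder.Language.{u, u}} (K : AClass L) (P : Model L → Prop) : AClass L where
  Mem M := K.Mem M ∧ P M
  le M N := K.le M N ∧ P M ∧ P N

/-- `⟨M α : α < δ⟩` is an increasing continuous sequence of models in `K`. -/
def AClass.IsChain {L : FirstOrder.Language.{u, u}} (K : AClass L) (δ : Ordinal.{u})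
    (M : Ordinal.{u} → Model L) : Prop :=
  (∀ α < δ, K.Mem (M α)) ∧
  (∀ α β, α < β → β < δ → K.le (M α) (M β)) ∧
  (∀ α < δ, Order.IsSuccLimit α → IsUnion M α (M α))

/-- The axioms of an AEC other than the existence of an LST-number, where closure under unions and
smoothness are required for sequences whose (limit) length satisfies `len`.
(Antisymmetry of `≼` follows from `le_sub`.) -/
structure AClass.IsAECCore {L : FirstOrder.Language.{u, u}} (K : AClass L) (len : Ordinal.{u} → Prop) :
    Prop where
  mem_iso : ∀ M N : Model L, K.Mem M → Nonempty (M.carrier ≃[L] N.carrier) → K.Mem N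
  le_iso : ∀ (M N M' N' : Model L) (f : N.carrier ≃[L] N'.carrier),
    K.le M N → M'.IsSub N' → ImageEq f M M' → K.le M' N'
  le_mem : ∀ M N, K.le M N → K.Mem M ∧ K.Mem N
  le_sub : ∀ M N, K.le M N → M.IsSub N
  le_refl : ∀ M, K.Mem M → K.le M M
  le_trans : ∀ M₀ M₁ M₂, K.le M₀ M₁ → K.le M₁ M₂ → K.le M₀ M₂
  coherence : ∀ M₀ M₁ M₂, M₀.IsSub M₁ → K.le M₀ M₂ → K.le M₁ M₂ → K.le M₀ M₁
  union : ∀ δ (M : Ordinal.{u} → Model L) (U : Model L), len δ → Order.IsSuccLimit δ →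
    K.IsChain δ M → IsUnion M δ U → K.Mem U ∧ ∀ α < δ, K.le (M α) U
  smooth : ∀ δ (M : Ordinal.{u} → Model L) (U N : Model L), len δ → Order.IsSuccLimit δ →
    K.IsChain δ M → IsUnion M δ U → (∀ α < δ, K.le (M α) N) → K.le U N

/-- `LST(K, ≼) ≤ lam`. -/
def AClass.LSTLe {L : FirstOrder.Language.{u, u}} (K : AClass L) (lam : Cardinal.{u}) : Prop :=
  ∀ (N : Model L) (A : Set ZFSet.{u}), K.Mem N → A ⊆ N.carrier →
    ∃ M, K.le M N ∧ A ⊆ M.carrier ∧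
      Cardinal.mk M.carrier ≤ Cardinal.lift.{u + 1} lam + Cardinal.mk A

/-- `(K, ≼)` is an AEC with LST-number at most `lam`. -/
def AClass.IsAEC {L : FirstOrder.Language.{u, u}} (K : AClass L) (lam : Cardinal.{u}) : Prop :=
  K.IsAECCore (fun _ => True) ∧ K.LSTLe lam

/-- `(K, ≼)` is an AEC in `κ`: all models have cardinality `κ`, only sequences of length `< κ⁺` are
considered, and no LST-number is required. -/
def AClass.IsAECIn {L : FirstOrder.Language.{u, u}} (K : AClass L) (κ : Cardinal.{u}) : Prop :=
  (∀ M, K.Mem M → M.HasCard κ) ∧ K.IsAECCore (fun δ => δ < (Order.succ κ).ord)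

/-- `f : M → N` is a `K`-embedding: an embedding of structures with `f[M] ≼ N`. -/
def AClass.IsEmb {L : FirstOrder.Language.{u, u}} (K : AClass L) {M N : Model L}
    (f : M.carrier ↪[L] N.carrier) : Prop :=
  ∃ M', K.le M' N ∧ ImageEq f M M'

/-- `f` fixes `M₀` pointwise. -/
def Fixes {L : FirstOrder.Language.{u, u}} (M₀ : Model L) {M N : Model L}
    (f : M.carrier ↪[L] N.carrier) : Prop :=
  ∀ x : M.carrier, (x : ZFSet.{u}) ∈ M₀.carrier → (f x : ZFSet.{u}) = x

/-- `(f₁, f₂, M₃)` is an amalgamation (in `K`) of `M₁` and `M₂` over `M₀`. -/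
def AClass.IsAmalgam {L : FirstOrder.Language.{u, u}} (K : AClass L) (M₀ : Model L) {M₁ M₂ M₃ : Model L}
    (f₁ : M₁.carrier ↪[L] M₃.carrier) (f₂ : M₂.carrier ↪[L] M₃.carrier) : Prop :=
  K.Mem M₃ ∧ K.IsEmb f₁ ∧ K.IsEmb f₂ ∧ Fixes M₀ f₁ ∧ Fixes M₀ f₂

/-- The amalgamation property of `(K, ≼)`. -/
def AClass.AP {L : FirstOrder.Language.{u, u}} (K : AClass L) : Prop :=
  ∀ M₀ M₁ M₂, K.le M₀ M₁ → K.le M₀ M₂ →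
    ∃ (M₃ : Model L) (f₁ : M₁.carrier ↪[L] M₃.carrier) (f₂ : M₂.carrier ↪[L] M₃.carrier),
      K.IsAmalgam M₀ f₁ f₂

/-- The joint embedding property of `(K, ≼)`. -/
def AClass.JEP {L : FirstOrder.Language.{u, u}} (K : AClass L) : Prop :=
  ∀ M₁ M₂, K.Mem M₁ → K.Mem M₂ →
    ∃ (M₃ : Model L) (f₁ : M₁.carrier ↪[L] M₃.carrier) (f₂ : M₂.carrier ↪[L] M₃.carrier),
      K.Mem M₃ ∧ K.IsEmb f₁ ∧ K.IsEmb f₂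

/-- `(K, ≼)` has no maximal model. -/
def AClass.NoMaximal {L : FirstOrder.Language.{u, u}} (K : AClass L) : Prop :=
  ∀ M, K.Mem M → ∃ N, K.le M N ∧ M ≠ N

/-! ### Galois types (of elements outside the base model) -/

/-- The triples `(M, N, a)` with `M ≼ N` and `a ∈ N \ M`, for a fixed `M`. -/
structure AClass.Triple {L : FirstOrder.Language.{u, u}} (K : AClass L) (M : Model L) where
  N : Model L
  a : ZFSet.{u}
  le : K.le M N
  mem : a ∈ N.carrier
  not_mem : a ∉ M.carrier

/-- The relation `E*` on triples over `M`. -/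
def AClass.EStar {L : FirstOrder.Language.{u, u}} (K : AClass L) (M : Model L) (s t : K.Triple M) : Prop :=
  ∃ (M₃ : Model L) (f₁ : s.N.carrier ↪[L] M₃.carrier) (f₂ : t.N.carrier ↪[L] M₃.carrier),
    K.IsAmalgam M f₁ f₂ ∧ f₁ ⟨s.a, s.mem⟩ = f₂ ⟨t.a, t.mem⟩

/-- `S(M)`: the set of types over `M`, i.e. of classes of triples modulo the equivalence relation
generated by `E*` (`E*` is reflexive and symmetric, so this is its transitive closure). -/
def AClass.GType {L : FirstOrder.Language.{u, u}} (K : AClass L) (M : Model L) : Type (u + 1) :=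
  Quot (K.EStar M)

/-- `M ≼ N`, `a ∈ N \ M` and `p = tp(a, M, N)`. -/
def AClass.IsTp {L : FirstOrder.Language.{u, u}} (K : AClass L) {M : Model L} (p : K.GType M)
    (N : Model L) (a : ZFSet.{u}) : Prop :=
  ∃ t : K.Triple M, t.N = N ∧ t.a = a ∧ p = Quot.mk _ t

/-- `tp(a₁, M, N₁) = tp(a₂, M, N₂)`. -/
def AClass.SameType {L : FirstOrder.Language.{u, u}} (K : AClass L) (M N₁ : Model L) (a₁ : ZFSet.{u})
    (N₂ : Model L) (a₂ : ZFSet.{u}) : Prop :=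
  ∃ p : K.GType M, K.IsTp p N₁ a₁ ∧ K.IsTp p N₂ a₂

/-- `M ∈ K` is saturated in `lam⁺` over `lam`. -/
def AClass.IsSaturated {L : FirstOrder.Language.{u, u}} (K : AClass L) (lam : Cardinal.{u}) (M : Model L) :
    Prop :=
  K.Mem M ∧ M.HasCard (Order.succ lam) ∧
    ∀ N, K.le N M → N.HasCard lam → ∀ p : K.GType N, ∃ a, K.IsTp p M a

/-! ### Frames -/

/-- The data of a frame: a pair `(K, ≼)` in which types are computed, the class `Mod ⊆ K` of models
of the frame (ordered by the restriction of `≼`), the basic types over a model,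
and the relation `Dnf M₀ a M₁ M₂`. -/
structure Frame (L : FirstOrder.Language.{u, u}) where
  K : AClass L
  Mod : Model L → Prop
  Sbs : (M : Model L) → Set (K.GType M)
  Dnf : Model L → ZFSet.{u} → Model L → Model L → Prop

namespace Frame

variable {L : FirstOrder.Language.{u, u}}

/-- The pair `(Mod, ≼ ↾ Mod)`. -/
def cls (s : Frame L) : AClass L := s.K.restrict s.Mod

/-- `tp(a, M, N)` is basic. -/
def Basic (s : Frame L) (M N : Model L) (a : ZFSet.{u}) : Prop :=
  ∃ p ∈ s.Sbs M, s.K.IsTp p N a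

/-- `tp(a, M₁, M₂)` does not fork over `M₀`: some triple in this type satisfies `Dnf`. -/
def TypeDnf (s : Frame L) (M₀ M₁ M₂ : Model L) (a : ZFSet.{u}) : Prop :=
  ∃ N b, s.K.SameType M₁ M₂ a N b ∧ s.Dnf M₀ b M₁ N

/-- `S^bs` respects isomorphisms. -/
def BasicIso (s : Frame L) : Prop :=
  ∀ (M N M' N' : Model L) (f : N.carrier ≃[L] N'.carrier) (a : N.carrier),
    s.cls.le M N → s.cls.le M' N' → ImageEq f M M' → s.Basic M N a → s.Basic M' N' (f a)

/-- Density of basic types. -/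
def Density (s : Frame L) : Prop :=
  ∀ M N, s.cls.le M N → M ≠ N → ∃ a, s.Basic M N a

/-- `|S^bs(M)| ≤ μ` for every model `M` of the frame. -/
def BasicStability (s : Frame L) (μ : Cardinal.{u}) : Prop :=
  ∀ M, s.Mod M → Cardinal.mk (s.Sbs M) ≤ Cardinal.lift.{u + 1} μ

/-- `Dnf` is a relation between models `M₀ ≼ M₁ ≼ M₂` of the frame and elements of `M₂ \ M₁`
whose types over `M₀` and `M₁` are basic. -/
def DnfBasic (s : Frame L) : Prop :=
  ∀ M₀ a M₁ M₂, s.Dnf M₀ a M₁ M₂ → s.cls.le M₀ M₁ ∧ s.cls.le M₁ M₂ ∧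
    s.Basic M₀ M₂ a ∧ s.Basic M₁ M₂ a

/-- `Dnf` is closed under isomorphisms. -/
def DnfIso (s : Frame L) : Prop :=
  ∀ (M₀ M₁ M₂ M₀' M₁' M₂' : Model L) (f : M₂.carrier ≃[L] M₂'.carrier) (a : M₂.carrier),
    s.cls.le M₀ M₁ → s.cls.le M₁ M₂ → s.cls.le M₀' M₁' → s.cls.le M₁' M₂' →
    ImageEq f M₀ M₀' → ImageEq f M₁ M₁' → s.Dnf M₀ a M₁ M₂ → s.Dnf M₀' (f a) M₁' M₂'

/-- Monotonicity: `M₀` may be increased and `M₁` decreased (keeping `M₀' ≼ M₁'`), and `M₂` may be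
replaced by a submodel, containing `M₁'` and `a`, of an extension of `M₂`. -/
def Monotonicity (s : Frame L) : Prop :=
  ∀ M₀ M₀' M₁' M₁ M₂ M₂' N a, s.cls.le M₀ M₀' → s.cls.le M₀' M₁' → s.cls.le M₁' M₁ →
    s.cls.le M₁ M₂ → s.cls.le M₂ N → s.cls.le M₂' N →
    M₁'.carrier ⊆ M₂'.carrier → a ∈ M₂'.carrier →
    s.Dnf M₀ a M₁ M₂ → s.Dnf M₀' a M₁' M₂'

/-- Local character, for increasing continuous sequences `⟨M α : α ≤ δ⟩` with `δ < κ⁺` limit. -/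
def LocalCharacter (s : Frame L) (κ : Cardinal.{u}) : Prop :=
  ∀ (δ : Ordinal.{u}) (M : Ordinal.{u} → Model L) (N : Model L) (a : ZFSet.{u}),
    δ < (Order.succ κ).ord → Order.IsSuccLimit δ → s.cls.IsChain (Order.succ δ) M →
    s.cls.le (M δ) N → s.Basic (M δ) N a → ∃ α < δ, s.TypeDnf (M α) (M δ) N a

/-- Uniqueness of the non-forking extension. -/
def Uniqueness (s : Frame L) : Prop :=
  ∀ M N N₁ N₂ a₁ a₂, s.cls.le M N → s.cls.le N N₁ → s.cls.le N N₂ →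
    s.TypeDnf M N N₁ a₁ → s.TypeDnf M N N₂ a₂ →
    s.K.SameType M N₁ a₁ N₂ a₂ → s.K.SameType N N₁ a₁ N₂ a₂

/-- Symmetry. -/
def Symmetry (s : Frame L) : Prop :=
  ∀ M₀ M₁ M₂ a₁ a₂, s.cls.le M₀ M₁ → s.cls.le M₁ M₂ →
    s.Basic M₀ M₁ a₁ → s.TypeDnf M₀ M₁ M₂ a₂ →
    ∃ M₃ M₄, s.cls.le M₀ M₃ ∧ s.cls.le M₃ M₄ ∧ s.cls.le M₂ M₄ ∧ a₂ ∈ M₃.carrier ∧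
      s.TypeDnf M₀ M₃ M₄ a₁

/-- Extension: a basic type over `M` has a non-forking extension over every `N ≽ M`. -/
def Extension (s : Frame L) : Prop :=
  ∀ M N, s.cls.le M N → ∀ p ∈ s.Sbs M, ∃ N' a, s.cls.le N N' ∧ s.K.IsTp p N' a ∧
    s.Basic N N' a ∧ s.TypeDnf M N N' a

/-- Continuity, for increasing continuous sequences `⟨M α : α ≤ δ⟩` with `δ < κ⁺` limit. -/
def Continuity (s : Frame L) (κ : Cardinal.{u}) : Prop :=
  ∀ (δ : Ordinal.{u}) (M : Ordinal.{u} → Model L) (N : Model L) (a : ZFSet.{u}),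
    δ < (Order.succ κ).ord → Order.IsSuccLimit δ → s.cls.IsChain (Order.succ δ) M →
    s.cls.le (M δ) N → a ∈ N.carrier → a ∉ (M δ).carrier →
    (∀ α < δ, s.TypeDnf (M 0) (M α) N a) →
    s.Basic (M δ) N a ∧ s.TypeDnf (M 0) (M δ) N a

/-- The axioms on `S^bs` and `Dnf`, for models of cardinality `κ`, where `μ` bounds the number of
basic types over a model. -/
structure Axioms (s : Frame L) (κ μ : Cardinal.{u}) : Prop where
  basicIso : s.BasicIso
  density : s.Density
  stability : s.BasicStability μ
  dnfBasic : s.DnfBasic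
  dnfIso : s.DnfIso
  monotonicity : s.Monotonicity
  localCharacter : s.LocalCharacter κ
  uniqueness : s.Uniqueness
  symmetry : s.Symmetry
  extension : s.Extension
  continuity : s.Continuity κ

/-- `s = (K, ≼, S^bs, Dnf)` is a semi-good non-forking `lam`-frame (the models of the frame are the
models in `K` of cardinality `lam`). -/
structure IsSemiGood (s : Frame L) (lam : Cardinal.{u}) : Prop where
  aec : s.K.IsAEC lam
  mod_iff : ∀ M, s.Mod M ↔ s.K.Mem M ∧ M.HasCard lam
  jep : s.cls.JEP
  ap : s.cls.AP
  noMaximal : s.cls.NoMaximal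
  frameAxioms : s.Axioms lam (Order.succ lam)

/-- `s` is a good non-forking `κ`-frame of the second version (based on an AEC in `κ`) minus the
joint embedding and amalgamation properties. -/
structure IsGoodMinusJEPAP (s : Frame L) (κ : Cardinal.{u}) : Prop where
  aecIn : s.cls.IsAECIn κ
  noMaximal : s.cls.NoMaximal
  frameAxioms : s.Axioms κ κ

/-- `s` is a good non-forking `κ`-frame of the second version minus the amalgamation property. -/
def IsGoodMinusAP (s : Frame L) (κ : Cardinal.{u}) : Prop :=
  s.IsGoodMinusJEPAP κ ∧ s.cls.JEP

/-! ### The frames derived from a `lam`-frame `s` -/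

/-- The extension of `Dnf` to models of cardinality at least `lam`. -/
def DnfGe (s : Frame L) (lam : Cardinal.{u}) (M₀ : Model L) (a : ZFSet.{u}) (M₁ M₂ : Model L) :
    Prop :=
  M₀.CardGe lam ∧ M₁.CardGe lam ∧ M₂.CardGe lam ∧ s.K.le M₀ M₁ ∧ s.K.le M₁ M₂ ∧
    a ∈ M₂.carrier ∧ a ∉ M₁.carrier ∧
    ∃ N₀, s.Mod N₀ ∧ s.K.le N₀ M₀ ∧
      ∀ N, s.Mod N → s.K.le N₀ N → s.K.le N M₁ → s.TypeDnf N₀ N M₂ a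

/-- `p ∈ S(M₁)` does not fork over `M₀`, for models of cardinality at least `lam`. -/
def PDnfGe (s : Frame L) (lam : Cardinal.{u}) (M₀ : Model L) {M₁ : Model L}
    (p : s.K.GType M₁) : Prop :=
  ∃ M₂ a, s.K.IsTp p M₂ a ∧ s.DnfGe lam M₀ a M₁ M₂

/-- The basic types over a model `M` of cardinality greater than `lam`: those that do not fork over
some `N ≼ M` of cardinality `lam`. -/
def SbsGt (s : Frame L) (lam : Cardinal.{u}) (M : Model L) : Set (s.K.GType M) :=
  {p | ∃ N, s.Mod N ∧ s.K.le N M ∧ s.PDnfGe lam N p}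

/-- The restriction to the models in a class `P` of the extension of `s` to larger models. -/
def derived (s : Frame L) (lam : Cardinal.{u}) (P : Model L → Prop) : Frame L where
  K := s.K
  Mod := P
  Sbs := s.SbsGt lam
  Dnf M₀ a M₁ M₂ := P M₀ ∧ P M₁ ∧ P M₂ ∧ s.DnfGe lam M₀ a M₁ M₂

/-- The frame `s_{lam⁺}` on the models in `K` of cardinality `lam⁺`. -/
def succFrame (s : Frame L) (lam : Cardinal.{u}) : Frame L :=
  s.derived lam (fun M => s.K.Mem M ∧ M.HasCard (Order.succ lam))

/-- The frame `s^sat` on the saturated models in `lam⁺` over `lam`. -/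
def satFrame (s : Frame L) (lam : Cardinal.{u}) : Frame L :=
  s.derived lam (s.K.IsSaturated lam)

/-- `(lam, lam⁺)`-tameness for non-forking types, over models `M₀` satisfying `P`. -/
def TameOver (s : Frame L) (lam : Cardinal.{u}) (P : Model L → Prop) : Prop :=
  ∀ M₀ M₁ M₂ : Model L, P M₀ →
    M₀.HasCard (Order.succ lam) → M₁.HasCard (Order.succ lam) → M₂.HasCard (Order.succ lam) →
    ∀ (p₁ p₂ : s.K.GType M₀) (a₁ a₂ : ZFSet.{u}), s.K.IsTp p₁ M₁ a₁ → s.K.IsTp p₂ M₂ a₂ →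
    (∃ N, s.Mod N ∧ s.K.le N M₀ ∧ s.K.SameType N M₁ a₁ M₂ a₂ ∧
      s.PDnfGe lam N p₁ ∧ s.PDnfGe lam N p₂) →
    p₁ = p₂

/-- `(lam, lam⁺)`-tameness for non-forking types. -/
def TameNF (s : Frame L) (lam : Cardinal.{u}) : Prop :=
  s.TameOver lam s.K.Mem

/-- `(lam, lam⁺)`-tameness for non-forking types over saturated models. -/
def TameNFSat (s : Frame L) (lam : Cardinal.{u}) : Prop :=
  s.TameOver lam (s.K.IsSaturated lam)

end Frame

end AECFrames

/-!
Every type considered here is controlled by its restrictions to models of cardinality `lam`, where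
the axioms of `s` apply. For `N₀` of cardinality `lam` and `N₀ ≼ M₁ ≼ M₂`, the central notion is
`Frame.NonForking s N₀ M₁ M₂ a`: all restrictions of the type of `a` over `M₁` to models of
cardinality `lam` between `N₀` and `M₁` do not fork over `N₀`. Both derived frames are restrictions
of this notion to a class `P` of models of cardinality `lam⁺`, and both parts of the theorem are
instances of `derived_axioms` and `derived_noMaximal`, for any such `P` that is cofinal among the
models of cardinality `lam⁺` and over which tameness holds.

* Non-forking over models of cardinality `lam` is transitive (`typeDnf_trans`), and equality of
  types over such models is witnessed in one amalgam of cardinality `lam`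
  (`exists_amalgam_of_sameType`).
* Density (`exists_nonForking`): if it fails for `M ≼ N`, a closure argument of length `ω` produces
  a pair of models of cardinality `lam` at which density contradicts local character.
* Extension (`exists_nonForking_extension`): a basic type over `N₀` extends to a non-forking type
  over any `M ≽ N₀` of cardinality `lam⁺`, by following a filtration of `M` with embeddings. This
  also shows that there is no maximal model in cardinality `lam⁺`.
* Local character and continuity: every model of cardinality `lam` inside the union of a chain is
  contained in the union of a chain of length less than `lam⁺` of models of cardinality `lam` inside
  earlier members (`exists_cofinal_chain`). This reduces both axioms to those of `s`.
* Tameness identifies a type that does not fork over `N₀` with its restriction to `N₀`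
  (`sameType_of_tame`). This gives uniqueness, extension between models of cardinality `lam⁺`, and
  the bound on the number of basic types (`derived_stability`).
* For saturated models, cofinality is obtained by realizing basic types `lam⁺` many times
  (`exists_basicSaturated`). A model that realizes all basic types over its small submodels is
  model homogeneous (`exists_embedding`), hence saturated: otherwise there is an embedding
  `f : A → B` which can be extended `lam⁺` times, each time with a new element of the current target
  in its range, and this is impossible because some stage is closed (`exists_inter_subset`). Model
  homogeneity also gives joint embedding (`exists_kMap_of_isSaturated`).

Embeddings are handled as maps `f : ZFSet → ZFSet` of the whole universe that are injective on the
carrier of a model (`AClass.KMap`). Since the universe of sets is not small, such maps can be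
extended with fresh values, which allows embeddings to be replaced by inclusions
(`KMap.exists_pullback`). Equality of types is transported along embeddings in `SameType.map`.
-/

namespace AECFrames

open Set

variable {L : FirstOrder.Language.{u, u}}

/-! ### Submodels, images of models and unions of chains -/

namespace Model

theorem IsSub.subset {M N : Model L} (h : M.IsSub N) : M.carrier ⊆ N.carrier := by
  obtain ⟨f, hf⟩ := h
  intro x hx
  have := (f ⟨x, hx⟩).2
  rwa [hf] at this

theorem IsSub.refl (M : Model L) : M.IsSub M :=
  ⟨FirstOrder.Language.Embedding.refl L _, fun _ => rfl⟩

theorem IsSub.of_subset {M₀ M₁ N : Model L} (h : M₀.carrier ⊆ M₁.carrier) (h₀ : M₀.IsSub N)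
    (h₁ : M₁.IsSub N) : M₀.IsSub M₁ := by
  obtain ⟨f, hf⟩ := h₀
  obtain ⟨g, hg⟩ := h₁
  have hgf : ∀ x, g (Set.inclusion h x) = f x := fun x => Subtype.ext (by simp [hf, hg])
  have hcomp : ∀ {n} (x : Fin n → M₀.carrier), g ∘ (Set.inclusion h ∘ x) = f ∘ x :=
    fun x => funext fun i => hgf _
  refine ⟨⟨⟨Set.inclusion h, Set.inclusion_injective h⟩, ?_, ?_⟩, fun x => rfl⟩
  · intro n F x
    apply g.injective
    change g (Set.inclusion h _) = g (FirstOrder.Language.Structure.funMap F (Set.inclusion h ∘ x))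
    rw [hgf, f.map_fun, g.map_fun, hcomp]
  · intro n R x
    change FirstOrder.Language.Structure.RelMap R (Set.inclusion h ∘ x) ↔ _
    rw [← g.map_rel, hcomp, f.map_rel]

theorem IsSub.eq {M N : Model L} (h : M.IsSub N) (hc : M.carrier = N.carrier) : M = N := by
  obtain ⟨c, hs, i⟩ := M
  obtain ⟨c', hs', i'⟩ := N
  obtain rfl : c = c' := hc
  obtain ⟨f, hf⟩ := h
  have hid : ∀ x, f x = x := fun x => Subtype.ext (hf x)
  have hid' : f.toFun = id := funext hid
  have hfun := @f.map_fun'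
  have hrel := @f.map_rel'
  rw [hid'] at hfun hrel
  congr 1
  refine FirstOrder.Language.Structure.ext ?_ ?_
  · funext n F x
    exact hfun F x
  · funext n R x
    exact propext (hrel R x).symm

theorem IsSub.of_subset_eq {M N : Model L} (h : M.IsSub N) (hc : N.carrier ⊆ M.carrier) :
    M = N :=
  h.eq (h.subset.antisymm hc)

theorem eq_of_equiv {M N₁ N₂ : Model L} (e₁ : M.carrier ≃[L] N₁.carrier)
    (e₂ : M.carrier ≃[L] N₂.carrier) (h : ∀ x, (e₁ x : ZFSet.{u}) = e₂ x) : N₁ = N₂ := by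
  refine IsSub.of_subset_eq ⟨(e₂.comp e₁.symm).toEmbedding, fun x => ?_⟩ ?_
  · change ((e₂ (e₁.symm x) : N₂.carrier) : ZFSet.{u}) = x
    rw [← h, e₁.apply_symm_apply]
  · intro x hx
    have : (e₁ (e₂.symm ⟨x, hx⟩) : ZFSet.{u}) = x := by rw [h, e₂.apply_symm_apply]
    rw [← this]
    exact Subtype.property _

/-- The image of the model `M` under a map `f` of the universe of sets that is injective on `M`
(and `M` itself if `f` is not injective on `M`). -/
noncomputable def map (M : Model L) (f : ZFSet.{u} → ZFSet.{u}) : Model L :=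
  open Classical in
  if h : InjOn f M.carrier then
    { carrier := f '' M.carrier
      small := have := M.small; inferInstance
      str := (Equiv.Set.imageOfInjOn f M.carrier h).inducedStructure }
  else M

theorem exists_mapEquiv {M : Model L} {f : ZFSet.{u} → ZFSet.{u}} (h : InjOn f M.carrier) :
    ∃ e : M.carrier ≃[L] (M.map f).carrier, ∀ x, (e x : ZFSet.{u}) = f x := by
  rw [map, dif_pos h]
  refine ⟨(Equiv.Set.imageOfInjOn f M.carrier h).inducedStructureEquiv, fun x => ?_⟩
  rfl

theorem map_carrier {M : Model L} {f : ZFSet.{u} → ZFSet.{u}} (h : InjOn f M.carrier) :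
    (M.map f).carrier = f '' M.carrier := by
  rw [map, dif_pos h]

theorem mem_map {M : Model L} {f : ZFSet.{u} → ZFSet.{u}} (h : InjOn f M.carrier) {x : ZFSet.{u}}
    (hx : x ∈ M.carrier) : f x ∈ (M.map f).carrier := by
  rw [map_carrier h]
  exact mem_image_of_mem f hx

theorem eq_map {M N : Model L} {f : ZFSet.{u} → ZFSet.{u}} (e : M.carrier ≃[L] N.carrier)
    (he : ∀ x, (e x : ZFSet.{u}) = f x) : InjOn f M.carrier ∧ N = M.map f := by
  have h : InjOn f M.carrier := by
    intro x hx y hy hxy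
    have h1 := he ⟨x, hx⟩
    have h2 := he ⟨y, hy⟩
    have := e.injective (Subtype.ext (h1.trans (hxy.trans h2.symm)))
    exact congrArg Subtype.val this
  obtain ⟨e', he'⟩ := exists_mapEquiv h
  exact ⟨h, eq_of_equiv e e' fun x => (he x).trans (he' x).symm⟩

theorem exists_eq_map {M N : Model L} (e : M.carrier ≃[L] N.carrier) :
    ∃ F : ZFSet.{u} → ZFSet.{u}, InjOn F M.carrier ∧ N = M.map F ∧
      ∀ x, (e x : ZFSet.{u}) = F x := by
  classical
  let F : ZFSet.{u} → ZFSet.{u} := fun x => if h : x ∈ M.carrier then e ⟨x, h⟩ else ∅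
  have he : ∀ x : M.carrier, (e x : ZFSet.{u}) = F x := fun x => by
    simp only [F, x.2, dif_pos]
  exact ⟨_, (eq_map e he).1, (eq_map e he).2, he⟩

theorem map_congr {M : Model L} {f g : ZFSet.{u} → ZFSet.{u}} (h : InjOn f M.carrier)
    (hfg : EqOn f g M.carrier) : M.map f = M.map g := by
  obtain ⟨e, he⟩ := exists_mapEquiv h
  exact (eq_map e fun x => (he x).trans (hfg x.2)).2

theorem map_eq_self {M : Model L} {f : ZFSet.{u} → ZFSet.{u}} (hf : EqOn f id M.carrier) :
    M.map f = M :=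
  (eq_map (FirstOrder.Language.Equiv.refl L _) fun x => (hf x.2).symm).2.symm

theorem map_map {M : Model L} {f g : ZFSet.{u} → ZFSet.{u}} (hf : InjOn f M.carrier)
    (hg : InjOn g (M.map f).carrier) : (M.map f).map g = M.map (g ∘ f) := by
  obtain ⟨e, he⟩ := exists_mapEquiv hf
  obtain ⟨e', he'⟩ := exists_mapEquiv hg
  exact (eq_map (e'.comp e) fun x => by
    rw [FirstOrder.Language.Equiv.comp_apply, he', he]; rfl).2

theorem IsSub.map {M N : Model L} {f : ZFSet.{u} → ZFSet.{u}} (h : M.IsSub N)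
    (hf : InjOn f N.carrier) : (M.map f).IsSub (N.map f) := by
  obtain ⟨e, he⟩ := exists_mapEquiv (hf.mono h.subset)
  obtain ⟨e', he'⟩ := exists_mapEquiv hf
  obtain ⟨i, hi⟩ := h
  refine ⟨(e'.toEmbedding.comp i).comp e.symm.toEmbedding, fun x => ?_⟩
  change ((e' (i (e.symm x)) : _) : ZFSet.{u}) = x
  rw [he', hi, ← he, e.apply_symm_apply]

theorem imageEq_map {M N N' : Model L} {f : ZFSet.{u} → ZFSet.{u}} (hMN : M.carrier ⊆ N.carrier)
    (hf : InjOn f M.carrier) {e : N.carrier → N'.carrier} (he : ∀ x, (e x : ZFSet.{u}) = f x) :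
    ImageEq e M (M.map f) := by
  rw [ImageEq, map_carrier hf]
  ext y
  exact ⟨fun ⟨x, hx, hy⟩ => ⟨⟨x, hMN hx⟩, hx, (he _).trans hy⟩,
    fun ⟨x, hx, hy⟩ => ⟨x, hx, (he x).symm.trans hy⟩⟩

theorem eq_map_of_imageEq {M N M' : Model L} {f : ZFSet.{u} → ZFSet.{u}}
    (hf : InjOn f N.carrier) (hM : M.IsSub N) {N' : Model L} (hN' : N' = N.map f)
    (hM' : M'.IsSub N') {e : N.carrier → N'.carrier} (he : ∀ x, (e x : ZFSet.{u}) = f x)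
    (h : ImageEq e M M') : M' = M.map f := by
  have hc : M'.carrier = (M.map f).carrier :=
    h.trans (imageEq_map hM.subset (hf.mono hM.subset) he).symm
  exact (IsSub.of_subset hc.le hM' (hN' ▸ hM.map hf)).eq hc

theorem mk_map {M : Model L} {f : ZFSet.{u} → ZFSet.{u}} (h : InjOn f M.carrier) :
    Cardinal.mk (M.map f).carrier = Cardinal.mk M.carrier := by
  obtain ⟨e, -⟩ := exists_mapEquiv h
  exact (Cardinal.mk_congr e.toEquiv).symm

theorem HasCard.map {M : Model L} {f : ZFSet.{u} → ZFSet.{u}} {κ : Cardinal.{u}}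
    (hM : M.HasCard κ) (h : InjOn f M.carrier) : (M.map f).HasCard κ :=
  (mk_map h).trans hM

end Model

/-- An injection defined on a subset of a small set extends to an injection of the whole set whose
new values avoid a given small set. -/
theorem exists_injOn_extension {A B C : Set ZFSet.{u}} [Small.{u} B] [Small.{u} C]
    {g : ZFSet.{u} → ZFSet.{u}} (hg : InjOn g B) :
    ∃ G : ZFSet.{u} → ZFSet.{u}, InjOn G A ∧ EqOn G g B ∧ ∀ x ∉ B, G x ∉ C := by
  classical
  let D : Set ZFSet.{u} := g '' B ∪ C
  let c : ZFSet.{u} := ZFSet.range fun x : Shrink.{u} D => ((equivShrink D).symm x : ZFSet.{u})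
  have hc : ∀ x ∈ D, x ∈ c := fun x hx =>
    ZFSet.mem_range.2 ⟨equivShrink D ⟨x, hx⟩, by simp⟩
  -- `pair c x` has an element that has `c` as an element, so it is not an element of `c`.
  have hfresh : ∀ x, ZFSet.pair c x ∉ D := by
    intro x hx
    have h1 : ({c} : ZFSet.{u}) ∈ ZFSet.pair c x := by simp [ZFSet.pair]
    have h2 : c ∈ ({c} : ZFSet.{u}) := by simp
    have := ZFSet.rank_lt_of_mem (hc _ hx)
    exact absurd (((ZFSet.rank_lt_of_mem h2).trans (ZFSet.rank_lt_of_mem h1)).trans this)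
      (lt_irrefl _)
  refine ⟨fun x => if x ∈ B then g x else ZFSet.pair c x, ?_, ?_, ?_⟩
  · intro x _ y _ hxy
    by_cases hxB : x ∈ B <;> by_cases hyB : y ∈ B <;> simp only [hxB, hyB, if_true, if_false] at hxy
    · exact hg hxB hyB hxy
    · exact absurd (hxy ▸ Or.inl (mem_image_of_mem g hxB)) (hfresh y)
    · exact absurd (hxy.symm ▸ Or.inl (mem_image_of_mem g hyB)) (hfresh x)
    · exact (ZFSet.pair_inj.1 hxy).2
  · intro x hx
    simp [hx]
  · intro x hx
    simp only [hx, if_false]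
    exact fun h => hfresh x (Or.inr h)

/-- An increasing sequence of models of limit length has a union. -/
theorem exists_isUnion {M : Ordinal.{u} → Model L}
    {δ : Ordinal.{u}} (hδ : Order.IsSuccLimit δ) (hM : ∀ α β, α < β → β < δ → (M α).IsSub (M β)) :
    ∃ U, IsUnion M δ U := by
  classical
  have hM' : ∀ α β, α ≤ β → β < δ → (M α).IsSub (M β) := fun α β h hβ => by
    rcases h.eq_or_lt with rfl | h
    exacts [Model.IsSub.refl _, hM _ _ h hβ]
  let c : Set ZFSet.{u} := {x | ∃ α < δ, x ∈ (M α).carrier}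
  have hsub : ∀ α < δ, (M α).carrier ⊆ c := fun α hα x hx => ⟨α, hα, hx⟩
  have hsmall : Small.{u} c := by
    have : c = ⋃ α : Iio δ, (M α).carrier := by ext x; simp [c]
    rw [this]
    have := fun α : Iio δ => (M α).small
    infer_instance
  have hfin : ∀ {n} (x : Fin n → c), ∃ α < δ, ∀ i, (x i : ZFSet.{u}) ∈ (M α).carrier := by
    intro n x
    choose f hf hf' using fun i => (x i).2
    rcases isEmpty_or_nonempty (Fin n) with h | h
    · exact ⟨0, hδ.bot_lt, fun i => isEmptyElim i⟩
    · obtain ⟨i₀, hi₀⟩ := Finite.exists_max f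
      exact ⟨f i₀, hf i₀, fun i => (hM' _ _ (hi₀ i) (hf i₀)).subset (hf' i)⟩
  choose a ha ha' using @hfin
  let inst : L.Structure c :=
    { funMap := fun {n} F x => Set.inclusion (hsub _ (ha x))
        (FirstOrder.Language.Structure.funMap F fun i => (⟨x i, ha' x i⟩ : (M (a x)).carrier))
      RelMap := fun {n} R x =>
        FirstOrder.Language.Structure.RelMap R fun i => (⟨x i, ha' x i⟩ : (M (a x)).carrier) }
  refine ⟨⟨c, hsmall, inst⟩, rfl, fun α hα => ?_⟩
  refine ⟨⟨⟨Set.inclusion (hsub α hα), Set.inclusion_injective _⟩, ?_, ?_⟩, fun _ => rfl⟩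
  · intro n F x
    let y : Fin n → c := Set.inclusion (hsub α hα) ∘ x
    obtain ⟨f, hf⟩ := hM' α (max α (a y)) (le_max_left _ _) (max_lt hα (ha y))
    obtain ⟨g, hg⟩ := hM' (a y) (max α (a y)) (le_max_right _ _) (max_lt hα (ha y))
    apply Subtype.ext
    change ((FirstOrder.Language.Structure.funMap F x : (M α).carrier) : ZFSet.{u}) =
      (FirstOrder.Language.Structure.funMap F fun i => (⟨y i, ha' y i⟩ : (M (a y)).carrier) :
        (M (a y)).carrier)
    rw [← hf, ← hg, f.map_fun, g.map_fun]
    congr 2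
    funext i
    exact Subtype.ext ((hf (x i)).trans (hg ⟨y i, ha' y i⟩).symm)
  · intro n R x
    let y : Fin n → c := Set.inclusion (hsub α hα) ∘ x
    obtain ⟨f, hf⟩ := hM' α (max α (a y)) (le_max_left _ _) (max_lt hα (ha y))
    obtain ⟨g, hg⟩ := hM' (a y) (max α (a y)) (le_max_right _ _) (max_lt hα (ha y))
    change FirstOrder.Language.Structure.RelMap R
      (fun i => (⟨y i, ha' y i⟩ : (M (a y)).carrier)) ↔ FirstOrder.Language.Structure.RelMap R x
    rw [← f.map_rel, ← g.map_rel]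
    have : (⇑g ∘ fun i => (⟨y i, ha' y i⟩ : (M (a y)).carrier)) = f ∘ x :=
      funext fun i => Subtype.ext ((hg _).trans (hf _).symm)
    rw [this]

/-! ### Embeddings as maps of the universe of sets, and Galois types -/

namespace AClass

variable {K : AClass L} {len : Ordinal.{u} → Prop}

/-- The restriction of the map `f` to `M` is a `K`-embedding of `M` into `N`. -/
def KMap (K : AClass L) (f : ZFSet.{u} → ZFSet.{u}) (M N : Model L) : Prop :=
  InjOn f M.carrier ∧ K.le (M.map f) N

theorem IsAECCore.subset (hK : K.IsAECCore len) {M N : Model L} (h : K.le M N) :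
    M.carrier ⊆ N.carrier :=
  (hK.le_sub _ _ h).subset

theorem IsAECCore.le_of_subset (hK : K.IsAECCore len) {M₀ M₁ N : Model L}
    (h : M₀.carrier ⊆ M₁.carrier) (h₀ : K.le M₀ N) (h₁ : K.le M₁ N) : K.le M₀ M₁ :=
  hK.coherence _ _ _ (.of_subset h (hK.le_sub _ _ h₀) (hK.le_sub _ _ h₁)) h₀ h₁

theorem IsAECCore.mem_map (hK : K.IsAECCore len) {M : Model L} {f : ZFSet.{u} → ZFSet.{u}}
    (h : K.Mem M) (hf : InjOn f M.carrier) : K.Mem (M.map f) :=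
  hK.mem_iso _ _ h ⟨(Model.exists_mapEquiv hf).choose⟩

theorem IsAECCore.le_map (hK : K.IsAECCore len) {M N : Model L} {f : ZFSet.{u} → ZFSet.{u}}
    (h : K.le M N) (hf : InjOn f N.carrier) : K.le (M.map f) (N.map f) := by
  obtain ⟨e, he⟩ := Model.exists_mapEquiv hf
  refine hK.le_iso M N _ _ e h ((hK.le_sub _ _ h).map hf) (Model.imageEq_map (hK.subset h) (hf.mono (hK.subset h)) he)

theorem KMap.mem_left (hK : K.IsAECCore len) {f : ZFSet.{u} → ZFSet.{u}} {M N : Model L}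
    (h : K.KMap f M N) : K.Mem M := by
  obtain ⟨e, -⟩ := Model.exists_mapEquiv h.1
  exact hK.mem_iso _ _ (hK.le_mem _ _ h.2).1 ⟨e.symm⟩

theorem KMap.mem {f : ZFSet.{u} → ZFSet.{u}} {M N : Model L} (hK : K.IsAECCore len)
    (h : K.KMap f M N) {x : ZFSet.{u}} (hx : x ∈ M.carrier) : f x ∈ N.carrier :=
  hK.subset h.2 (Model.mem_map h.1 hx)

theorem KMap.of_le {M N : Model L} (h : K.le M N) : K.KMap id M N :=
  ⟨injOn_id _, by rwa [Model.map_eq_self fun _ _ => rfl]⟩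

theorem KMap.of_injOn (hK : K.IsAECCore len) {f : ZFSet.{u} → ZFSet.{u}} {M : Model L}
    (hM : K.Mem M) (hf : InjOn f M.carrier) : K.KMap f M (M.map f) :=
  ⟨hf, hK.le_refl _ (hK.mem_map hM hf)⟩

theorem KMap.trans_le (hK : K.IsAECCore len) {f : ZFSet.{u} → ZFSet.{u}} {M N N' : Model L}
    (h : K.KMap f M N) (h' : K.le N N') : K.KMap f M N' :=
  ⟨h.1, hK.le_trans _ _ _ h.2 h'⟩

theorem KMap.comp (hK : K.IsAECCore len) {f g : ZFSet.{u} → ZFSet.{u}} {M N N' : Model L}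
    (hf : K.KMap f M N) (hg : K.KMap g N N') : K.KMap (g ∘ f) M N' := by
  have hg' := hg.1.mono (hK.subset hf.2)
  have hmaps : MapsTo f M.carrier (M.map f).carrier := fun x hx => Model.mem_map hf.1 hx
  refine ⟨hg'.comp hf.1 hmaps, ?_⟩
  rw [← Model.map_map hf.1 hg']
  exact hK.le_trans _ _ _ (hK.le_map hf.2 hg.1) hg.2

theorem KMap.restrict (hK : K.IsAECCore len) {f : ZFSet.{u} → ZFSet.{u}} {M₀ M N : Model L}
    (h : K.KMap f M N) (h₀ : K.le M₀ M) : K.KMap f M₀ N :=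
  (KMap.of_le h₀).comp hK h

/-- Two embeddings `f₁`, `f₂` of `N` yield the embedding `f₂ ∘ f₁⁻¹` of the image of `f₁`. -/
theorem KMap.exists_factor {f₁ f₂ : ZFSet.{u} → ZFSet.{u}} {N N₂ : Model L}
    (h₁ : InjOn f₁ N.carrier) (h₂ : K.KMap f₂ N N₂) :
    ∃ h, K.KMap h (N.map f₁) N₂ ∧ ∀ x ∈ N.carrier, h (f₁ x) = f₂ x := by
  classical
  have hh : ∀ x ∈ N.carrier, (f₂ ∘ Function.invFunOn f₁ N.carrier) (f₁ x) = f₂ x := fun x hx =>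
    congrArg f₂ (h₁.leftInvOn_invFunOn hx)
  have hinj : InjOn (f₂ ∘ Function.invFunOn f₁ N.carrier) (N.map f₁).carrier := by
    rw [Model.map_carrier h₁]
    rintro _ ⟨x, hx, rfl⟩ _ ⟨y, hy, rfl⟩ hxy
    rw [hh x hx, hh y hy] at hxy
    rw [h₂.1 hx hy hxy]
  refine ⟨_, ⟨hinj, ?_⟩, hh⟩
  rw [Model.map_map h₁ hinj, ← Model.map_congr h₂.1 (g := _ ∘ f₁) fun x hx => (hh x hx).symm]
  exact h₂.2

/-- The target of an embedding can be renamed so that the embedding becomes the inclusion map. -/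
theorem KMap.exists_pullback (hK : K.IsAECCore len) {f : ZFSet.{u} → ZFSet.{u}} {M N : Model L}
    (h : K.KMap f M N) :
    ∃ G, InjOn G N.carrier ∧ K.le M (N.map G) ∧ ∀ x ∈ M.carrier, G (f x) = x := by
  obtain ⟨g, hg, hgf⟩ := KMap.exists_factor h.1 (KMap.of_le (hK.le_refl _ (h.mem_left hK)))
  have := (M.map f).small
  obtain ⟨G, hG, hGg, -⟩ := exists_injOn_extension (A := N.carrier) (C := ∅) hg.1
  have hGf : ∀ x ∈ M.carrier, G (f x) = x := fun x hx =>
    (hGg (Model.mem_map h.1 hx)).trans (hgf x hx)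
  refine ⟨G, hG, ?_, hGf⟩
  have := hK.le_map h.2 hG
  rwa [Model.map_map h.1 (hG.mono (hK.subset h.2)), Model.map_eq_self (f := G ∘ f) hGf] at this

theorem IsEmb.exists_kMap (hK : K.IsAECCore len) {M N : Model L} {e : M.carrier ↪[L] N.carrier}
    (h : K.IsEmb e) : ∃ F, K.KMap F M N ∧ ∀ x : M.carrier, F x = e x := by
  classical
  obtain ⟨M', hM', hi⟩ := h
  let F : ZFSet.{u} → ZFSet.{u} := fun x => if h : x ∈ M.carrier then e ⟨x, h⟩ else ∅
  have hF : ∀ x : M.carrier, F x = e x := fun x => dif_pos x.2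
  have hinj : InjOn F M.carrier := fun x hx y hy hxy => by
    have := e.injective (Subtype.ext ((hF ⟨x, hx⟩).symm.trans (hxy.trans (hF ⟨y, hy⟩))))
    exact congrArg Subtype.val this
  obtain ⟨i, hi'⟩ := Model.exists_mapEquiv hinj
  have hsub : (M.map F).IsSub N := ⟨e.comp i.symm.toEmbedding, fun x => by
    change ((e (i.symm x) : _) : ZFSet.{u}) = x
    rw [← hF, ← hi', i.apply_symm_apply]⟩
  have hc : (M.map F).carrier = M'.carrier := by
    exact (Model.imageEq_map subset_rfl hinj fun x => (hF x).symm).trans hi.symm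
  refine ⟨F, ⟨hinj, ?_⟩, hF⟩
  rwa [(Model.IsSub.of_subset hc.le hsub (hK.le_sub _ _ hM')).eq hc]

theorem KMap.exists_isEmb (hK : K.IsAECCore len) {F : ZFSet.{u} → ZFSet.{u}} {M N : Model L}
    (h : K.KMap F M N) :
    ∃ e : M.carrier ↪[L] N.carrier, K.IsEmb e ∧ ∀ x : M.carrier, (e x : ZFSet.{u}) = F x := by
  obtain ⟨i, hi⟩ := Model.exists_mapEquiv h.1
  obtain ⟨j, hj⟩ := hK.le_sub _ _ h.2
  have he : ∀ x, ((j.comp i.toEmbedding) x : ZFSet.{u}) = F x := fun x => (hj _).trans (hi x)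
  exact ⟨j.comp i.toEmbedding, ⟨_, h.2, Model.imageEq_map subset_rfl h.1 he⟩, he⟩

theorem eStar_iff (hK : K.IsAECCore len) {M : Model L} {s t : K.Triple M} :
    K.EStar M s t ↔ ∃ M₃ F₁ F₂, K.KMap F₁ s.N M₃ ∧ K.KMap F₂ t.N M₃ ∧ EqOn F₁ id M.carrier ∧
      EqOn F₂ id M.carrier ∧ F₁ s.a = F₂ t.a := by
  constructor
  · rintro ⟨M₃, f₁, f₂, ⟨-, h₁, h₂, h₃, h₄⟩, h₅⟩
    obtain ⟨F₁, hF₁, hF₁'⟩ := h₁.exists_kMap hK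
    obtain ⟨F₂, hF₂, hF₂'⟩ := h₂.exists_kMap hK
    refine ⟨M₃, F₁, F₂, hF₁, hF₂, fun x hx => ?_, fun x hx => ?_, ?_⟩
    · exact (hF₁' ⟨x, hK.subset s.le hx⟩).trans (h₃ _ hx)
    · exact (hF₂' ⟨x, hK.subset t.le hx⟩).trans (h₄ _ hx)
    · exact (hF₁' ⟨s.a, s.mem⟩).trans ((congrArg Subtype.val h₅).trans (hF₂' ⟨t.a, t.mem⟩).symm)
  · rintro ⟨M₃, F₁, F₂, h₁, h₂, h₃, h₄, h₅⟩
    obtain ⟨f₁, hf₁, hf₁'⟩ := h₁.exists_isEmb hK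
    obtain ⟨f₂, hf₂, hf₂'⟩ := h₂.exists_isEmb hK
    refine ⟨M₃, f₁, f₂, ⟨(hK.le_mem _ _ h₁.2).2, hf₁, hf₂, fun x hx => ?_, fun x hx => ?_⟩, ?_⟩
    · exact (hf₁' x).trans (h₃ hx)
    · exact (hf₂' x).trans (h₄ hx)
    · exact Subtype.ext ((hf₁' ⟨s.a, s.mem⟩).trans (h₅.trans (hf₂' ⟨t.a, t.mem⟩).symm))

theorem IsTp.le {M N : Model L} {p : K.GType M} {a : ZFSet.{u}} (h : K.IsTp p N a) : K.le M N := by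
  obtain ⟨t, rfl, rfl, -⟩ := h
  exact t.le

theorem IsTp.mem {M N : Model L} {p : K.GType M} {a : ZFSet.{u}} (h : K.IsTp p N a) :
    a ∈ N.carrier := by
  obtain ⟨t, rfl, rfl, -⟩ := h
  exact t.mem

theorem IsTp.notMem {M N : Model L} {p : K.GType M} {a : ZFSet.{u}} (h : K.IsTp p N a) :
    a ∉ M.carrier := by
  obtain ⟨t, rfl, rfl, -⟩ := h
  exact t.not_mem

theorem IsTp.unique {M N : Model L} {p q : K.GType M} {a : ZFSet.{u}} (hp : K.IsTp p N a)
    (hq : K.IsTp q N a) : p = q := by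
  obtain ⟨⟨N, a, _, _, _⟩, rfl, rfl, rfl⟩ := hp
  obtain ⟨⟨N', a', _, _, _⟩, h1, h2, rfl⟩ := hq
  obtain rfl : N' = N := h1
  obtain rfl : a' = a := h2
  rfl

theorem exists_isTp {M N : Model L} {a : ZFSet.{u}} (h : K.le M N) (ha : a ∈ N.carrier)
    (ha' : a ∉ M.carrier) : ∃ p : K.GType M, K.IsTp p N a :=
  ⟨_, ⟨N, a, h, ha, ha'⟩, rfl, rfl, rfl⟩

theorem exists_isTp' {M : Model L} (p : K.GType M) : ∃ N a, K.IsTp p N a := by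
  obtain ⟨t, rfl⟩ := Quot.exists_rep p
  exact ⟨t.N, t.a, t, rfl, rfl, rfl⟩

theorem IsTp.of_sameType {M N₁ N₂ : Model L} {p : K.GType M} {a₁ a₂ : ZFSet.{u}}
    (h : K.IsTp p N₁ a₁) (h' : K.SameType M N₁ a₁ N₂ a₂) : K.IsTp p N₂ a₂ := by
  obtain ⟨q, h₁, h₂⟩ := h'
  rwa [h.unique h₁]

theorem IsTp.eq_of_sameType {M N₁ N₂ : Model L} {p q : K.GType M} {a₁ a₂ : ZFSet.{u}}
    (hp : K.IsTp p N₁ a₁) (hq : K.IsTp q N₂ a₂) (h : K.SameType M N₁ a₁ N₂ a₂) : p = q :=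
  (hp.of_sameType h).unique hq

namespace SameType

theorem refl {M N : Model L} {a : ZFSet.{u}} (h : K.le M N) (ha : a ∈ N.carrier)
    (ha' : a ∉ M.carrier) : K.SameType M N a N a := by
  obtain ⟨p, hp⟩ := exists_isTp h ha ha'
  exact ⟨p, hp, hp⟩

theorem symm {M N₁ N₂ : Model L} {a₁ a₂ : ZFSet.{u}} (h : K.SameType M N₁ a₁ N₂ a₂) :
    K.SameType M N₂ a₂ N₁ a₁ := by
  obtain ⟨p, h₁, h₂⟩ := h
  exact ⟨p, h₂, h₁⟩

theorem trans {M N₁ N₂ N₃ : Model L} {a₁ a₂ a₃ : ZFSet.{u}} (h : K.SameType M N₁ a₁ N₂ a₂)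
    (h' : K.SameType M N₂ a₂ N₃ a₃) : K.SameType M N₁ a₁ N₃ a₃ := by
  obtain ⟨p, h₁, h₂⟩ := h
  exact ⟨p, h₁, h₂.of_sameType h'⟩

theorem le_left {M N₁ N₂ : Model L} {a₁ a₂ : ZFSet.{u}} (h : K.SameType M N₁ a₁ N₂ a₂) :
    K.le M N₁ := h.choose_spec.1.le

theorem mem_left {M N₁ N₂ : Model L} {a₁ a₂ : ZFSet.{u}} (h : K.SameType M N₁ a₁ N₂ a₂) :
    a₁ ∈ N₁.carrier := h.choose_spec.1.mem

theorem notMem_left {M N₁ N₂ : Model L} {a₁ a₂ : ZFSet.{u}} (h : K.SameType M N₁ a₁ N₂ a₂) :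
    a₁ ∉ M.carrier := h.choose_spec.1.notMem

theorem exists_eqvGen {M N₁ N₂ : Model L} {a₁ a₂ : ZFSet.{u}} (h : K.SameType M N₁ a₁ N₂ a₂) :
    ∃ s t : K.Triple M, s.N = N₁ ∧ s.a = a₁ ∧ t.N = N₂ ∧ t.a = a₂ ∧
      Relation.EqvGen (K.EStar M) s t := by
  obtain ⟨p, ⟨s, hs, hs', rfl⟩, ⟨t, ht, ht', h⟩⟩ := h
  exact ⟨s, t, hs, hs', ht, ht', Quot.eqvGen_exact h⟩

theorem of_eqvGen {M : Model L} {s t : K.Triple M} (h : Relation.EqvGen (K.EStar M) s t) :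
    K.SameType M s.N s.a t.N t.a :=
  ⟨Quot.mk _ s, ⟨s, rfl, rfl, rfl⟩, ⟨t, rfl, rfl, Quot.eqvGen_sound h⟩⟩

/-- Elements that become equal in an amalgam over `M` have the same type over `M`. -/
theorem of_kMap (hK : K.IsAECCore len) {M N₁ N₂ M₃ : Model L} {a₁ a₂ : ZFSet.{u}}
    {F₁ F₂ : ZFSet.{u} → ZFSet.{u}} (h₁ : K.le M N₁) (ha₁ : a₁ ∈ N₁.carrier)
    (ha₁' : a₁ ∉ M.carrier) (h₂ : K.le M N₂) (ha₂ : a₂ ∈ N₂.carrier) (hF₁ : K.KMap F₁ N₁ M₃)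
    (hF₂ : K.KMap F₂ N₂ M₃) (hF₁' : EqOn F₁ id M.carrier) (hF₂' : EqOn F₂ id M.carrier)
    (h : F₁ a₁ = F₂ a₂) : K.SameType M N₁ a₁ N₂ a₂ := by
  have ha₂' : a₂ ∉ M.carrier := fun hm => by
    rw [hF₂' hm] at h
    have := hF₁.1 ha₁ (hK.subset h₁ hm) (h.trans (hF₁' hm).symm)
    exact ha₁' (this ▸ hm)
  exact of_eqvGen (s := ⟨N₁, a₁, h₁, ha₁, ha₁'⟩) (t := ⟨N₂, a₂, h₂, ha₂, ha₂'⟩)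
    (.rel _ _ ((eStar_iff hK).2 ⟨M₃, F₁, F₂, hF₁, hF₂, hF₁', hF₂', h⟩))

theorem of_le (hK : K.IsAECCore len) {M N N' : Model L} {a : ZFSet.{u}} (h : K.le M N)
    (h' : K.le N N') (ha : a ∈ N.carrier) (ha' : a ∉ M.carrier) : K.SameType M N a N' a :=
  of_kMap hK h ha ha' (hK.le_trans _ _ _ h h') (hK.subset h' ha) (KMap.of_le h')
    (KMap.of_le (hK.le_refl _ (hK.le_mem _ _ h').2)) (fun _ _ => rfl) (fun _ _ => rfl) rfl

theorem of_kMap_fix (hK : K.IsAECCore len) {M N N' : Model L} {a : ZFSet.{u}}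
    {f : ZFSet.{u} → ZFSet.{u}} (h : K.le M N) (hf : K.KMap f N N') (hfM : EqOn f id M.carrier)
    (ha : a ∈ N.carrier) (ha' : a ∉ M.carrier) : K.SameType M N a N' (f a) := by
  have hM := (hf.restrict hK h).2
  rw [Model.map_eq_self hfM] at hM
  exact of_kMap hK h ha ha' hM (hf.mem hK ha) hf
    (KMap.of_le (hK.le_refl _ (hK.le_mem _ _ hf.2).2)) hfM (fun _ _ => rfl) rfl

theorem restrict (hK : K.IsAECCore len) {M₀ M N₁ N₂ : Model L} {a₁ a₂ : ZFSet.{u}}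
    (h : K.SameType M N₁ a₁ N₂ a₂) (hM : K.le M₀ M) : K.SameType M₀ N₁ a₁ N₂ a₂ := by
  obtain ⟨s, t, rfl, rfl, rfl, rfl, hst⟩ := h.exists_eqvGen
  clear h
  have hle : ∀ s : K.Triple M, K.le M₀ s.N := fun s => hK.le_trans _ _ _ hM s.le
  have hnot : ∀ s : K.Triple M, s.a ∉ M₀.carrier := fun s h => s.not_mem (hK.subset hM h)
  induction hst with
  | rel s t h =>
    obtain ⟨M₃, F₁, F₂, h₁, h₂, h₃, h₄, h₅⟩ := (eStar_iff hK).1 h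
    exact of_kMap hK (hle s) s.mem (hnot s) (hle t) t.mem h₁ h₂ (h₃.mono (hK.subset hM))
      (h₄.mono (hK.subset hM)) h₅
  | refl s => exact .refl (hle s) s.mem (hnot s)
  | symm s t _ ih => exact ih.symm
  | trans s t r _ _ ih ih' => exact ih.trans ih'

theorem of_two_kMaps (hK : K.IsAECCore len) {M N N₁ N₂ : Model L} {a : ZFSet.{u}}
    {f₁ f₂ : ZFSet.{u} → ZFSet.{u}} (h : K.le M N) (ha : a ∈ N.carrier) (ha' : a ∉ M.carrier)
    (hf₁ : K.KMap f₁ N N₁) (hf₂ : K.KMap f₂ N N₂) (hM : EqOn f₁ f₂ M.carrier) :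
    K.SameType (M.map f₁) N₁ (f₁ a) N₂ (f₂ a) := by
  obtain ⟨k, hk, hk'⟩ := KMap.exists_factor hf₁.1 hf₂
  have hle := hK.le_map h hf₁.1
  have hMN := hK.subset h
  have hinj := hf₁.1.mono hMN
  have hmem := Model.mem_map hf₁.1 ha
  have hnot : f₁ a ∉ (M.map f₁).carrier := by
    rw [Model.map_carrier hinj]
    rintro ⟨x, hx, hxa⟩
    exact ha' (hf₁.1 (hMN hx) ha hxa ▸ hx)
  rw [← hk' a ha]
  refine (of_le hK hle hf₁.2 hmem hnot).symm.trans (of_kMap_fix hK hle hk ?_ hmem hnot)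
  rw [Model.map_carrier hinj]
  rintro _ ⟨x, hx, rfl⟩
  exact (hk' x (hMN hx)).trans (hM hx).symm

/-- Equality of types is preserved by embeddings that agree on the base model. -/
theorem map (hK : K.IsAECCore len) {M N₁ N₂ N₁' N₂' : Model L} {a₁ a₂ : ZFSet.{u}}
    {f₁ f₂ : ZFSet.{u} → ZFSet.{u}} (h : K.SameType M N₁ a₁ N₂ a₂) (hf₁ : K.KMap f₁ N₁ N₁')
    (hf₂ : K.KMap f₂ N₂ N₂') (hf : EqOn f₁ f₂ M.carrier) :
    K.SameType (M.map f₁) N₁' (f₁ a₁) N₂' (f₂ a₂) := by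
  obtain ⟨s, t, rfl, rfl, rfl, rfl, hst⟩ := h.exists_eqvGen
  clear h
  have hsymm : ∀ {f₁ f₂ : ZFSet.{u} → ZFSet.{u}} {s : K.Triple M} {N}, K.KMap f₁ s.N N →
      EqOn f₁ f₂ M.carrier → M.map f₁ = M.map f₂ := fun {_ _ s _} h h' =>
    Model.map_congr (h.1.mono (hK.subset s.le)) h'
  have := M.small
  induction hst generalizing f₁ f₂ N₁' N₂' with
  | rel s t h =>
    obtain ⟨M₃, F₁, F₂, h₁, h₂, h₃, h₄, h₅⟩ := (eStar_iff hK).1 h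
    obtain ⟨G, hG, hGf, -⟩ := exists_injOn_extension (A := M₃.carrier) (C := ∅)
      (hf₁.1.mono (hK.subset s.le))
    have hM₃ := KMap.of_injOn hK (hK.le_mem _ _ h₁.2).2 hG
    have e₁ : EqOn f₁ (G ∘ F₁) M.carrier := fun x hx => by
      simp only [Function.comp, h₃ hx, id, hGf hx]
    have e₂ : EqOn (G ∘ F₂) f₂ M.carrier := fun x hx => by
      simp only [Function.comp, h₄ hx, id, hGf hx, hf hx]
    refine (of_two_kMaps hK s.le s.mem s.not_mem hf₁ (h₁.comp hK hM₃) e₁).trans ?_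
    rw [hsymm hf₁ hf, ← hsymm (h₂.comp hK hM₃) e₂]
    have := of_two_kMaps hK t.le t.mem t.not_mem (h₂.comp hK hM₃) hf₂ e₂
    rwa [Function.comp, ← h₅] at this
  | refl s => exact of_two_kMaps hK s.le s.mem s.not_mem hf₁ hf₂ hf
  | symm s t _ ih =>
    rw [hsymm hf₁ hf]
    exact (ih hf.symm hf₂ hf₁).symm
  | trans s t r _ _ ih ih' =>
    obtain ⟨G, hG, hGf, -⟩ := exists_injOn_extension (A := t.N.carrier) (C := ∅)
      (hf₁.1.mono (hK.subset s.le))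
    have ht := KMap.of_injOn hK (hK.le_mem _ _ t.le).2 hG
    refine (ih hGf.symm hf₁ ht).trans ?_
    rw [hsymm hf₁ hGf.symm]
    exact ih' (hGf.trans hf) ht hf₂

end SameType

theorem IsTp.mono_top (hK : K.IsAECCore len) {M N N' : Model L} {p : K.GType M} {a : ZFSet.{u}}
    (h : K.IsTp p N a) (hN : K.le N N') : K.IsTp p N' a :=
  h.of_sameType (.of_le hK h.le hN h.mem h.notMem)

end AClass

/-! ### Cardinal arithmetic of increasing sequences -/

theorem isSuccLimit_ord_succ {lam : Cardinal.{u}} (hlam : Cardinal.aleph0 ≤ lam) :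
    Order.IsSuccLimit (Order.succ lam).ord :=
  Cardinal.isSuccLimit_ord (hlam.trans (Order.le_succ lam))

/-- `lam⁺` is regular: a set of at most `lam` ordinals below `lam⁺` is bounded below `lam⁺`. -/
theorem exists_bound_lt_ord_succ {lam : Cardinal.{u}} (hlam : Cardinal.aleph0 ≤ lam)
    {Y : Type (u + 1)} {X : Set Y} (hX : Cardinal.mk X ≤ Cardinal.lift.{u + 1} lam)
    {a : Y → Ordinal.{u}} (ha : ∀ x ∈ X, a x < (Order.succ lam).ord) :
    ∃ β < (Order.succ lam).ord, ∀ x ∈ X, a x ≤ β := by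
  have hs : ∀ i ∈ a '' X, i < (Order.succ lam).ord := by
    rintro _ ⟨x, hx, rfl⟩
    exact ha x hx
  refine ⟨sSup (a '' X), Ordinal.sSup_lt_of_lt_cof ?_ hs, fun x hx =>
    le_csSup ⟨_, fun i hi => (hs i hi).le⟩ (mem_image_of_mem a hx)⟩
  rw [← Ordinal.lift_cof, (Cardinal.isRegular_succ hlam).cof_ord]
  exact (Cardinal.mk_image_le.trans hX).trans_lt (Cardinal.lift_lt.2 (Order.lt_succ lam))

theorem exists_enumeration {κ : Cardinal.{u}} {Y : Type (u + 1)} [Nonempty Y]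
    (hY : Cardinal.mk Y ≤ Cardinal.lift.{u + 1} κ) :
    ∃ e : Ordinal.{u} → Y, ∀ y, ∃ i < κ.ord, e i = y := by
  classical
  rw [← Cardinal.card_ord κ, ← Cardinal.mk_Iio_ordinal, Cardinal.le_def] at hY
  obtain ⟨f⟩ := hY
  refine ⟨Function.invFun fun y => ((f y : Iio κ.ord) : Ordinal.{u}), fun y => ⟨f y, (f y).2, ?_⟩⟩
  exact Function.leftInverse_invFun (fun a b h => f.injective (Subtype.ext h)) y

theorem mk_iUnion_Iio_le {κ : Cardinal.{u}} (hκ : Cardinal.aleph0 ≤ κ) {Y : Type (u + 1)}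
    {δ : Ordinal.{u}} (hδ : δ.card ≤ κ) {X : Ordinal.{u} → Set Y}
    (hX : ∀ α < δ, Cardinal.mk (X α) ≤ Cardinal.lift.{u + 1} κ) :
    Cardinal.mk {x | ∃ α < δ, x ∈ X α} ≤ Cardinal.lift.{u + 1} κ := by
  have h : {x | ∃ α < δ, x ∈ X α} = ⋃ α : Iio δ, X α := by ext x; simp
  rw [h]
  refine (Cardinal.mk_iUnion_le _).trans ?_
  rw [← Cardinal.mul_eq_self (Cardinal.aleph0_le_lift.2 hκ), Cardinal.mk_Iio_ordinal]
  exact mul_le_mul' (Cardinal.lift_le.2 hδ) (ciSup_le' fun α => hX α α.2)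

theorem mk_union_le {κ : Cardinal.{u}} (hκ : Cardinal.aleph0 ≤ κ) {Y : Type (u + 1)} {A B : Set Y}
    (hA : Cardinal.mk A ≤ Cardinal.lift.{u + 1} κ) (hB : Cardinal.mk B ≤ Cardinal.lift.{u + 1} κ) :
    Cardinal.mk (A ∪ B : Set Y) ≤ Cardinal.lift.{u + 1} κ := by
  refine (Cardinal.mk_union_le _ _).trans ?_
  rw [← Cardinal.add_eq_self (Cardinal.aleph0_le_lift.2 hκ)]
  exact add_le_add hA hB

theorem mk_singleton_le {κ : Cardinal.{u}} (hκ : Cardinal.aleph0 ≤ κ) {Y : Type (u + 1)} (a : Y) :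
    Cardinal.mk ({a} : Set Y) ≤ Cardinal.lift.{u + 1} κ := by
  rw [Cardinal.mk_singleton]
  exact Cardinal.one_le_aleph0.trans (Cardinal.aleph0_le_lift.2 hκ)

theorem mk_biUnion_le {κ : Cardinal.{u}} (hκ : Cardinal.aleph0 ≤ κ) {Y Z : Type (u + 1)}
    {A : Set Z} (hA : Cardinal.mk A ≤ Cardinal.lift.{u + 1} κ) {X : Z → Set Y}
    (hX : ∀ a ∈ A, Cardinal.mk (X a) ≤ Cardinal.lift.{u + 1} κ) :
    Cardinal.mk (⋃ a ∈ A, X a) ≤ Cardinal.lift.{u + 1} κ := by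
  refine (Cardinal.mk_biUnion_le _ _).trans ?_
  rw [← Cardinal.mul_eq_self (Cardinal.aleph0_le_lift.2 hκ)]
  exact mul_le_mul' hA (ciSup_le' fun α => hX α α.2)

theorem exists_subset_of_mk_le {lam : Cardinal.{u}} (hlam : Cardinal.aleph0 ≤ lam)
    {Y : Type (u + 1)} {X : Set Y} (hX : Cardinal.mk X ≤ Cardinal.lift.{u + 1} lam)
    {A : Ordinal.{u} → Set Y} (hA : ∀ α β, α < β → β < (Order.succ lam).ord → A α ⊆ A β)
    (h : ∀ x ∈ X, ∃ α < (Order.succ lam).ord, x ∈ A α) :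
    ∃ α < (Order.succ lam).ord, X ⊆ A α := by
  choose! a ha ha' using h
  obtain ⟨β, hβ, hb⟩ := exists_bound_lt_ord_succ hlam hX ha
  refine ⟨β, hβ, fun x hx => ?_⟩
  rcases (hb x hx).eq_or_lt with h | h
  · exact h ▸ ha' x hx
  · exact hA _ _ h hβ (ha' x hx)

/-- If `A` and `B` are increasing sequences of length `lam⁺`, the sets `A α` have cardinality at
most `lam`, and `B` is continuous, then there is a stage at which `A` and the union of `B` meet
only in the current set of the sequence `B`. -/
theorem exists_inter_subset {lam : Cardinal.{u}} (hlam : Cardinal.aleph0 ≤ lam)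
    {Y : Type (u + 1)} {A B : Ordinal.{u} → Set Y}
    (hA : ∀ α < (Order.succ lam).ord, Cardinal.mk (A α) ≤ Cardinal.lift.{u + 1} lam)
    (hA' : ∀ α < (Order.succ lam).ord, Order.IsSuccLimit α → A α = {x | ∃ β < α, x ∈ A β})
    (hAm : ∀ α β, α < β → β < (Order.succ lam).ord → A α ⊆ A β)
    (hB : ∀ α β, α < β → β < (Order.succ lam).ord → B α ⊆ B β) :
    ∃ α < (Order.succ lam).ord, ∀ β < (Order.succ lam).ord, A α ∩ B β ⊆ B α := by
  set θ := (Order.succ lam).ord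
  have hθ : Order.IsSuccLimit θ := isSuccLimit_ord_succ hlam
  have hstep : ∀ α < θ, ∃ γ < θ, α < γ ∧ ∀ β < θ, A α ∩ B β ⊆ B γ := by
    intro α hα
    obtain ⟨γ, hγ, h⟩ := exists_subset_of_mk_le hlam
      (X := A α ∩ {x | ∃ β < θ, x ∈ B β}) ((Cardinal.mk_le_mk_of_subset inter_subset_left).trans
        (hA α hα)) hB (fun x hx => hx.2)
    have hmax : max γ (Order.succ α) < θ := max_lt hγ (hθ.succ_lt hα)
    refine ⟨max γ (Order.succ α), hmax, (Order.lt_succ α).trans_le (le_max_right _ _), ?_⟩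
    intro β hβ x hx
    have := h ⟨hx.1, β, hβ, hx.2⟩
    rcases (le_max_left γ (Order.succ α)).eq_or_lt with e | e
    · rwa [← e]
    · exact hB _ _ e hmax this
  choose! g hg hg' hg'' using hstep
  let s : ℕ → Ordinal.{u} := fun n => g^[n] 0
  have hs : ∀ n, s (n + 1) = g (s n) := fun n => Function.iterate_succ_apply' g n 0
  have hsθ : ∀ n, s n < θ := by
    intro n
    induction n with
    | zero => exact hθ.bot_lt
    | succ n ih => rw [hs]; exact hg _ ih
  have hlt : ∀ n, s n < s (n + 1) := fun n => hs n ▸ hg' _ (hsθ n)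
  have hbdd : BddAbove (range s) := ⟨θ, by rintro _ ⟨n, rfl⟩; exact (hsθ n).le⟩
  have hsup : ∀ n, s n < ⨆ n, s n := fun n => (hlt n).trans_le (le_ciSup hbdd (n + 1))
  have hlim : Order.IsSuccLimit (⨆ n, s n) := by
    refine (Order.isSuccLimit_iff _).2 ⟨?_, ?_⟩
    · rw [isMin_iff_eq_bot]
      exact ((bot_le.trans_lt (hsup 0))).ne'
    · refine Order.isSuccPrelimit_of_succ_lt fun a ha => ?_
      obtain ⟨n, hn⟩ := exists_lt_of_lt_ciSup ha
      exact (Order.succ_le_of_lt hn).trans_lt (hsup n)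
  have hδ : ⨆ n, s n < θ := by
    obtain ⟨β, hβ, h⟩ := exists_bound_lt_ord_succ hlam (X := (univ : Set (ULift.{u + 1} ℕ)))
      (a := fun n => s n.down) (by simpa using hlam) (fun n _ => hsθ n.down)
    exact (ciSup_le' fun n => h ⟨n⟩ (mem_univ _)).trans_lt hβ
  refine ⟨_, hδ, fun β hβ x hx => ?_⟩
  rw [hA' _ hδ hlim] at hx
  obtain ⟨⟨γ, hγ, hxγ⟩, hxB⟩ := hx
  obtain ⟨n, hn⟩ := exists_lt_of_lt_ciSup hγ
  have := hg'' _ (hsθ n) β hβ ⟨hAm _ _ hn (hsθ n) hxγ, hxB⟩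
  rw [← hs] at this
  exact hB _ _ (hsup (n + 1)) hδ this

/-- A family of at most `lam` ordinals below a limit ordinal `δ` is dominated by an increasing
sequence in `δ` whose length is a limit ordinal `μ < lam⁺`. -/
theorem exists_dominating_sequence {lam : Cardinal.{u}} (hlam : Cardinal.aleph0 ≤ lam)
    {δ : Ordinal.{u}} (hδ : Order.IsSuccLimit δ) {a : Ordinal.{u} → Ordinal.{u}}
    (ha : ∀ j < lam.ord, a j < δ) :
    ∃ (μ : Ordinal.{u}) (h : Ordinal.{u} → Ordinal.{u}), μ < (Order.succ lam).ord ∧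
      Order.IsSuccLimit μ ∧ (∀ i < μ, h i < δ) ∧ (∀ i j, i ≤ j → j < μ → h i ≤ h j) ∧
      ∀ j < lam.ord, ∃ i < μ, a j ≤ h i := by
  have hlt : lam.ord < (Order.succ lam).ord := Cardinal.ord_lt_ord.2 (Order.lt_succ lam)
  by_cases hb : ∃ i ≤ lam.ord, ∀ β < δ, ∃ j < i, β ≤ a j
  · -- the first initial segment of the family that is unbounded in `δ` has limit length
    obtain ⟨μ, ⟨hμ, hub⟩, hmin⟩ := WellFounded.has_min (r := ((· < ·) : Ordinal.{u} → _ → Prop))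
      wellFounded_lt {i | i ≤ lam.ord ∧ ∀ β < δ, ∃ j < i, β ≤ a j} hb
    have hbd : ∀ i < μ, ∃ β < δ, ∀ j < i, a j ≤ β := by
      intro i hi
      have := hmin i
      contrapose! this
      exact ⟨⟨hi.le.trans hμ, fun β hβ => (this β hβ).imp fun j hj => ⟨hj.1, hj.2.le⟩⟩, hi⟩
    have hμlim : Order.IsSuccLimit μ := by
      refine (Order.isSuccLimit_iff _).2 ⟨?_, ?_⟩
      · rw [isMin_iff_eq_bot]
        rintro rfl
        obtain ⟨j, hj, -⟩ := hub 0 hδ.bot_lt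
        exact absurd hj not_lt_bot
      · refine Order.isSuccPrelimit_of_succ_ne fun i hi => ?_
        subst hi
        obtain ⟨β, hβ, h⟩ := hbd i (Order.lt_succ i)
        have hi' := ha i ((Order.lt_succ i).trans_le hμ)
        obtain ⟨j, hj, hj'⟩ := hub (Order.succ (max β (a i))) (hδ.succ_lt (max_lt hβ hi'))
        have := (Order.lt_succ _).trans_le hj'
        rcases (Order.lt_succ_iff.1 hj).eq_or_lt with rfl | hj
        · exact absurd this (not_lt.2 (le_max_right _ _))
        · exact absurd (this.trans_le (h j hj)) (not_lt.2 (le_max_left _ _))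
    have hmem : ∀ i < μ, ∀ j < i, a j ≤ sInf {β | ∀ j < i, a j ≤ β} := by
      intro i hi
      obtain ⟨β, -, h⟩ := hbd i hi
      exact csInf_mem (s := {β | ∀ j < i, a j ≤ β}) ⟨β, h⟩
    refine ⟨μ, fun i => sInf {β | ∀ j < i, a j ≤ β}, hμ.trans_lt hlt, hμlim, ?_, ?_, ?_⟩
    · intro i hi
      obtain ⟨β, hβ, h⟩ := hbd i hi
      exact (csInf_le' (s := {β | ∀ j < i, a j ≤ β}) h).trans_lt hβ
    · intro i j hij hj
      exact csInf_le' fun k hk => hmem j hj k (hk.trans_le hij)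
    · intro j hj
      obtain ⟨k, hk, hk'⟩ := hub (a j) (ha j hj)
      exact ⟨Order.succ k, hμlim.succ_lt hk,
        hk'.trans (hmem _ (hμlim.succ_lt hk) k (Order.lt_succ k))⟩
  · push Not at hb
    obtain ⟨β, hβ, h⟩ := hb _ le_rfl
    refine ⟨Ordinal.omega0, fun _ => β, ?_, Ordinal.isSuccLimit_omega0, fun _ _ => hβ,
      fun _ _ _ _ => le_rfl, fun j hj => ⟨0, Ordinal.omega0_pos, (h j hj).le⟩⟩
    rw [← Cardinal.ord_aleph0]
    exact Cardinal.ord_lt_ord.2 (hlam.trans_lt (Order.lt_succ lam))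

/-! ### Transfinite constructions -/

theorem exists_transfinite_sequence {S : Type*} (s₀ : S) (θ : Ordinal.{u})
    (Spec : Ordinal.{u} → (Ordinal.{u} → S) → S → Prop)
    (hcongr : ∀ α f g t, (∀ β < α, f β = g β) → Spec α f t → Spec α g t)
    (h : ∀ α < θ, ∀ f, (∀ β < α, Spec β f (f β)) → ∃ t, Spec α f t) :
    ∃ f, ∀ α < θ, Spec α f (f α) := by
  classical
  let extd : (α : Ordinal.{u}) → (∀ β, β < α → S) → Ordinal.{u} → S :=
    fun α g β => if hβ : β < α then g β hβ else s₀
  let F : (α : Ordinal.{u}) → (∀ β, β < α → S) → S := fun α g =>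
    if hex : ∃ t, Spec α (extd α g) t then hex.choose else s₀
  let f : Ordinal.{u} → S := wellFounded_lt.fix F
  have hf : ∀ α, f α = F α fun β _ => f β := fun α => wellFounded_lt.fix_eq F α
  have hextd : ∀ α, ∀ β < α, extd α (fun β _ => f β) β = f β := fun α β hβ => dif_pos hβ
  refine ⟨f, fun α => ?_⟩
  induction α using WellFoundedLT.induction with
  | ind α ih =>
    intro hα
    obtain ⟨t, ht⟩ := h α hα f fun β hβ => ih β hβ (hβ.trans hα)
    have hex : ∃ t, Spec α (extd α fun β _ => f β) t :=
      ⟨t, hcongr _ _ _ _ (fun β hβ => (hextd α β hβ).symm) ht⟩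
    have : f α = hex.choose := by
      rw [hf]
      exact dif_pos hex
    rw [this]
    exact hcongr _ _ _ _ (hextd α) hex.choose_spec

/-- Transfinite construction of an increasing continuous sequence of length `θ`: `Good α s` is the
requirement on the `α`-th member, `T α s t` is a requirement on the members with indices `α` and
`α + 1`, and `Lim α f t` says that `t` is the limit of the first `α` members of `f`. -/
theorem exists_continuous_sequence {S : Type*} {R : S → S → Prop}
    (hR : ∀ s t r, R s t → R t r → R s r) {Lim : Ordinal.{u} → (Ordinal.{u} → S) → S → Prop}
    (hLim : ∀ α f g t, (∀ β < α, f β = g β) → Lim α f t → Lim α g t)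
    {Good : Ordinal.{u} → S → Prop} {T : Ordinal.{u} → S → S → Prop} {θ : Ordinal.{u}}
    (hθ : 0 < θ) {s₀ : S} (h₀ : Good 0 s₀)
    (hsucc : ∀ α s, Order.succ α < θ → Good α s → ∃ t, Good (Order.succ α) t ∧ R s t ∧ T α s t)
    (hlim : ∀ α < θ, Order.IsSuccLimit α → ∀ f : Ordinal.{u} → S, (∀ β < α, Good β (f β)) →
      (∀ β γ, β < γ → γ < α → R (f β) (f γ)) →
      (∀ β < α, Order.IsSuccLimit β → Lim β f (f β)) →
      ∃ t, Good α t ∧ Lim α f t ∧ ∀ β < α, R (f β) t) :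
    ∃ f : Ordinal.{u} → S, f 0 = s₀ ∧ (∀ α < θ, Good α (f α)) ∧
      (∀ α β, α < β → β < θ → R (f α) (f β)) ∧
      (∀ α < θ, Order.IsSuccLimit α → Lim α f (f α)) ∧
      ∀ α, Order.succ α < θ → T α (f α) (f (Order.succ α)) := by
  let Spec : Ordinal.{u} → (Ordinal.{u} → S) → S → Prop := fun α f t =>
    (α = 0 → t = s₀) ∧ Good α t ∧ (∀ β < α, R (f β) t) ∧ (Order.IsSuccLimit α → Lim α f t) ∧
      ∀ β, α = Order.succ β → T β (f β) t
  have key : ∃ f, ∀ α < θ, Spec α f (f α) := by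
    refine exists_transfinite_sequence s₀ θ Spec ?_ ?_
    · rintro α f g t hfg ⟨h1, h2, h3, h4, h5⟩
      refine ⟨h1, h2, fun β hβ => hfg β hβ ▸ h3 β hβ, fun hα => hLim _ _ _ _ hfg (h4 hα), ?_⟩
      rintro β rfl
      exact hfg β (Order.lt_succ β) ▸ h5 β rfl
    · intro α hα f hf
      rcases Ordinal.zero_or_succ_or_isSuccLimit α with rfl | ⟨β, rfl⟩ | hα'
      · exact ⟨s₀, fun _ => rfl, h₀, fun β hβ => absurd hβ not_lt_zero,
          fun h => absurd h Order.not_isSuccLimit_bot,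
          fun β hβ => absurd hβ.symm (Order.succ_ne_bot β)⟩
      · obtain ⟨t, ht, hRt, hTt⟩ := hsucc β (f β) hα (hf β (Order.lt_succ β)).2.1
        refine ⟨t, fun h => absurd h (Order.succ_ne_bot β), ht, fun γ hγ => ?_,
          fun h => absurd h (Order.not_isSuccLimit_succ β), ?_⟩
        · rcases (Order.lt_succ_iff.1 hγ).eq_or_lt with rfl | hγ
          · exact hRt
          · exact hR _ _ _ ((hf β (Order.lt_succ β)).2.2.1 γ hγ) hRt
        · intro γ hγ
          obtain rfl := Order.succ_injective hγ
          exact hTt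
      · obtain ⟨t, ht, hLt, hRt⟩ := hlim α hα hα' f (fun β hβ => (hf β hβ).2.1)
          (fun β γ hβ hγ => (hf γ hγ).2.2.1 β hβ) (fun β hβ => (hf β hβ).2.2.2.1)
        refine ⟨t, ?_, ht, hRt, fun _ => hLt, ?_⟩
        · rintro rfl
          exact absurd hα' Order.not_isSuccLimit_bot
        · rintro β rfl
          exact absurd hα' (Order.not_isSuccLimit_succ β)
  obtain ⟨f, hf⟩ := key
  exact ⟨f, (hf 0 hθ).1 rfl, fun α hα => (hf α hα).2.1, fun α β h hβ => (hf β hβ).2.2.1 α h,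
    fun α hα => (hf α hα).2.2.2.1, fun α hα => (hf _ hα).2.2.2.2 α rfl⟩

/-! ### Continuous chains of models and of embeddings -/

theorem IsUnion.congr {M M' : Ordinal.{u} → Model L} {δ : Ordinal.{u}} {U : Model L}
    (h : IsUnion M δ U) (hM : ∀ α < δ, M α = M' α) : IsUnion M' δ U := by
  refine ⟨h.1.trans ?_, fun α hα => hM α hα ▸ h.2 α hα⟩
  ext x
  exact exists_congr fun α => and_congr_right fun hα => by rw [hM α hα]

theorem IsUnion.map {M : Ordinal.{u} → Model L} {δ : Ordinal.{u}} {U : Model L}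
    (h : IsUnion M δ U) {F : ZFSet.{u} → ZFSet.{u}} (hF : InjOn F U.carrier) :
    IsUnion (fun α => (M α).map F) δ (U.map F) := by
  refine ⟨?_, fun α hα => (h.2 α hα).map hF⟩
  have hc : ∀ α < δ, ((M α).map F).carrier = F '' (M α).carrier := fun α hα =>
    Model.map_carrier (hF.mono (h.2 α hα).subset)
  rw [Model.map_carrier hF, h.1]
  ext y
  constructor
  · rintro ⟨x, ⟨α, hα, hx⟩, rfl⟩
    exact ⟨α, hα, by rw [hc α hα]; exact mem_image_of_mem F hx⟩
  · rintro ⟨α, hα, hy⟩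
    rw [hc α hα] at hy
    obtain ⟨x, hx, rfl⟩ := hy
    exact ⟨x, ⟨α, hα, hx⟩, rfl⟩

theorem IsUnion.exists_mem {M : Ordinal.{u} → Model L} {δ : Ordinal.{u}} {U : Model L}
    (h : IsUnion M δ U) {x : ZFSet.{u}} (hx : x ∈ U.carrier) : ∃ α < δ, x ∈ (M α).carrier := by
  rwa [h.1] at hx

theorem IsUnion.subset {M : Ordinal.{u} → Model L} {δ : Ordinal.{u}} {U : Model L}
    (h : IsUnion M δ U) {X : Set ZFSet.{u}} (hX : ∀ α < δ, (M α).carrier ⊆ X) : U.carrier ⊆ X := by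
  intro x hx
  obtain ⟨α, hα, hx⟩ := h.exists_mem hx
  exact hX α hα hx

theorem IsUnion.eq_of_const {M : Ordinal.{u} → Model L} {δ : Ordinal.{u}} {U V : Model L}
    (h : IsUnion M δ U) (hδ : 0 < δ) (hM : ∀ α < δ, M α = V) : U = V := by
  have hsub := h.2 0 hδ
  rw [hM 0 hδ] at hsub
  exact (hsub.of_subset_eq (h.subset fun α hα => by rw [hM α hα])).symm

theorem IsUnion.hasCard {M : Ordinal.{u} → Model L} {δ : Ordinal.{u}} {U : Model L}
    {κ : Cardinal.{u}} (hκ : Cardinal.aleph0 ≤ κ) (h : IsUnion M δ U) (hδ₀ : 0 < δ)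
    (hδ : δ < (Order.succ κ).ord) (hM : ∀ α < δ, (M α).HasCard κ) : U.HasCard κ := by
  refine le_antisymm ?_ ?_
  · rw [h.1]
    exact mk_iUnion_Iio_le hκ (Cardinal.card_le_iff.2 hδ) fun α hα => (hM α hα).le
  · exact (hM 0 hδ₀).ge.trans (Cardinal.mk_le_mk_of_subset (h.2 0 hδ₀).subset)

theorem Model.HasCard.cardGe {M : Model L} {κ : Cardinal.{u}} (h : M.HasCard κ) : M.CardGe κ :=
  h.ge

theorem Model.CardGe.mono {M N : Model L} {κ : Cardinal.{u}} (h : M.CardGe κ)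
    (hMN : M.carrier ⊆ N.carrier) : N.CardGe κ :=
  h.trans (Cardinal.mk_le_mk_of_subset hMN)

theorem Model.CardGe.of_le {M : Model L} {κ μ : Cardinal.{u}} (h : M.CardGe κ) (hμ : μ ≤ κ) :
    M.CardGe μ :=
  (Cardinal.lift_le.2 hμ).trans h

namespace AClass

variable {K : AClass L}

theorem IsAECCore.exists_limit (hK : K.IsAECCore fun _ => True) {δ : Ordinal.{u}}
    (hδ : Order.IsSuccLimit δ) {M : Ordinal.{u} → Model L} (hM : K.IsChain δ M) :
    ∃ U, IsUnion M δ U ∧ K.Mem U ∧ ∀ α < δ, K.le (M α) U := by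
  obtain ⟨U, hU⟩ := exists_isUnion hδ fun α β h hβ => hK.le_sub _ _ (hM.2.1 α β h hβ)
  exact ⟨U, hU, hK.union δ M U trivial hδ hM hU⟩

theorem IsChain.mono {δ δ' : Ordinal.{u}} {M : Ordinal.{u} → Model L} (h : K.IsChain δ M)
    (hδ : δ' ≤ δ) : K.IsChain δ' M :=
  ⟨fun α hα => h.1 α (hα.trans_le hδ), fun α β hαβ hβ => h.2.1 α β hαβ (hβ.trans_le hδ),
    fun α hα => h.2.2 α (hα.trans_le hδ)⟩

theorem IsChain.le {δ : Ordinal.{u}} {M : Ordinal.{u} → Model L} (h : K.IsChain δ M)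
    (hK : K.IsAECCore fun _ => True) {α β : Ordinal.{u}} (hαβ : α ≤ β) (hβ : β < δ) :
    K.le (M α) (M β) := by
  rcases hαβ.eq_or_lt with rfl | hαβ
  · exact hK.le_refl _ (h.1 _ hβ)
  · exact h.2.1 _ _ hαβ hβ

theorem IsAECCore.isUnion_unique (hK : K.IsAECCore fun _ => True) {M : Ordinal.{u} → Model L}
    {δ : Ordinal.{u}} (hδ : Order.IsSuccLimit δ) (hM : K.IsChain δ M) {U V : Model L}
    (hU : IsUnion M δ U) (hV : IsUnion M δ V) : U = V := by
  have hle := hK.smooth δ M U V trivial hδ hM hU (hK.union δ M V trivial hδ hM hV).2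
  exact (hK.le_sub _ _ hle).eq (hU.1.trans hV.1.symm)

theorem IsChain.map (hK : K.IsAECCore fun _ => True) {M : Ordinal.{u} → Model L}
    {δ : Ordinal.{u}} (hM : K.IsChain δ M) {F : ZFSet.{u} → ZFSet.{u}}
    (hF : ∀ α < δ, InjOn F (M α).carrier) : K.IsChain δ fun α => (M α).map F :=
  ⟨fun α hα => hK.mem_map (hM.1 α hα) (hF α hα),
    fun α β h hβ => hK.le_map (hM.2.1 α β h hβ) (hF β hβ),
    fun α hα hα' => (hM.2.2 α hα hα').map (hF α hα)⟩

/-- Transfinite construction of a continuous chain of models. -/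
theorem IsAECCore.exists_chain (hK : K.IsAECCore fun _ => True)
    {Good : Ordinal.{u} → Model L → Prop} {T : Ordinal.{u} → Model L → Model L → Prop}
    {θ : Ordinal.{u}} (hθ : 0 < θ) {M₀ : Model L} (hmem : ∀ α M, Good α M → K.Mem M)
    (h₀ : Good 0 M₀)
    (hsucc : ∀ α M, Order.succ α < θ → Good α M →
      ∃ N, Good (Order.succ α) N ∧ K.le M N ∧ T α M N)
    (hlim : ∀ α < θ, Order.IsSuccLimit α → ∀ (M : Ordinal.{u} → Model L) (U : Model L),
      (∀ β < α, Good β (M β)) → K.IsChain α M → IsUnion M α U → K.Mem U → (∀ β < α, K.le (M β) U) →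
      Good α U) :
    ∃ M : Ordinal.{u} → Model L, M 0 = M₀ ∧ K.IsChain θ M ∧ (∀ α < θ, Good α (M α)) ∧
      ∀ α, Order.succ α < θ → T α (M α) (M (Order.succ α)) := by
  obtain ⟨M, h1, h2, h3, h4, h5⟩ := exists_continuous_sequence (R := K.le) hK.le_trans
    (Lim := fun α M U => IsUnion M α U) (fun _ _ _ _ h h' => h'.congr h) hθ h₀ hsucc
    (fun α hα hα' M hM hM' hM'' => by
      have hc : K.IsChain α M := ⟨fun β hβ => hmem _ _ (hM β hβ), hM', hM''⟩
      obtain ⟨U, hU, hU', hle⟩ := hK.exists_limit hα' hc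
      exact ⟨U, hlim α hα hα' M U hM hc hU hU' hle, hU, hle⟩)
  exact ⟨M, h1, ⟨fun α hα => hmem _ _ (h2 α hα), h3, h4⟩, h2, h5⟩

end AClass

/-- A map `map` of the universe of sets, considered on the model `dom`, together with a model
`cod`; it is used for `K`-embeddings `dom → cod`. -/
structure EmbState (L : FirstOrder.Language.{u, u}) where
  dom : Model L
  cod : Model L
  map : ZFSet.{u} → ZFSet.{u}

namespace AClass

variable {K : AClass L}

/-- The embedding `t` extends the embedding `s`. -/
def StateLe (K : AClass L) (s t : EmbState L) : Prop :=
  K.le s.dom t.dom ∧ K.le s.cod t.cod ∧ EqOn t.map s.map s.dom.carrier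

theorem IsAECCore.stateLe_trans {len : Ordinal.{u} → Prop} (hK : K.IsAECCore len)
    {s t r : EmbState L} (h : K.StateLe s t) (h' : K.StateLe t r) : K.StateLe s r :=
  ⟨hK.le_trans _ _ _ h.1 h'.1, hK.le_trans _ _ _ h.2.1 h'.2.1,
    fun _ hx => (h'.2.2 (hK.subset h.1 hx)).trans (h.2.2 hx)⟩

/-- `⟨s α : α < δ⟩` is an increasing continuous sequence of embeddings. -/
structure IsStateChain (K : AClass L) (δ : Ordinal.{u}) (s : Ordinal.{u} → EmbState L) : Prop where
  kMap : ∀ α < δ, K.KMap (s α).map (s α).dom (s α).cod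
  le : ∀ α β, α < β → β < δ → K.StateLe (s α) (s β)
  dom_union : ∀ α < δ, Order.IsSuccLimit α → IsUnion (fun β => (s β).dom) α (s α).dom
  cod_union : ∀ α < δ, Order.IsSuccLimit α → IsUnion (fun β => (s β).cod) α (s α).cod

theorem IsStateChain.dom_chain {δ : Ordinal.{u}} {s : Ordinal.{u} → EmbState L}
    (h : K.IsStateChain δ s) (hK : K.IsAECCore fun _ => True) :
    K.IsChain δ fun α => (s α).dom :=
  ⟨fun α hα => (h.kMap α hα).mem_left hK, fun α β hαβ hβ => (h.le α β hαβ hβ).1, h.dom_union⟩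

theorem IsStateChain.cod_chain {δ : Ordinal.{u}} {s : Ordinal.{u} → EmbState L}
    (h : K.IsStateChain δ s) (hK : K.IsAECCore fun _ => True) :
    K.IsChain δ fun α => (s α).cod :=
  ⟨fun α hα => (hK.le_mem _ _ (h.kMap α hα).2).2, fun α β hαβ hβ => (h.le α β hαβ hβ).2.1,
    h.cod_union⟩

/-- The union of an increasing continuous sequence of `K`-embeddings is a `K`-embedding. -/
theorem IsStateChain.exists_limit {δ : Ordinal.{u}} {s : Ordinal.{u} → EmbState L}
    (h : K.IsStateChain δ s) (hK : K.IsAECCore fun _ => True) (hδ : Order.IsSuccLimit δ) :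
    ∃ t : EmbState L, K.KMap t.map t.dom t.cod ∧ IsUnion (fun β => (s β).dom) δ t.dom ∧
      IsUnion (fun β => (s β).cod) δ t.cod ∧ ∀ α < δ, K.StateLe (s α) t := by
  classical
  obtain ⟨U, hU, hU', hle⟩ := hK.exists_limit hδ (h.dom_chain hK)
  obtain ⟨V, hV, hV', hle'⟩ := hK.exists_limit hδ (h.cod_chain hK)
  let F : ZFSet.{u} → ZFSet.{u} := fun x =>
    if hx : ∃ α < δ, x ∈ (s α).dom.carrier then (s hx.choose).map x else x
  have hmaps : ∀ α β, α ≤ β → β < δ → EqOn (s β).map (s α).map (s α).dom.carrier := by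
    intro α β hαβ hβ x hx
    rcases hαβ.eq_or_lt with rfl | hαβ
    · rfl
    · exact (h.le α β hαβ hβ).2.2 hx
  have hF : ∀ α < δ, EqOn F (s α).map (s α).dom.carrier := by
    intro α hα x hx
    have hex : ∃ α < δ, x ∈ (s α).dom.carrier := ⟨α, hα, hx⟩
    have : F x = (s hex.choose).map x := dif_pos hex
    rw [this]
    obtain ⟨hc, hc'⟩ := hex.choose_spec
    rcases le_total α hex.choose with h' | h'
    · exact hmaps _ _ h' hc hx
    · exact (hmaps _ _ h' hα hc').symm
  have hdom : ∀ α β, α ≤ β → β < δ → (s α).dom.carrier ⊆ (s β).dom.carrier := fun α β hαβ hβ =>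
    hK.subset ((h.dom_chain hK).le hK hαβ hβ)
  have hinj : InjOn F U.carrier := by
    intro x hx y hy hxy
    obtain ⟨α, hα, hx⟩ := hU.exists_mem hx
    obtain ⟨β, hβ, hy⟩ := hU.exists_mem hy
    have hm := max_lt hα hβ
    have hx' := hdom _ _ (le_max_left α β) hm hx
    have hy' := hdom _ _ (le_max_right α β) hm hy
    rw [hF _ hm hx', hF _ hm hy'] at hxy
    exact (h.kMap _ hm).1 hx' hy' hxy
  have hmap : ∀ α < δ, (s α).dom.map F = (s α).dom.map (s α).map := fun α hα =>
    Model.map_congr (hinj.mono (hK.subset (hle α hα))) (hF α hα)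
  refine ⟨⟨U, V, F⟩, ⟨hinj, ?_⟩, hU, hV, fun α hα => ⟨hle α hα, hle' α hα, hF α hα⟩⟩
  refine hK.smooth δ (fun α => (s α).dom.map F) _ _ trivial hδ ⟨?_, ?_, ?_⟩ (hU.map hinj) ?_
  · exact fun α hα => hK.mem_map (hK.le_mem _ _ (hle α hα)).1 (hinj.mono (hK.subset (hle α hα)))
  · exact fun α β hαβ hβ => hK.le_map (h.le α β hαβ hβ).1 (hinj.mono (hK.subset (hle β hβ)))
  · exact fun α hα hα' => (h.dom_union α hα hα').map (hinj.mono (hK.subset (hle α hα)))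
  · intro α hα
    rw [hmap α hα]
    exact hK.le_trans _ _ _ (h.kMap α hα).2 (hle' α hα)

/-- Transfinite construction of an increasing continuous sequence of `K`-embeddings. -/
theorem IsAECCore.exists_stateChain (hK : K.IsAECCore fun _ => True)
    {Good : Ordinal.{u} → EmbState L → Prop} {T : Ordinal.{u} → EmbState L → EmbState L → Prop}
    {θ : Ordinal.{u}} (hθ : 0 < θ) {s₀ : EmbState L}
    (hmap : ∀ α s, Good α s → K.KMap s.map s.dom s.cod) (h₀ : Good 0 s₀)
    (hsucc : ∀ α s, Order.succ α < θ → Good α s →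
      ∃ t, Good (Order.succ α) t ∧ K.StateLe s t ∧ T α s t)
    (hlim : ∀ α < θ, Order.IsSuccLimit α → ∀ (s : Ordinal.{u} → EmbState L) (t : EmbState L),
      (∀ β < α, Good β (s β)) → K.IsStateChain α s → K.KMap t.map t.dom t.cod →
      IsUnion (fun β => (s β).dom) α t.dom → IsUnion (fun β => (s β).cod) α t.cod →
      (∀ β < α, K.StateLe (s β) t) → Good α t) :
    ∃ s : Ordinal.{u} → EmbState L, s 0 = s₀ ∧ K.IsStateChain θ s ∧ (∀ α < θ, Good α (s α)) ∧
      ∀ α, Order.succ α < θ → T α (s α) (s (Order.succ α)) := by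
  obtain ⟨s, h1, h2, h3, h4, h5⟩ := exists_continuous_sequence (R := K.StateLe)
    (fun _ _ _ => hK.stateLe_trans)
    (Lim := fun α s t => IsUnion (fun β => (s β).dom) α t.dom ∧
      IsUnion (fun β => (s β).cod) α t.cod)
    (fun _ _ _ _ h h' => ⟨h'.1.congr fun α hα => by rw [h α hα],
      h'.2.congr fun α hα => by rw [h α hα]⟩) hθ h₀ hsucc
    (fun α hα hα' s hs hs' hs'' => by
      have hc : K.IsStateChain α s := ⟨fun β hβ => hmap _ _ (hs β hβ), hs',
        fun β hβ hβ' => (hs'' β hβ hβ').1, fun β hβ hβ' => (hs'' β hβ hβ').2⟩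
      obtain ⟨t, ht, hd, hc', hle⟩ := hc.exists_limit hK hα'
      exact ⟨t, hlim α hα hα' s t hs hc ht hd hc' hle, ⟨hd, hc'⟩, hle⟩)
  exact ⟨s, h1, ⟨fun α hα => hmap _ _ (h2 α hα), h3, fun α hα hα' => (h4 α hα hα').1,
    fun α hα hα' => (h4 α hα hα').2⟩, h2, h5⟩

/-! ### The downward Löwenheim–Skolem–Tarski property -/

variable {lam : Cardinal.{u}}

theorem IsAEC.exists_le (hK : K.IsAEC lam) {κ : Cardinal.{u}} (hlam : Cardinal.aleph0 ≤ lam)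
    (hκ : lam ≤ κ) {M : Model L} (hM : K.Mem M) (hc : M.CardGe κ) {A : Set ZFSet.{u}}
    (hA : A ⊆ M.carrier) (hA' : Cardinal.mk A ≤ Cardinal.lift.{u + 1} κ) :
    ∃ N, K.le N M ∧ A ⊆ N.carrier ∧ N.HasCard κ := by
  obtain ⟨B, hB, hB'⟩ := Cardinal.le_mk_iff_exists_subset.1 hc
  have hκ₀ := hlam.trans hκ
  obtain ⟨N, hN, hAN, hN'⟩ := hK.2 M (A ∪ B) hM (union_subset hA hB)
  refine ⟨N, hN, subset_union_left.trans hAN, le_antisymm (hN'.trans ?_) ?_⟩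
  · rw [← Cardinal.add_eq_self (Cardinal.aleph0_le_lift.2 hκ₀)]
    exact add_le_add (Cardinal.lift_le.2 hκ) (mk_union_le hκ₀ hA' hB'.le)
  · exact hB'.ge.trans (Cardinal.mk_le_mk_of_subset (subset_union_right.trans hAN))

theorem IsAEC.exists_between (hK : K.IsAEC lam) {κ : Cardinal.{u}} (hlam : Cardinal.aleph0 ≤ lam)
    (hκ : lam ≤ κ) {M N₀ : Model L} (hN₀ : K.le N₀ M) (hc : N₀.HasCard κ) {A : Set ZFSet.{u}}
    (hA : A ⊆ M.carrier) (hA' : Cardinal.mk A ≤ Cardinal.lift.{u + 1} κ) :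
    ∃ N, K.le N₀ N ∧ K.le N M ∧ A ⊆ N.carrier ∧ N.HasCard κ := by
  have hsub := hK.1.subset hN₀
  obtain ⟨N, hN, hAN, hN'⟩ := hK.exists_le hlam hκ (hK.1.le_mem _ _ hN₀).2
    (hc.cardGe.mono hsub) (union_subset hsub hA) (mk_union_le (hlam.trans hκ) hc.le hA')
  exact ⟨N, hK.1.le_of_subset (subset_union_left.trans hAN) hN₀ hN, hN,
    subset_union_right.trans hAN, hN'⟩

/-- A model of cardinality `lam⁺` is the union of a continuous chain of models of cardinality
`lam`, with a prescribed first member. -/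
theorem IsAEC.exists_filtration (hK : K.IsAEC lam) (hlam : Cardinal.aleph0 ≤ lam) {M N₀ : Model L}
    (hM : M.HasCard (Order.succ lam)) (hN₀ : K.le N₀ M) (hc : N₀.HasCard lam) :
    ∃ N : Ordinal.{u} → Model L, N 0 = N₀ ∧ K.IsChain (Order.succ lam).ord N ∧
      (∀ α < (Order.succ lam).ord, K.le (N α) M ∧ (N α).HasCard lam) ∧
      IsUnion N (Order.succ lam).ord M := by
  have : Nonempty M.carrier := by
    rw [← Cardinal.mk_ne_zero_iff, hM]
    exact (Cardinal.aleph0_pos.trans_le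
      (Cardinal.aleph0_le_lift.2 (hlam.trans (Order.le_succ lam)))).ne'
  obtain ⟨e, he⟩ := exists_enumeration hM.le
  have hθ := isSuccLimit_ord_succ hlam
  obtain ⟨N, h1, h2, h3, h4⟩ := hK.1.exists_chain (θ := (Order.succ lam).ord)
    (Good := fun α N => K.le N M ∧ N.HasCard lam)
    (T := fun α _ N => (e α : ZFSet.{u}) ∈ N.carrier) hθ.bot_lt (M₀ := N₀)
    (fun _ N h => (hK.1.le_mem _ _ h.1).1) ⟨hN₀, hc⟩
    (fun α N _ hN => by
      obtain ⟨N', h, h', hA, hN'⟩ := hK.exists_between hlam le_rfl hN.1 hN.2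
        (singleton_subset_iff.2 (e α).2) (mk_singleton_le hlam _)
      exact ⟨N', ⟨h', hN'⟩, h, singleton_subset_iff.1 hA⟩)
    (fun α hα hα' N U hN hN' hU hU' hle =>
      ⟨hK.1.smooth α N U M trivial hα' hN' hU fun β hβ => (hN β hβ).1,
        hU.hasCard hlam hα'.bot_lt hα fun β hβ => (hN β hβ).2⟩)
  refine ⟨N, h1, h2, h3, ?_, fun α hα => hK.1.le_sub _ _ (h3 α hα).1⟩
  ext x
  constructor
  · intro hx
    obtain ⟨i, hi, hx'⟩ := he ⟨x, hx⟩
    refine ⟨Order.succ i, hθ.succ_lt hi, ?_⟩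
    have := h4 i (hθ.succ_lt hi)
    rwa [hx'] at this
  · rintro ⟨α, hα, hx⟩
    exact hK.1.subset (h3 α hα).1 hx

/-- A submodel of cardinality at most `lam` of the union of a chain of length `lam⁺` is contained
in a member of the chain. -/
theorem IsAECCore.exists_le_of_isUnion {len : Ordinal.{u} → Prop} (hK : K.IsAECCore len)
    (hlam : Cardinal.aleph0 ≤ lam) {M : Ordinal.{u} → Model L} {U N : Model L}
    (hM : K.IsChain (Order.succ lam).ord M) (hU : IsUnion M (Order.succ lam).ord U)
    (hle : ∀ α < (Order.succ lam).ord, K.le (M α) U) (hN : K.le N U) (hc : N.HasCard lam) :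
    ∃ α < (Order.succ lam).ord, K.le N (M α) := by
  obtain ⟨α, hα, h⟩ := exists_subset_of_mk_le hlam hc.le (A := fun α => (M α).carrier)
    (fun α β h hβ => hK.subset (hM.2.1 α β h hβ)) fun x hx => hU.exists_mem (hK.subset hN hx)
  exact ⟨α, hα, hK.le_of_subset h hN (hle α hα)⟩

end AClass

namespace Frame

variable {s : Frame L} {lam : Cardinal.{u}}

/-! ### Types over models of cardinality `lam` -/

namespace IsSemiGood

theorem core (hs : s.IsSemiGood lam) : s.K.IsAECCore fun _ => True := hs.aec.1

theorem mem (hs : s.IsSemiGood lam) {M : Model L} (h : s.Mod M) : s.K.Mem M :=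
  ((hs.mod_iff M).1 h).1

theorem card (hs : s.IsSemiGood lam) {M : Model L} (h : s.Mod M) : M.HasCard lam :=
  ((hs.mod_iff M).1 h).2

theorem mod_of_le (hs : s.IsSemiGood lam) {M N : Model L} (h : s.K.le M N) (hM : M.HasCard lam) :
    s.Mod M :=
  (hs.mod_iff M).2 ⟨(hs.core.le_mem _ _ h).1, hM⟩

theorem mod_map (hs : s.IsSemiGood lam) {M : Model L} (hM : s.Mod M) {f : ZFSet.{u} → ZFSet.{u}}
    (hf : InjOn f M.carrier) : s.Mod (M.map f) :=
  (hs.mod_iff _).2 ⟨hs.core.mem_map (hs.mem hM) hf, (hs.card hM).map hf⟩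

theorem exists_between (hs : s.IsSemiGood lam) (hlam : Cardinal.aleph0 ≤ lam) {M N₀ : Model L}
    (hN₀ : s.Mod N₀) (h : s.K.le N₀ M) {A : Set ZFSet.{u}} (hA : A ⊆ M.carrier)
    (hA' : Cardinal.mk A ≤ Cardinal.lift.{u + 1} lam) :
    ∃ N, s.Mod N ∧ s.K.le N₀ N ∧ s.K.le N M ∧ A ⊆ N.carrier := by
  obtain ⟨N, h1, h2, h3, h4⟩ := hs.aec.exists_between hlam le_rfl h (hs.card hN₀) hA hA'
  exact ⟨N, hs.mod_of_le h2 h4, h1, h2, h3⟩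

theorem exists_between_singleton (hs : s.IsSemiGood lam) (hlam : Cardinal.aleph0 ≤ lam)
    {M N₀ : Model L} (hN₀ : s.Mod N₀) (h : s.K.le N₀ M) {a : ZFSet.{u}} (ha : a ∈ M.carrier) :
    ∃ N, s.Mod N ∧ s.K.le N₀ N ∧ s.K.le N M ∧ a ∈ N.carrier := by
  obtain ⟨N, h1, h2, h3, h4⟩ := hs.exists_between hlam hN₀ h (singleton_subset_iff.2 ha)
    (mk_singleton_le hlam a)
  exact ⟨N, h1, h2, h3, singleton_subset_iff.1 h4⟩

theorem exists_upper_bound (hs : s.IsSemiGood lam) (hlam : Cardinal.aleph0 ≤ lam)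
    {M N₀ N₁ : Model L} (hN₀ : s.Mod N₀) (h₀ : s.K.le N₀ M) (hN₁ : s.Mod N₁) (h₁ : s.K.le N₁ M) :
    ∃ N, s.Mod N ∧ s.K.le N₀ N ∧ s.K.le N₁ N ∧ s.K.le N M := by
  obtain ⟨N, h1, h2, h3, h4⟩ := hs.exists_between hlam hN₀ h₀ (hs.core.subset h₁)
    (hs.card hN₁).le
  exact ⟨N, h1, h2, hs.core.le_of_subset h4 h₁ h3, h3⟩

/-- Amalgamation of two embeddings of a model of cardinality `lam`. -/
theorem exists_amalgam (hs : s.IsSemiGood lam) {M₀ M₁ M₂ : Model L} {F₁ F₂ : ZFSet.{u} → ZFSet.{u}}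
    (hM₀ : s.Mod M₀) (hM₁ : s.Mod M₁) (hM₂ : s.Mod M₂) (h₁ : s.K.KMap F₁ M₀ M₁)
    (h₂ : s.K.KMap F₂ M₀ M₂) :
    ∃ M₃ G₁ G₂, s.Mod M₃ ∧ s.K.KMap G₁ M₁ M₃ ∧ s.K.KMap G₂ M₂ M₃ ∧
      ∀ x ∈ M₀.carrier, G₁ (F₁ x) = G₂ (F₂ x) := by
  obtain ⟨H₁, hH₁, hle₁, hx₁⟩ := h₁.exists_pullback hs.core
  obtain ⟨H₂, hH₂, hle₂, hx₂⟩ := h₂.exists_pullback hs.core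
  obtain ⟨M₃, f₁, f₂, hM₃, ⟨A₁, hA₁, he₁⟩, ⟨A₂, hA₂, he₂⟩, hf₁, hf₂⟩ := hs.ap M₀ _ _
    ⟨hle₁, hM₀, hs.mod_map hM₁ hH₁⟩ ⟨hle₂, hM₀, hs.mod_map hM₂ hH₂⟩
  obtain ⟨G₁, hG₁, hG₁'⟩ := AClass.IsEmb.exists_kMap hs.core (e := f₁) ⟨A₁, hA₁.1, he₁⟩
  obtain ⟨G₂, hG₂, hG₂'⟩ := AClass.IsEmb.exists_kMap hs.core (e := f₂) ⟨A₂, hA₂.1, he₂⟩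
  refine ⟨M₃, G₁ ∘ H₁, G₂ ∘ H₂, hM₃.2, (AClass.KMap.of_injOn hs.core (hs.mem hM₁) hH₁).comp
    hs.core hG₁, (AClass.KMap.of_injOn hs.core (hs.mem hM₂) hH₂).comp hs.core hG₂, fun x hx => ?_⟩
  have e₁ := hG₁' ⟨x, hs.core.subset hle₁ hx⟩
  have e₂ := hG₂' ⟨x, hs.core.subset hle₂ hx⟩
  rw [hf₁ _ hx] at e₁
  rw [hf₂ _ hx] at e₂
  simp only [Function.comp, hx₁ x hx, hx₂ x hx]
  exact e₁.trans e₂.symm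

/-- Over a model of cardinality `lam`, equality of types is witnessed by a single amalgam of
cardinality `lam`, since amalgamation makes `E*` transitive. -/
theorem exists_amalgam_of_sameType (hs : s.IsSemiGood lam) (hlam : Cardinal.aleph0 ≤ lam)
    {M N₁ N₂ : Model L} {a₁ a₂ : ZFSet.{u}} (hM : s.Mod M) (hN₁ : s.Mod N₁) (hN₂ : s.Mod N₂)
    (h : s.K.SameType M N₁ a₁ N₂ a₂) :
    ∃ N F, s.Mod N ∧ s.K.le N₁ N ∧ s.K.KMap F N₂ N ∧ EqOn F id M.carrier ∧ F a₂ = a₁ := by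
  have hK := hs.core
  suffices H : ∃ N F₁ F₂, s.Mod N ∧ s.K.KMap F₁ N₁ N ∧ s.K.KMap F₂ N₂ N ∧ EqOn F₁ F₂ M.carrier ∧
      F₁ a₁ = F₂ a₂ by
    obtain ⟨N, F₁, F₂, hN, hF₁, hF₂, hM, ha⟩ := H
    obtain ⟨G, hG, hG', hGF⟩ := hF₁.exists_pullback hK
    refine ⟨N.map G, G ∘ F₂, hs.mod_map hN hG, hG',
      hF₂.comp hK (AClass.KMap.of_injOn hK (hs.mem hN) hG), fun x hx => ?_, ?_⟩
    · simp only [Function.comp, ← hM hx, hGF x (hK.subset h.le_left hx), id]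
    · simp only [Function.comp, ← ha, hGF a₁ h.mem_left]
  obtain ⟨t₁, t₂, rfl, rfl, rfl, rfl, ht⟩ := h.exists_eqvGen
  clear h
  suffices H : ∀ N₁ N₂, s.Mod N₁ → s.Mod N₂ → s.K.le M N₁ → s.K.le M N₂ → s.K.le N₁ t₁.N →
      s.K.le N₂ t₂.N → t₁.a ∈ N₁.carrier → t₂.a ∈ N₂.carrier → ∃ N F₁ F₂, s.Mod N ∧
      s.K.KMap F₁ N₁ N ∧ s.K.KMap F₂ N₂ N ∧ EqOn F₁ F₂ M.carrier ∧ F₁ t₁.a = F₂ t₂.a from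
    H _ _ hN₁ hN₂ t₁.le t₂.le (hK.le_refl _ (hs.mem hN₁)) (hK.le_refl _ (hs.mem hN₂)) t₁.mem t₂.mem
  clear hN₁ hN₂
  have hcut : ∀ {M₃ N₁ N₂ : Model L} {F₁ F₂ : ZFSet.{u} → ZFSet.{u}}, s.Mod N₁ → s.Mod N₂ →
      s.K.KMap F₁ N₁ M₃ → s.K.KMap F₂ N₂ M₃ →
      ∃ N, s.Mod N ∧ s.K.KMap F₁ N₁ N ∧ s.K.KMap F₂ N₂ N := by
    intro M₃ N₁ N₂ F₁ F₂ hN₁ hN₂ h₁ h₂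
    obtain ⟨N, hN, hN', hN'', -⟩ := hs.exists_upper_bound hlam (hs.mod_map hN₁ h₁.1) h₁.2
      (hs.mod_map hN₂ h₂.1) h₂.2
    exact ⟨N, hN, ⟨h₁.1, hN'⟩, ⟨h₂.1, hN''⟩⟩
  induction ht with
  | rel t₁ t₂ h =>
    intro N₁ N₂ hN₁ hN₂ _ _ h₁ h₂ _ _
    obtain ⟨M₃, F₁, F₂, hF₁, hF₂, h3, h4, h5⟩ := (AClass.eStar_iff hK).1 h
    obtain ⟨N, hN, hN', hN''⟩ := hcut hN₁ hN₂ (hF₁.restrict hK h₁) (hF₂.restrict hK h₂)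
    exact ⟨N, F₁, F₂, hN, hN', hN'', h3.trans h4.symm, h5⟩
  | refl t =>
    intro N₁ N₂ hN₁ hN₂ _ _ h₁ h₂ _ _
    obtain ⟨N, hN, hN', hN''⟩ := hcut hN₁ hN₂ (AClass.KMap.of_le h₁) (AClass.KMap.of_le h₂)
    exact ⟨N, id, id, hN, hN', hN'', fun _ _ => rfl, rfl⟩
  | symm t₁ t₂ _ ih =>
    intro N₁ N₂ hN₁ hN₂ hM₁ hM₂ h₁ h₂ ha₁ ha₂
    obtain ⟨N, F₁, F₂, hN, hF₁, hF₂, h3, h4⟩ := ih N₂ N₁ hN₂ hN₁ hM₂ hM₁ h₂ h₁ ha₂ ha₁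
    exact ⟨N, F₂, F₁, hN, hF₂, hF₁, h3.symm, h4.symm⟩
  | trans t₁ t t₂ _ _ ih ih' =>
    intro N₁ N₂ hN₁ hN₂ hM₁ hM₂ h₁ h₂ ha₁ ha₂
    obtain ⟨N, hN, hMN, hNt, ha⟩ := hs.exists_between_singleton hlam hM t.le t.mem
    obtain ⟨P, F₁, F, hP, hF₁, hF, h3, h4⟩ := ih N₁ N hN₁ hN hM₁ hMN h₁ hNt ha₁ ha
    obtain ⟨P', F', F₂, hP', hF', hF₂, h3', h4'⟩ := ih' N N₂ hN hN₂ hMN hM₂ hNt h₂ ha ha₂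
    obtain ⟨Q, G₁, G₂, hQ, hG₁, hG₂, hG⟩ := hs.exists_amalgam hN hP hP' hF hF'
    refine ⟨Q, G₁ ∘ F₁, G₂ ∘ F₂, hQ, hF₁.comp hK hG₁, hF₂.comp hK hG₂, fun x hx => ?_, ?_⟩
    · simp only [Function.comp, h3 hx, ← h3' hx]
      exact hG x (hK.subset hMN hx)
    · simp only [Function.comp, h4, ← h4']
      exact hG _ ha

end IsSemiGood

/-! ### Basic types and non-forking over models of cardinality `lam`, inside larger models -/

theorem Basic.of_sameType {M N N' : Model L} {a a' : ZFSet.{u}} (h : s.Basic M N a)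
    (h' : s.K.SameType M N a N' a') : s.Basic M N' a' := by
  obtain ⟨p, hp, hp'⟩ := h
  exact ⟨p, hp, hp'.of_sameType h'⟩

theorem Basic.le {M N : Model L} {a : ZFSet.{u}} (h : s.Basic M N a) : s.K.le M N :=
  h.choose_spec.2.le

theorem Basic.mem {M N : Model L} {a : ZFSet.{u}} (h : s.Basic M N a) : a ∈ N.carrier :=
  h.choose_spec.2.mem

theorem Basic.notMem {M N : Model L} {a : ZFSet.{u}} (h : s.Basic M N a) : a ∉ M.carrier :=
  h.choose_spec.2.notMem

theorem TypeDnf.of_sameType {M₀ M N N' : Model L} {a a' : ZFSet.{u}} (h : s.TypeDnf M₀ M N a)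
    (h' : s.K.SameType M N a N' a') : s.TypeDnf M₀ M N' a' := by
  obtain ⟨P, b, hb, hP⟩ := h
  exact ⟨P, b, h'.symm.trans hb, hP⟩

theorem TypeDnf.le {M₀ M N : Model L} {a : ZFSet.{u}} (h : s.TypeDnf M₀ M N a) : s.K.le M N :=
  h.choose_spec.choose_spec.1.le_left

theorem TypeDnf.mem {M₀ M N : Model L} {a : ZFSet.{u}} (h : s.TypeDnf M₀ M N a) : a ∈ N.carrier :=
  h.choose_spec.choose_spec.1.mem_left

theorem TypeDnf.notMem {M₀ M N : Model L} {a : ZFSet.{u}} (h : s.TypeDnf M₀ M N a) :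
    a ∉ M.carrier :=
  h.choose_spec.choose_spec.1.notMem_left

namespace IsSemiGood

theorem le_base (hs : s.IsSemiGood lam) {M₀ M N : Model L} {a : ZFSet.{u}}
    (h : s.TypeDnf M₀ M N a) : s.cls.le M₀ M := by
  obtain ⟨P, b, -, hP⟩ := h
  exact (hs.frameAxioms.dnfBasic _ _ _ _ hP).1

theorem basic_of_typeDnf (hs : s.IsSemiGood lam) {M₀ M N : Model L} {a : ZFSet.{u}}
    (h : s.TypeDnf M₀ M N a) : s.Basic M N a := by
  obtain ⟨P, b, hb, hP⟩ := h
  exact (hs.frameAxioms.dnfBasic _ _ _ _ hP).2.2.2.of_sameType hb.symm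

theorem basic_base_of_typeDnf (hs : s.IsSemiGood lam) {M₀ M N : Model L} {a : ZFSet.{u}}
    (h : s.TypeDnf M₀ M N a) : s.Basic M₀ N a := by
  have hle := hs.le_base h
  obtain ⟨P, b, hb, hP⟩ := h
  exact (hs.frameAxioms.dnfBasic _ _ _ _ hP).2.2.1.of_sameType
    (hb.symm.restrict hs.core hle.1)

theorem typeDnf_mono (hs : s.IsSemiGood lam) {M₀ M₀' M₁' M₁ N : Model L} {a : ZFSet.{u}}
    (h : s.TypeDnf M₀ M₁ N a) (hM₀' : s.Mod M₀') (hM₁' : s.Mod M₁') (h₀ : s.K.le M₀ M₀')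
    (h₁ : s.K.le M₀' M₁') (h₂ : s.K.le M₁' M₁) : s.TypeDnf M₀' M₁' N a := by
  have hK := hs.core
  have hle := hs.le_base h
  obtain ⟨P, b, hb, hP⟩ := h
  have hP' := (hs.frameAxioms.dnfBasic _ _ _ _ hP).2.1
  have hPP : s.cls.le P P := ⟨hK.le_refl _ (hs.mem hP'.2.2), hP'.2.2, hP'.2.2⟩
  refine ⟨P, b, hb.restrict hK h₂, hs.frameAxioms.monotonicity M₀ M₀' M₁' M₁ P P P b
    ⟨h₀, hle.2.1, hM₀'⟩ ⟨h₁, hM₀', hM₁'⟩ ⟨h₂, hM₁', hle.2.2⟩ hP' hPP hPP ?_ hb.symm.mem_left hP⟩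
  exact (hK.subset h₂).trans (hK.subset hP'.1)

theorem typeDnf_mono_top (hs : s.IsSemiGood lam) {M₀ M N N' : Model L} {a : ZFSet.{u}}
    (h : s.TypeDnf M₀ M N a) (hN : s.K.le N N') : s.TypeDnf M₀ M N' a :=
  h.of_sameType (.of_le hs.core h.le hN h.mem h.notMem)

theorem typeDnf_of_top (hs : s.IsSemiGood lam) {M₀ M N N' : Model L} {a : ZFSet.{u}}
    (h : s.TypeDnf M₀ M N' a) (hM : s.K.le M N) (hN : s.K.le N N') (ha : a ∈ N.carrier) :
    s.TypeDnf M₀ M N a :=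
  h.of_sameType (.symm (.of_le hs.core hM hN ha h.notMem))

theorem basic_mono_top (hs : s.IsSemiGood lam) {M N N' : Model L} {a : ZFSet.{u}}
    (h : s.Basic M N a) (hN : s.K.le N N') : s.Basic M N' a :=
  h.of_sameType (.of_le hs.core h.le hN h.mem h.notMem)

theorem basic_of_top (hs : s.IsSemiGood lam) {M N N' : Model L} {a : ZFSet.{u}}
    (h : s.Basic M N' a) (hM : s.K.le M N) (hN : s.K.le N N') (ha : a ∈ N.carrier) :
    s.Basic M N a :=
  h.of_sameType (.symm (.of_le hs.core hM hN ha h.notMem))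

theorem basic_map (hs : s.IsSemiGood lam) (hlam : Cardinal.aleph0 ≤ lam) {M N N' : Model L}
    {a : ZFSet.{u}} {f : ZFSet.{u} → ZFSet.{u}} (hM : s.Mod M) (h : s.Basic M N a)
    (hf : s.K.KMap f N N') : s.Basic (M.map f) N' (f a) := by
  have hK := hs.core
  obtain ⟨P, hP, hMP, hPN, ha⟩ := hs.exists_between_singleton hlam hM h.le h.mem
  have hfP := hf.restrict hK hPN
  have hinj := hfP.1
  obtain ⟨e, he⟩ := Model.exists_mapEquiv hinj
  have := hs.frameAxioms.basicIso M P (M.map f) (P.map f) e ⟨a, ha⟩ ⟨hMP, hM, hP⟩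
    ⟨hK.le_map hMP hinj, hs.mod_map hM (hinj.mono (hK.subset hMP)), hs.mod_map hP hinj⟩ 
    (Model.imageEq_map (hK.subset hMP) (hinj.mono (hK.subset hMP)) he) (hs.basic_of_top h hMP hPN ha)
  rw [he] at this
  exact hs.basic_mono_top this hfP.2

theorem typeDnf_map (hs : s.IsSemiGood lam) {M₀ M N N' : Model L}
    {a : ZFSet.{u}} {f : ZFSet.{u} → ZFSet.{u}} (h : s.TypeDnf M₀ M N a)
    (hf : s.K.KMap f N N') : s.TypeDnf (M₀.map f) (M.map f) N' (f a) := by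
  have hK := hs.core
  have hle := hs.le_base h
  have hMN := hK.subset h.le
  obtain ⟨P, b, hb, hP⟩ := h
  have hP' := (hs.frameAxioms.dnfBasic _ _ _ _ hP).2.1
  have hbP := hb.symm.mem_left
  have := M.small
  have hfM := hf.1.mono hMN
  obtain ⟨G, hG, hGf, -⟩ := exists_injOn_extension (A := P.carrier) (C := ∅) hfM
  have hGM := hG.mono (hK.subset hP'.1)
  have hM₀M := hK.subset hle.1
  obtain ⟨e, he⟩ := Model.exists_mapEquiv hG
  have himage : ∀ Q : Model L, s.K.le Q P → ImageEq e Q (Q.map G) := fun Q hQ =>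
    Model.imageEq_map (hK.subset hQ) (hG.mono (hK.subset hQ)) he
  have := hs.frameAxioms.dnfIso M₀ M P (M₀.map G) (M.map G) (P.map G) e ⟨b, hbP⟩ hle hP'
    ⟨hK.le_map hle.1 hGM, hs.mod_map hle.2.1 (hGM.mono hM₀M), hs.mod_map hle.2.2 hGM⟩
    ⟨hK.le_map hP'.1 hG, hs.mod_map hle.2.2 hGM, hs.mod_map hP'.2.2 hG⟩
    (himage _ (hK.le_trans _ _ _ hle.1 hP'.1)) (himage _ hP'.1) hP
  rw [he, Model.map_congr hGM hGf, Model.map_congr (hGM.mono hM₀M) (hGf.mono hM₀M)] at this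
  exact ⟨_, _, hb.map hK hf (.of_injOn hK (hs.mem hP'.2.2) hG) hGf.symm, this⟩

theorem uniqueness (hs : s.IsSemiGood lam) (hlam : Cardinal.aleph0 ≤ lam)
    {M₀ M N₁ N₂ : Model L} {a₁ a₂ : ZFSet.{u}} (h₁ : s.TypeDnf M₀ M N₁ a₁)
    (h₂ : s.TypeDnf M₀ M N₂ a₂) (h : s.K.SameType M₀ N₁ a₁ N₂ a₂) :
    s.K.SameType M N₁ a₁ N₂ a₂ := by
  have hK := hs.core
  have hle := hs.le_base h₁
  obtain ⟨P₁, hP₁, hMP₁, hPN₁, ha₁⟩ := hs.exists_between_singleton hlam hle.2.2 h₁.le h₁.mem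
  obtain ⟨P₂, hP₂, hMP₂, hPN₂, ha₂⟩ := hs.exists_between_singleton hlam hle.2.2 h₂.le h₂.mem
  have e₁ := AClass.SameType.of_le hK hMP₁ hPN₁ ha₁ h₁.notMem
  have e₂ := AClass.SameType.of_le hK hMP₂ hPN₂ ha₂ h₂.notMem
  refine e₁.symm.trans (.trans ?_ e₂)
  exact hs.frameAxioms.uniqueness M₀ M P₁ P₂ a₁ a₂ hle ⟨hMP₁, hle.2.2, hP₁⟩ ⟨hMP₂, hle.2.2, hP₂⟩
    (h₁.of_sameType e₁.symm) (h₂.of_sameType e₂.symm)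
    ((e₁.restrict hK hle.1).trans (h.trans (e₂.restrict hK hle.1).symm))

theorem extension (hs : s.IsSemiGood lam) {M N M' : Model L} {a : ZFSet.{u}} (h : s.Basic M N a)
    (hM : s.Mod M) (hM' : s.Mod M') (hle : s.K.le M M') :
    ∃ N' b, s.Mod N' ∧ s.K.SameType M N a N' b ∧ s.TypeDnf M M' N' b := by
  obtain ⟨p, hp, hp'⟩ := h
  obtain ⟨N', b, hN', hb, -, hd⟩ := hs.frameAxioms.extension M M' ⟨hle, hM, hM'⟩ p hp
  exact ⟨N', b, hN'.2.2, ⟨p, hp', hb⟩, hd⟩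

/-- Transitivity of non-forking follows from extension and uniqueness. -/
theorem typeDnf_trans (hs : s.IsSemiGood lam) (hlam : Cardinal.aleph0 ≤ lam)
    {M₀ M₁ M₂ N : Model L} {a : ZFSet.{u}} (h : s.TypeDnf M₀ M₁ N a) (h' : s.TypeDnf M₁ M₂ N a) :
    s.TypeDnf M₀ M₂ N a := by
  have hK := hs.core
  have h₀₁ := hs.le_base h
  have h₁₂ := hs.le_base h'
  obtain ⟨N', b, hN', hb, hd⟩ := hs.extension (hs.basic_base_of_typeDnf h) h₀₁.2.1 h₁₂.2.2
    (hK.le_trans _ _ _ h₀₁.1 h₁₂.1)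
  have hd₁ := hs.typeDnf_mono hd h₀₁.2.1 h₀₁.2.2
    (hK.le_refl _ (hs.mem h₀₁.2.1)) h₀₁.1 h₁₂.1
  have hd₂ := hs.typeDnf_mono hd h₀₁.2.2 h₁₂.2.2 h₀₁.1 h₁₂.1 (hK.le_refl _ (hs.mem h₁₂.2.2))
  exact hd.of_sameType (hs.uniqueness hlam h' hd₂ (hs.uniqueness hlam h hd₁ hb)).symm

theorem isChain_cls (hs : s.IsSemiGood lam) {M : Ordinal.{u} → Model L} {δ : Ordinal.{u}}
    (hM : s.K.IsChain δ M) (hmod : ∀ α < δ, s.Mod (M α)) : s.cls.IsChain δ M :=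
  ⟨fun α hα => ⟨hs.mem (hmod α hα), hmod α hα⟩,
    fun α β h hβ => ⟨hM.2.1 α β h hβ, hmod α (h.trans hβ), hmod β hβ⟩, hM.2.2⟩

theorem localCharacter (hs : s.IsSemiGood lam) (hlam : Cardinal.aleph0 ≤ lam)
    {M : Ordinal.{u} → Model L} {δ : Ordinal.{u}} {N : Model L} {a : ZFSet.{u}}
    (hδ : δ < (Order.succ lam).ord) (hδ' : Order.IsSuccLimit δ)
    (hM : s.K.IsChain (Order.succ δ) M) (hmod : ∀ α ≤ δ, s.Mod (M α)) (h : s.Basic (M δ) N a) :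
    ∃ α < δ, s.TypeDnf (M α) (M δ) N a := by
  obtain ⟨P, hP, hMP, hPN, ha⟩ := hs.exists_between_singleton hlam (hmod δ le_rfl) h.le h.mem
  obtain ⟨α, hα, hd⟩ := hs.frameAxioms.localCharacter δ M P a hδ hδ'
    (hs.isChain_cls hM fun α hα => hmod α (Order.lt_succ_iff.1 hα)) ⟨hMP, hmod δ le_rfl, hP⟩
    (hs.basic_of_top h hMP hPN ha)
  exact ⟨α, hα, hs.typeDnf_mono_top hd hPN⟩

theorem continuity (hs : s.IsSemiGood lam) (hlam : Cardinal.aleph0 ≤ lam)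
    {M : Ordinal.{u} → Model L} {δ : Ordinal.{u}} {N : Model L} {a : ZFSet.{u}}
    (hδ : δ < (Order.succ lam).ord) (hδ' : Order.IsSuccLimit δ)
    (hM : s.K.IsChain (Order.succ δ) M) (hmod : ∀ α ≤ δ, s.Mod (M α)) (hN : s.K.le (M δ) N)
    (ha : a ∈ N.carrier) (ha' : a ∉ (M δ).carrier)
    (h : ∀ α < δ, s.TypeDnf (M 0) (M α) N a) : s.TypeDnf (M 0) (M δ) N a := by
  obtain ⟨P, hP, hMP, hPN, haP⟩ := hs.exists_between_singleton hlam (hmod δ le_rfl) hN ha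
  refine hs.typeDnf_mono_top (hs.frameAxioms.continuity δ M P a hδ hδ'
    (hs.isChain_cls hM fun α hα => hmod α (Order.lt_succ_iff.1 hα)) ⟨hMP, hmod δ le_rfl, hP⟩
    haP ha' fun α hα => ?_).2 hPN
  exact hs.typeDnf_of_top (h α hα)
    (hs.core.le_trans _ _ _ (hM.2.1 α δ hα (Order.lt_succ δ)) hMP) hPN haP

end IsSemiGood

/-! ### Non-forking of types over larger models -/

/-- For a model `N₀` of cardinality `lam` and `N₀ ≼ M₁ ≼ M₂`: the type of `a` over `M₁` in `M₂`
does not fork over `N₀`, i.e. its restrictions to models of cardinality `lam` do not. -/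
structure NonForking (s : Frame L) (N₀ M₁ M₂ : Model L) (a : ZFSet.{u}) : Prop where
  mod : s.Mod N₀
  le_base : s.K.le N₀ M₁
  le : s.K.le M₁ M₂
  mem : a ∈ M₂.carrier
  notMem : a ∉ M₁.carrier
  typeDnf : ∀ N, s.Mod N → s.K.le N₀ N → s.K.le N M₁ → s.TypeDnf N₀ N M₂ a

namespace IsSemiGood

theorem nonForking_of_sameType (hs : s.IsSemiGood lam) {N₀ M₁ M₂ M₂' : Model L} {a a' : ZFSet.{u}}
    (h : s.NonForking N₀ M₁ M₂ a) (h' : s.K.SameType M₁ M₂ a M₂' a') :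
    s.NonForking N₀ M₁ M₂' a' :=
  ⟨h.mod, h.le_base, h'.symm.le_left, h'.symm.mem_left, h'.symm.notMem_left, fun N hN h₀ h₁ =>
    (h.typeDnf N hN h₀ h₁).of_sameType (h'.restrict hs.core h₁)⟩

theorem nonForking_mono_base (hs : s.IsSemiGood lam) {N₀ N₀' M₁ M₂ : Model L} {a : ZFSet.{u}}
    (h : s.NonForking N₀ M₁ M₂ a) (hN₀' : s.Mod N₀') (h₀ : s.K.le N₀ N₀') (h₁ : s.K.le N₀' M₁) :
    s.NonForking N₀' M₁ M₂ a :=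
  ⟨hN₀', h₁, h.le, h.mem, h.notMem, fun N hN h₀' h₁' =>
    hs.typeDnf_mono (h.typeDnf N hN (hs.core.le_trans _ _ _ h₀ h₀') h₁') hN₀' hN h₀ h₀'
      (hs.core.le_refl _ (hs.mem hN))⟩

theorem nonForking_mono (hs : s.IsSemiGood lam) {N₀ M₁ M₁' M₂ : Model L} {a : ZFSet.{u}}
    (h : s.NonForking N₀ M₁ M₂ a) (h₀ : s.K.le N₀ M₁') (h₁ : s.K.le M₁' M₁) :
    s.NonForking N₀ M₁' M₂ a :=
  ⟨h.mod, h₀, hs.core.le_trans _ _ _ h₁ h.le, h.mem, fun h' => h.notMem (hs.core.subset h₁ h'),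
    fun N hN h₀' h₁' => h.typeDnf N hN h₀' (hs.core.le_trans _ _ _ h₁' h₁)⟩

/-- Non-forking over `N₀` may be checked on a cofinal family of models of cardinality `lam`. -/
theorem nonForking_of_cofinal (hs : s.IsSemiGood lam) {N₀ M₁ M₂ : Model L} {a : ZFSet.{u}}
    (hN₀ : s.Mod N₀) (h₀ : s.K.le N₀ M₁) (hM : s.K.le M₁ M₂) (ha : a ∈ M₂.carrier)
    (ha' : a ∉ M₁.carrier)
    (h : ∀ N, s.Mod N → s.K.le N₀ N → s.K.le N M₁ →
      ∃ N', s.K.le N N' ∧ s.TypeDnf N₀ N' M₂ a) : s.NonForking N₀ M₁ M₂ a :=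
  ⟨hN₀, h₀, hM, ha, ha', fun N hN h₀' h₁' => by
    obtain ⟨N', hNN', hd⟩ := h N hN h₀' h₁'
    exact hs.typeDnf_mono hd hN₀ hN (hs.core.le_refl _ (hs.mem hN₀)) h₀' hNN'⟩

theorem nonForking_trans (hs : s.IsSemiGood lam) (hlam : Cardinal.aleph0 ≤ lam)
    {N₀ N₁ M₁ M₂ : Model L} {a : ZFSet.{u}} (h₀ : s.TypeDnf N₀ N₁ M₂ a)
    (h : s.NonForking N₁ M₁ M₂ a) : s.NonForking N₀ M₁ M₂ a := by
  have hle := hs.le_base h₀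
  refine hs.nonForking_of_cofinal hle.2.1 (hs.core.le_trans _ _ _ hle.1 h.le_base) h.le h.mem
    h.notMem fun N hN _ hNM => ?_
  obtain ⟨N', hN', h₁, h₂, h₃⟩ := hs.exists_upper_bound hlam hN hNM h.mod h.le_base
  exact ⟨N', h₁, hs.typeDnf_trans hlam h₀ (h.typeDnf N' hN' h₂ h₃)⟩

theorem nonForking_map (hs : s.IsSemiGood lam) {N₀ M₁ M₂ M₂' : Model L} {a : ZFSet.{u}}
    (h : s.NonForking N₀ M₁ M₂ a) {f : ZFSet.{u} → ZFSet.{u}} (hf : s.K.KMap f M₂ M₂') :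
    s.NonForking (N₀.map f) (M₁.map f) M₂' (f a) := by
  have hK := hs.core
  have hM₁ := hf.1.mono (hK.subset h.le)
  have hN₀ := hM₁.mono (hK.subset h.le_base)
  refine ⟨hs.mod_map h.mod hN₀, hK.le_map h.le_base hM₁,
    hK.le_trans _ _ _ (hK.le_map h.le hf.1) hf.2, hf.mem hK h.mem, ?_, fun N hN h₀ h₁ => ?_⟩
  · rw [Model.map_carrier hM₁]
    rintro ⟨x, hx, hxa⟩
    exact h.notMem (hf.1 (hK.subset h.le hx) h.mem hxa ▸ hx)
  · -- `N` is the image of its preimage under `f`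
    obtain ⟨g, hg, hgf⟩ := AClass.KMap.exists_factor hM₁
      (AClass.KMap.of_le (hK.le_refl _ (hK.le_mem _ _ h.le).1))
    have hgN := hg.restrict hK h₁
    have himg : ∀ x ∈ N.carrier, f (g x) = x := by
      intro x hx
      have hx' := hK.subset h₁ hx
      rw [Model.map_carrier hM₁] at hx'
      obtain ⟨y, hy, rfl⟩ := hx'
      rw [hgf y hy, id]
    have hfN : InjOn f (N.map g).carrier := hM₁.mono (hK.subset hgN.2)
    have hNeq : (N.map g).map f = N := by
      rw [Model.map_map hgN.1 hfN]
      exact Model.map_eq_self himg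
    have hN₀g : (N₀.map f).map g = N₀ := by
      rw [Model.map_map hN₀ (hgN.1.mono (hK.subset h₀))]
      exact Model.map_eq_self fun x hx => hgf x (hK.subset h.le_base hx)
    have hle : s.K.le N₀ (N.map g) := hN₀g ▸ hK.le_map h₀ hgN.1
    have := hs.typeDnf_map (h.typeDnf _ (hs.mod_map hN hgN.1) hle hgN.2) hf
    rwa [hNeq] at this

/-- Density over larger models. If no type of an element of `N \ M` over `M` is non-forking over
a small model, one builds chains `A n ≼ M` and `B n ≼ N` of length `ω` such that
`B n ∩ M ⊆ A (n + 1)` and `A (n + 1)` witnesses forking over `A n` for all elements of `B n \ M`;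
density over the union of the `A n` then contradicts local character. -/
theorem exists_nonForking (hs : s.IsSemiGood lam) (hlam : Cardinal.aleph0 ≤ lam) {M N : Model L}
    (hMN : s.K.le M N) (hne : M ≠ N) (hM : M.CardGe lam) : ∃ N₀ a, s.NonForking N₀ M N a := by
  classical
  have hK := hs.core
  by_contra! hcon
  have hW : ∀ A a, s.Mod A → s.K.le A M → a ∈ N.carrier → a ∉ M.carrier →
      ∃ A', s.Mod A' ∧ s.K.le A A' ∧ s.K.le A' M ∧ ¬ s.TypeDnf A A' N a := by
    intro A a hA hAM ha ha'
    by_contra! h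
    exact hcon A a ⟨hA, hAM, hMN, ha, ha', h⟩
  obtain ⟨b, hb, hbM⟩ : ∃ b ∈ N.carrier, b ∉ M.carrier := by
    by_contra! h
    exact hne ((hK.le_sub _ _ hMN).of_subset_eq h)
  obtain ⟨A₀, hA₀M, -, hA₀⟩ := hs.aec.exists_le hlam le_rfl (hK.le_mem _ _ hMN).1 hM
    (empty_subset _) (by simp)
  have hA₀' := hs.mod_of_le hA₀M hA₀
  obtain ⟨B₀, hB₀, hAB₀, hB₀N, hbB⟩ := hs.exists_between_singleton hlam hA₀'
    (hK.le_trans _ _ _ hA₀M hMN) hb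
  obtain ⟨c, hc0, hc, hgood, hT⟩ := hK.exists_stateChain (θ := (Order.succ lam).ord)
    (Good := fun _ c => s.K.KMap c.map c.dom c.cod ∧ EqOn c.map id c.dom.carrier ∧ s.Mod c.dom ∧
      s.Mod c.cod ∧ s.K.le c.dom M ∧ s.K.le c.cod N ∧ b ∈ c.cod.carrier)
    (T := fun _ c d => c.cod.carrier ∩ M.carrier ⊆ d.dom.carrier ∧
      ∀ a ∈ c.cod.carrier, a ∉ M.carrier → ¬ s.TypeDnf c.dom d.dom N a)
    (isSuccLimit_ord_succ hlam).bot_lt (s₀ := ⟨A₀, B₀, id⟩) (fun _ _ h => h.1)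
    ⟨.of_le hAB₀, fun _ _ => rfl, hA₀', hB₀, hA₀M, hB₀N, hbB⟩
    (by
      rintro α ⟨A, B, f⟩ - ⟨hf, hfid, hA, hB, hAM, hBN, hbB⟩
      dsimp only at hf hfid hA hB hAM hBN hbB
      have : Nonempty (Model L) := ⟨A⟩
      choose! W hWmod hAW hWM hWd using fun a => hW A a hA hAM
      obtain ⟨A', hA', hAA', hA'M, hsub⟩ := hs.exists_between hlam hA hAM
        (A := (B.carrier ∩ M.carrier) ∪ ⋃ a ∈ B.carrier \ M.carrier, (W a).carrier)
        (union_subset inter_subset_right (iUnion₂_subset fun a ha =>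
          hK.subset (hWM a (hK.subset hBN ha.1) ha.2)))
        (mk_union_le hlam
          ((Cardinal.mk_le_mk_of_subset inter_subset_left).trans (hs.card hB).le)
          (mk_biUnion_le hlam ((Cardinal.mk_le_mk_of_subset sdiff_subset).trans (hs.card hB).le)
            fun a ha => (hs.card (hWmod a (hK.subset hBN ha.1) ha.2)).le))
      have hA'N := hK.le_trans _ _ _ hA'M hMN
      obtain ⟨B', hB', hBB', hA'B', hB'N⟩ := hs.exists_upper_bound hlam hB hBN hA' hA'N
      refine ⟨⟨A', B', id⟩, ⟨.of_le hA'B', fun _ _ => rfl, hA', hB', hA'M, hB'N,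
        hK.subset hBB' hbB⟩, ⟨hAA', hBB', hfid.symm⟩, subset_union_left.trans hsub, ?_⟩
      intro a ha haM hd
      have haN := hK.subset hBN ha
      refine hWd a haN haM (hs.typeDnf_mono hd hA (hWmod a haN haM) (hK.le_refl _ (hs.mem hA))
        (hAW a haN haM) (hK.le_of_subset ?_ (hWM a haN haM) hA'M))
      exact (subset_biUnion_of_mem (u := fun a => (W a).carrier)
        (show a ∈ B.carrier \ M.carrier from ⟨ha, haM⟩)).trans (subset_union_right.trans hsub))
    (by
      intro α hα hα' c t hc hch ht hd hcod hle
      refine ⟨ht, fun x hx => ?_, hs.mod_of_le (hK.smooth α _ _ M trivial hα' (hch.dom_chain hK) hd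
        fun β hβ => (hc β hβ).2.2.2.2.1) (hd.hasCard hlam hα'.bot_lt hα fun β hβ =>
        hs.card (hc β hβ).2.2.1), hs.mod_of_le (hK.smooth α _ _ N trivial hα' (hch.cod_chain hK)
        hcod fun β hβ => (hc β hβ).2.2.2.2.2.1) (hcod.hasCard hlam hα'.bot_lt hα fun β hβ =>
        hs.card (hc β hβ).2.2.2.1), hK.smooth α _ _ M trivial hα' (hch.dom_chain hK) hd
        fun β hβ => (hc β hβ).2.2.2.2.1, hK.smooth α _ _ N trivial hα' (hch.cod_chain hK)
        hcod fun β hβ => (hc β hβ).2.2.2.2.2.1, ?_⟩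
      · obtain ⟨β, hβ, hx⟩ := hd.exists_mem hx
        exact ((hle β hβ).2.2 hx).trans ((hc β hβ).2.1 hx)
      · exact hK.subset (hle 0 hα'.bot_lt).2.1 (hc 0 hα'.bot_lt).2.2.2.2.2.2)
  have hω : Ordinal.omega0 < (Order.succ lam).ord := by
    rw [← Cardinal.ord_aleph0]
    exact Cardinal.ord_lt_ord.2 (hlam.trans_lt (Order.lt_succ lam))
  have hωlim := Ordinal.isSuccLimit_omega0
  obtain ⟨hmap, hid, hA, hB, hAM, hBN, hbω⟩ := hgood _ hω
  have hAB : s.K.le (c Ordinal.omega0).dom (c Ordinal.omega0).cod := by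
    have := hmap.2
    rwa [Model.map_eq_self hid] at this
  have hinter : ∀ x ∈ (c Ordinal.omega0).cod.carrier, x ∈ M.carrier →
      x ∈ (c Ordinal.omega0).dom.carrier := by
    intro x hx hxM
    obtain ⟨n, hn, hx⟩ := (hc.cod_union _ hω hωlim).exists_mem hx
    have hn' := hωlim.succ_lt hn
    exact hK.subset (hc.le _ _ hn' hω).1 ((hT n (hn'.trans hω)).1 ⟨hx, hxM⟩)
  obtain ⟨a, ha⟩ := hs.frameAxioms.density _ _ ⟨hAB, hA, hB⟩ (fun h => by
    rw [← h] at hbω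
    exact hbM (hK.subset hAM hbω))
  have haM : a ∉ M.carrier := fun h => ha.notMem (hinter a ha.mem h)
  obtain ⟨n, hn, hd⟩ := hs.localCharacter hlam (M := fun i => (c i).dom) hω hωlim
    ((hc.dom_chain hK).mono (Order.succ_le_of_lt hω)) (fun i hi => (hgood i (hi.trans_lt hω)).2.2.1)
    (hs.basic_mono_top ha hBN)
  obtain ⟨m, hm, ham⟩ := (hc.cod_union _ hω hωlim).exists_mem ha.mem
  have hk : max n m < Ordinal.omega0 := max_lt hn hm
  have hk' := hωlim.succ_lt hk
  refine (hT (max n m) (hk'.trans hω)).2 a ?_ haM (hs.typeDnf_mono hd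
    (hgood _ (hk.trans hω)).2.2.1 (hgood _ (hk'.trans hω)).2.2.1
    ((hc.dom_chain hK).le hK (le_max_left _ _) (hk.trans hω))
    (hc.le _ _ (Order.lt_succ _) (hk'.trans hω)).1 (hc.le _ _ hk' hω).1)
  exact hK.subset ((hc.cod_chain hK).le hK (le_max_right _ _) (hk.trans hω)) ham

/-! ### Non-forking extensions to models of cardinality `lam⁺` -/

theorem typeDnf_self (hs : s.IsSemiGood lam) {M N : Model L} {a : ZFSet.{u}} (hM : s.Mod M)
    (h : s.Basic M N a) : s.TypeDnf M M N a := by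
  obtain ⟨N', b, -, hb, hd⟩ := hs.extension h hM hM (hs.core.le_refl _ (hs.mem hM))
  exact hd.of_sameType hb.symm

/-- The successor step in the construction of a non-forking extension: if the type of `a` over
`f[N]` does not fork over `N₀`, then for `N ≼ N'` the embedding `f` extends to an embedding `f'`
of `N'` such that the type of the same `a` over `f'[N']` does not fork over `N₀`. -/
theorem exists_nonForking_step (hs : s.IsSemiGood lam) (hlam : Cardinal.aleph0 ≤ lam)
    {N₀ N N' B : Model L} {a : ZFSet.{u}} {f : ZFSet.{u} → ZFSet.{u}} (hN' : s.Mod N')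
    (hNN' : s.K.le N N') (hB : s.Mod B) (hf : s.K.KMap f N B) (hd : s.TypeDnf N₀ (N.map f) B a) :
    ∃ B' f', s.Mod B' ∧ s.K.le B B' ∧ s.K.KMap f' N' B' ∧ EqOn f' f N.carrier ∧
      s.TypeDnf N₀ (N'.map f') B' a := by
  have hK := hs.core
  have hle := hs.le_base hd
  have := N.small
  obtain ⟨G, hG, hGf, -⟩ := exists_injOn_extension (A := N'.carrier) (C := ∅) hf.1
  have hGN := hG.mono (hK.subset hNN')
  have hGeq : N.map G = N.map f := Model.map_congr hGN hGf
  have hC : s.Mod (N'.map G) := hs.mod_map hN' hG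
  have hAC : s.K.le (N.map f) (N'.map G) := hGeq ▸ hK.le_map hNN' hG
  obtain ⟨B₁, b, hB₁, hb, hbd⟩ := hs.extension (hs.basic_base_of_typeDnf hd) hle.2.1 hC
    (hK.le_trans _ _ _ hle.1 hAC)
  have hbA := hs.typeDnf_mono hbd hle.2.1 hle.2.2 (hK.le_refl _ (hs.mem hle.2.1)) hle.1 hAC
  obtain ⟨B', F, hB', hBB', hF, hFA, hFb⟩ := hs.exists_amalgam_of_sameType hlam hle.2.2 hB hB₁
    (hs.uniqueness hlam hd hbA hb)
  have hN'B₁ : s.K.KMap G N' B₁ := ⟨hG, hbd.le⟩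
  refine ⟨B', F ∘ G, hB', hBB', hN'B₁.comp hK hF, fun x hx => ?_, ?_⟩
  · simp only [Function.comp, hGf hx]
    exact hFA (Model.mem_map hf.1 hx)
  · have := hs.typeDnf_map hbd hF
    rwa [Model.map_eq_self (hFA.mono (hK.subset hle.1)), hFb,
      Model.map_map hG (hF.1.mono (hK.subset hbd.le))] at this

/-- A basic type over a model of cardinality `lam` has a non-forking extension over any larger
model of cardinality `lam⁺`. Along a filtration of `M` one constructs an increasing continuous
sequence of embeddings into models containing `a`, keeping the type of `a` over the images
non-forking (by continuity at limits), and renames the union. -/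
theorem exists_nonForking_extension (hs : s.IsSemiGood lam) (hlam : Cardinal.aleph0 ≤ lam)
    {N₀ N₁ M : Model L} {a : ZFSet.{u}} (hN₀ : s.Mod N₀) (hN₀M : s.K.le N₀ M)
    (hM : M.HasCard (Order.succ lam)) (ha : s.Basic N₀ N₁ a) :
    ∃ M' b, M'.HasCard (Order.succ lam) ∧ s.NonForking N₀ M M' b ∧ s.K.SameType N₀ N₁ a M' b := by
  have hK := hs.core
  obtain ⟨B₀, hB₀, hNB₀, hB₀N₁, haB₀⟩ := hs.exists_between_singleton hlam hN₀ ha.le ha.mem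
  have haB := hs.basic_of_top ha hNB₀ hB₀N₁ haB₀
  obtain ⟨N, hN0, hN, hNM, hU⟩ := hs.aec.exists_filtration hlam hM hN₀M (hs.card hN₀)
  set θ := (Order.succ lam).ord with hθ_def
  have hθ : Order.IsSuccLimit θ := isSuccLimit_ord_succ hlam
  have hNmod : ∀ α < θ, s.Mod (N α) := fun α hα => hs.mod_of_le (hNM α hα).1 (hNM α hα).2
  have hN₀N : ∀ α < θ, s.K.le N₀ (N α) := fun α hα => hN0 ▸ hN.le hK bot_le hα
  have hNc : ∀ {δ} (_ : δ ≤ θ), s.K.IsChain δ N := fun hδ => hN.mono hδ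
  obtain ⟨c, hc0, hc, hgood, -⟩ := hK.exists_stateChain (θ := θ)
    (Good := fun α c => s.K.KMap c.map c.dom c.cod ∧ c.dom = N α ∧ s.Mod c.cod ∧
      EqOn c.map id N₀.carrier ∧ s.TypeDnf N₀ (c.dom.map c.map) c.cod a)
    (T := fun _ _ _ => True) hθ.bot_lt (s₀ := ⟨N₀, B₀, id⟩) (fun _ _ h => h.1)
    ⟨.of_le hNB₀, hN0.symm, hB₀, fun _ _ => rfl, by
      rw [Model.map_eq_self fun _ _ => rfl]
      exact hs.typeDnf_self hN₀ haB⟩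
    (by
      rintro α ⟨A, B, f⟩ hα ⟨hf, hA, hB, hf₀, hd⟩
      dsimp only at hf hA hB hf₀ hd
      subst hA
      have hα' := (Order.lt_succ α).trans hα
      have hle := hN.2.1 _ _ (Order.lt_succ α) hα
      obtain ⟨B', f', hB', hBB', hf', hff', hd'⟩ := hs.exists_nonForking_step hlam
        (hNmod _ hα) hle hB hf hd
      exact ⟨⟨N (Order.succ α), B', f'⟩, ⟨hf', rfl, hB',
        fun x hx => (hff' (hK.subset (hN₀N α hα') hx)).trans (hf₀ hx), hd'⟩, ⟨hle, hBB', hff'⟩,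
        trivial⟩)
    (by
      intro α hα hα' c t hc hch ht hd hcod hle
      have hdom : ∀ β < α, (c β).dom = N β := fun β hβ => (hc β hβ).2.1
      have htN : t.dom = N α := hK.isUnion_unique hα' (hNc hα.le) (hd.congr hdom)
        (hN.2.2 α hα hα')
      have h0 := hα'.bot_lt
      have htid : EqOn t.map id N₀.carrier := fun x hx =>
        ((hle 0 h0).2.2 (by rw [hdom 0 h0, hN0]; exact hx)).trans ((hc 0 h0).2.2.2.1 hx)
      have htinj : ∀ β ≤ α, InjOn t.map (N β).carrier := fun β hβ =>
        ht.1.mono (htN ▸ hK.subset (hN.le hK hβ hα))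
      have hcodmod : s.Mod t.cod := (hs.mod_iff _).2 ⟨(hK.le_mem _ _ ht.2).2,
        hcod.hasCard hlam h0 hα fun β hβ => hs.card (hc β hβ).2.2.1⟩
      have himg : ∀ β < α, (N β).map t.map = (c β).dom.map (c β).map := fun β hβ => by
        rw [hdom β hβ]
        exact Model.map_congr (htinj β hβ.le) (hdom β hβ ▸ (hle β hβ).2.2)
      have hdnf : ∀ β < α, s.TypeDnf N₀ ((N β).map t.map) t.cod a := fun β hβ => by
        rw [himg β hβ]
        exact hs.typeDnf_mono_top (hc β hβ).2.2.2.2 (hle β hβ).2.1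
      have hN0t : (N 0).map t.map = N₀ := by rw [hN0, Model.map_eq_self htid]
      refine ⟨ht, htN, hcodmod, htid, ?_⟩
      have hsucc : Order.succ α ≤ θ := Order.succ_le_of_lt hα
      have := hs.continuity hlam (M := fun β => (N β).map t.map) hα hα' (N := t.cod) (a := a)
        ((hNc hsucc).map hK fun β hβ => htinj β (Order.lt_succ_iff.1 hβ))
        (fun β hβ => hs.mod_map (hNmod β (hβ.trans_lt hα)) (htinj β hβ)) (htN ▸ ht.2)
        (hdnf 0 h0).mem (fun hmem => by
          obtain ⟨β, hβ, hx⟩ := ((hN.2.2 α hα hα').map (htinj α le_rfl)).exists_mem hmem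
          exact (hdnf β hβ).notMem hx) (fun β hβ => by
          rw [hN0t]
          exact hdnf β hβ)
      rwa [hN0t, ← htN] at this)
  obtain ⟨t, ht, hd, hcod, hle⟩ := hc.exists_limit hK hθ
  have hdom : ∀ β < θ, (c β).dom = N β := fun β hβ => (hgood β hβ).2.1
  have htM : t.dom = M := hK.isUnion_unique hθ hN (hd.congr hdom) hU
  rw [htM] at ht
  have h0 := hθ.bot_lt
  have htid : EqOn t.map id N₀.carrier := fun x hx =>
    ((hle 0 h0).2.2 (by rw [hdom 0 h0, hN0]; exact hx)).trans ((hgood 0 h0).2.2.2.1 hx)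
  have htinj : ∀ β < θ, InjOn t.map (N β).carrier := fun β hβ =>
    ht.1.mono (hK.subset (hNM β hβ).1)
  have hdnf : ∀ β < θ, s.TypeDnf N₀ ((N β).map t.map) t.cod a := fun β hβ => by
    have : (N β).map t.map = (c β).dom.map (c β).map := by
      rw [hdom β hβ]
      exact Model.map_congr (htinj β hβ) (hdom β hβ ▸ (hle β hβ).2.2)
    rw [this]
    exact hs.typeDnf_mono_top (hgood β hβ).2.2.2.2 (hle β hβ).2.1
  have hchain := hN.map hK htinj
  have hunion := hU.map ht.1
  have hN₀img : N₀.map t.map = N₀ := Model.map_eq_self htid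
  have hNF : s.NonForking N₀ (M.map t.map) t.cod a := by
    refine hs.nonForking_of_cofinal hN₀ (hN₀img ▸ hK.le_map hN₀M ht.1) ht.2 (hdnf 0 h0).mem
      (fun hmem => ?_) fun P hP _ hPM => ?_
    · obtain ⟨β, hβ, hx⟩ := hunion.exists_mem hmem
      exact (hdnf β hβ).notMem hx
    · obtain ⟨β, hβ, hPβ⟩ := hK.exists_le_of_isUnion hlam hchain hunion
        (fun β hβ => hK.le_map (hNM β hβ).1 ht.1) hPM (hs.card hP)
      exact ⟨_, hPβ, hdnf β hβ⟩
  obtain ⟨G, hG, hMG, hGt⟩ := ht.exists_pullback hK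
  have hGmap : s.K.KMap G t.cod (t.cod.map G) := .of_injOn hK (hK.le_mem _ _ ht.2).2 hG
  have hGid : EqOn G id N₀.carrier := fun x hx => by
    have := hGt x (hK.subset hN₀M hx)
    rwa [htid hx] at this
  have hNF' := hs.nonForking_map hNF hGmap
  rw [Model.map_eq_self hGid, Model.map_map ht.1 (hG.mono (hK.subset ht.2)),
    Model.map_eq_self (f := G ∘ t.map) hGt] at hNF'
  obtain ⟨M', hMM', hM'le, hb, hM'⟩ := hs.aec.exists_between hlam (Order.le_succ lam) hMG hM
    (singleton_subset_iff.2 hNF'.mem) (mk_singleton_le (hlam.trans (Order.le_succ lam)) _)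
  have hb := singleton_subset_iff.1 hb
  refine ⟨M', G a, hM', hs.nonForking_of_sameType hNF'
    (.symm (.of_le hK hMM' hM'le hb hNF'.notMem)), ?_⟩
  have hB₀t : s.K.le B₀ t.cod := by
    have := (hle 0 h0).2.1
    rwa [hc0] at this
  have hN₀t := hK.le_trans _ _ _ hNB₀ hB₀t
  exact (AClass.SameType.of_le hK hNB₀ hB₀N₁ haB₀ ha.notMem).symm.trans
    ((AClass.SameType.of_le hK hNB₀ hB₀t haB₀ ha.notMem).trans
      ((AClass.SameType.of_kMap_fix hK hN₀t hGmap hGid (hK.subset hB₀t haB₀) ha.notMem).trans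
        (AClass.SameType.of_le hK (hK.le_trans _ _ _ hN₀M hMM') hM'le hb
          (fun h => hNF'.notMem (hK.subset hN₀M h)) |>.symm)))

end IsSemiGood

/-! ### Saturated models in `lam⁺` -/

/-- `M` is a model of cardinality `lam⁺` that realizes every basic type over its submodels of
cardinality `lam`. -/
structure BasicSaturated (s : Frame L) (lam : Cardinal.{u}) (M : Model L) : Prop where
  mem : s.K.Mem M
  card : M.HasCard (Order.succ lam)
  realize : ∀ N, s.Mod N → s.K.le N M → ∀ p ∈ s.Sbs N, ∃ a, s.K.IsTp p M a

namespace IsSemiGood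

theorem exists_mod_le (hs : s.IsSemiGood lam) (hlam : Cardinal.aleph0 ≤ lam) {M : Model L}
    (hM : s.K.Mem M) (hc : M.CardGe lam) : ∃ N, s.Mod N ∧ s.K.le N M := by
  obtain ⟨N, hN, -, hN'⟩ := hs.aec.exists_le hlam le_rfl hM hc (empty_subset _) (by simp)
  exact ⟨N, hs.mod_of_le hN hN', hN⟩

theorem exists_basic (hs : s.IsSemiGood lam) {N : Model L} (hN : s.Mod N) :
    ∃ N' a, s.Basic N N' a := by
  obtain ⟨N', hle, hne⟩ := hs.noMaximal N ⟨hs.mem hN, hN⟩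
  obtain ⟨a, ha⟩ := hs.frameAxioms.density N N' hle hne
  exact ⟨N', a, ha⟩

theorem exists_proper_extension (hs : s.IsSemiGood lam) (hlam : Cardinal.aleph0 ≤ lam)
    {M : Model L} (hM : s.K.Mem M) (hc : M.HasCard (Order.succ lam)) :
    ∃ M', s.K.le M M' ∧ M ≠ M' ∧ M'.HasCard (Order.succ lam) := by
  obtain ⟨N, hN, hNM⟩ := hs.exists_mod_le hlam hM (hc.cardGe.of_le (Order.le_succ lam))
  obtain ⟨N', a, ha⟩ := hs.exists_basic hN
  obtain ⟨M', b, hM', hb, -⟩ := hs.exists_nonForking_extension hlam hN hNM hc ha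
  exact ⟨M', hb.le, fun h => hb.notMem (h ▸ hb.mem), hM'⟩

theorem mk_basic_types_le (hs : s.IsSemiGood lam) (hlam : Cardinal.aleph0 ≤ lam)
    {N : Ordinal.{u} → Model L} (hN : ∀ α < (Order.succ lam).ord, s.Mod (N α)) :
    Cardinal.mk (Σ α : Iio (Order.succ lam).ord, s.Sbs (N α)) ≤
      Cardinal.lift.{u + 1} (Order.succ lam) := by
  rw [Cardinal.mk_sigma]
  refine (Cardinal.sum_le_mk_mul_iSup _).trans ?_
  rw [← Cardinal.mul_eq_self (Cardinal.aleph0_le_lift.2 (hlam.trans (Order.le_succ lam))),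
    Cardinal.mk_Iio_ordinal, Cardinal.card_ord]
  exact mul_le_mul' le_rfl (ciSup_le' fun α => hs.frameAxioms.stability _ (hN α α.2))

/-- There are at most `lam⁺` basic types over the members of a filtration of `M`; they are
realized one after the other. -/
theorem exists_realizing_extension (hs : s.IsSemiGood lam) (hlam : Cardinal.aleph0 ≤ lam)
    {M : Model L} (hM : s.K.Mem M) (hc : M.HasCard (Order.succ lam)) :
    ∃ M', s.K.le M M' ∧ M'.HasCard (Order.succ lam) ∧
      ∀ N, s.Mod N → s.K.le N M → ∀ p ∈ s.Sbs N, ∃ a, s.K.IsTp p M' a := by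
  have hK := hs.core
  have hlam' := hlam.trans (Order.le_succ lam)
  obtain ⟨N₀, hN₀, hN₀M⟩ := hs.exists_mod_le hlam hM (hc.cardGe.of_le (Order.le_succ lam))
  obtain ⟨N, hN0, hN, hNM, hU⟩ := hs.aec.exists_filtration hlam hc hN₀M (hs.card hN₀)
  set θ := (Order.succ lam).ord
  have hθ : Order.IsSuccLimit θ := isSuccLimit_ord_succ hlam
  have hNmod : ∀ α < θ, s.Mod (N α) := fun α hα => hs.mod_of_le (hNM α hα).1 (hNM α hα).2
  let Y := Σ α : Iio θ, s.Sbs (N α)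
  have hY := hs.mk_basic_types_le hlam hNmod
  have hYne : Nonempty Y := by
    obtain ⟨_, _, p, hp, -⟩ := hs.exists_basic (hNmod 0 hθ.bot_lt)
    exact ⟨⟨⟨0, hθ.bot_lt⟩, p, hp⟩⟩
  obtain ⟨e, he⟩ := exists_enumeration hY
  obtain ⟨X, hX0, hX, hXM, hT⟩ := hK.exists_chain (θ := θ)
    (Good := fun _ X => s.K.le M X ∧ X.HasCard (Order.succ lam))
    (T := fun i _ X => ∃ a, s.K.IsTp (e i).2.1 X a) hθ.bot_lt (M₀ := M)
    (fun _ X h => (hK.le_mem _ _ h.1).2) ⟨hK.le_refl _ hM, hc⟩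
    (fun i X _ hX => by
      obtain ⟨P, a, hp⟩ := AClass.exists_isTp' (e i).2.1
      have hi := (e i).1.2
      obtain ⟨M', b, hM', hb, hb'⟩ := hs.exists_nonForking_extension hlam (hNmod _ hi)
        (hK.le_trans _ _ _ (hNM _ hi).1 hX.1) hX.2 ⟨_, (e i).2.2, hp⟩
      exact ⟨M', ⟨hK.le_trans _ _ _ hX.1 hb.le, hM'⟩, hb.le, b, hp.of_sameType hb'⟩)
    (fun α hα hα' X U hX _ hU _ hle => ⟨hK.le_trans _ _ _ (hX 0 hα'.bot_lt).1 (hle 0 hα'.bot_lt),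
      hU.hasCard hlam' hα'.bot_lt (hα.trans (Cardinal.ord_lt_ord.2 (Order.lt_succ _)))
        fun β hβ => (hX β hβ).2⟩)
  obtain ⟨M', hM'U, -, hle⟩ := hK.exists_limit hθ hX
  refine ⟨M', hX0 ▸ hle 0 hθ.bot_lt, hM'U.hasCard hlam' hθ.bot_lt
    (Cardinal.ord_lt_ord.2 (Order.lt_succ _)) fun β hβ => (hXM β hβ).2, fun P hP hPM p hp => ?_⟩
  -- a basic type over `P ≼ N α` is a restriction of a basic type over `N α`
  obtain ⟨α, hα, hPα⟩ := hK.exists_le_of_isUnion hlam hN hU (fun α hα => (hNM α hα).1) hPM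
    (hs.card hP)
  obtain ⟨Q, a, ha⟩ := AClass.exists_isTp' p
  obtain ⟨Q', b, -, hb, hd⟩ := hs.extension ⟨p, hp, ha⟩ hP (hNmod α hα) hPα
  obtain ⟨q, hq, hq'⟩ := hs.basic_of_typeDnf hd
  obtain ⟨i, hi, hei⟩ := he ⟨⟨α, hα⟩, q, hq⟩
  obtain ⟨d, hd'⟩ := hT i (hθ.succ_lt hi)
  rw [hei] at hd'
  have hd'' := hd'.mono_top hK (hle _ (hθ.succ_lt hi))
  refine ⟨d, ha.of_sameType (hb.trans ?_)⟩
  exact AClass.SameType.restrict hK ⟨q, hq', hd''⟩ hPα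

theorem exists_basicSaturated (hs : s.IsSemiGood lam) (hlam : Cardinal.aleph0 ≤ lam)
    {M : Model L} (hM : s.K.Mem M) (hc : M.HasCard (Order.succ lam)) :
    ∃ M', s.K.le M M' ∧ s.BasicSaturated lam M' := by
  have hK := hs.core
  have hlam' := hlam.trans (Order.le_succ lam)
  have hθ := isSuccLimit_ord_succ hlam
  obtain ⟨X, hX0, hX, hXM, hT⟩ := hK.exists_chain (θ := (Order.succ lam).ord)
    (Good := fun _ X => s.K.le M X ∧ X.HasCard (Order.succ lam))
    (T := fun _ X X' => ∀ N, s.Mod N → s.K.le N X → ∀ p ∈ s.Sbs N, ∃ a, s.K.IsTp p X' a)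
    hθ.bot_lt (M₀ := M) (fun _ X h => (hK.le_mem _ _ h.1).2) ⟨hK.le_refl _ hM, hc⟩
    (fun i X _ hX => by
      obtain ⟨M', hle, hM', h⟩ := hs.exists_realizing_extension hlam (hK.le_mem _ _ hX.1).2 hX.2
      exact ⟨M', ⟨hK.le_trans _ _ _ hX.1 hle, hM'⟩, hle, h⟩)
    (fun α hα hα' X U hX _ hU _ hle => ⟨hK.le_trans _ _ _ (hX 0 hα'.bot_lt).1 (hle 0 hα'.bot_lt),
      hU.hasCard hlam' hα'.bot_lt (hα.trans (Cardinal.ord_lt_ord.2 (Order.lt_succ _)))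
        fun β hβ => (hX β hβ).2⟩)
  obtain ⟨M', hM'U, hM', hle⟩ := hK.exists_limit hθ hX
  refine ⟨M', hX0 ▸ hle 0 hθ.bot_lt, hM', hM'U.hasCard hlam' hθ.bot_lt
    (Cardinal.ord_lt_ord.2 (Order.lt_succ _)) fun β hβ => (hXM β hβ).2, fun P hP hPM p hp => ?_⟩
  obtain ⟨α, hα, hPα⟩ := hK.exists_le_of_isUnion hlam hX hM'U hle hPM (hs.card hP)
  obtain ⟨a, ha⟩ := hT α (hθ.succ_lt hα) P hP hPα p hp
  exact ⟨a, ha.mono_top hK (hle _ (hθ.succ_lt hα))⟩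

/-- The successor step in the proof of model homogeneity: if the embedding `f : A → B` is not onto,
it extends to an embedding `f' : A' → B'` whose range contains a new element of `B`. -/
theorem exists_homogeneity_step (hs : s.IsSemiGood lam) (hlam : Cardinal.aleph0 ≤ lam)
    {M A B : Model L} (hM : s.BasicSaturated lam M) {f : ZFSet.{u} → ZFSet.{u}} (hA : s.Mod A)
    (hAM : s.K.le A M) (hB : s.Mod B) (hf : s.K.KMap f A B) (hne : A.map f ≠ B) :
    ∃ A' B' f', s.Mod A' ∧ s.Mod B' ∧ s.K.le A A' ∧ s.K.le A' M ∧ s.K.le B B' ∧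
      s.K.KMap f' A' B' ∧ EqOn f' f A.carrier ∧
      ∃ b ∈ A'.carrier, f' b ∈ B.carrier ∧ f' b ∉ (A.map f).carrier := by
  have hK := hs.core
  have hAf := hs.mod_map hA hf.1
  obtain ⟨a, ha⟩ := hs.frameAxioms.density _ _ ⟨hf.2, hAf, hB⟩ hne
  obtain ⟨G, hG, hAG, hGf⟩ := hf.exists_pullback hK
  have hGmap : s.K.KMap G B (B.map G) := .of_injOn hK (hs.mem hB) hG
  have haG := hs.basic_map hlam hAf ha hGmap
  rw [Model.map_map hf.1 (hG.mono (hK.subset hf.2)), Model.map_eq_self (f := G ∘ f) hGf] at haG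
  obtain ⟨p, hp, hp'⟩ := haG
  obtain ⟨b, hb⟩ := hM.realize A hA hAM p hp
  obtain ⟨A', hA', hAA', hA'M, hbA'⟩ := hs.exists_between_singleton hlam hA hAM hb.mem
  have hsame : s.K.SameType A (B.map G) (G a) A' b :=
    .trans ⟨p, hp', hb⟩ (.symm (.of_le hK hAA' hA'M hbA' hb.notMem))
  obtain ⟨P, F, hP, hBP, hF, hFA, hFb⟩ := hs.exists_amalgam_of_sameType hlam hA
    (hs.mod_map hB hG) hA' hsame
  obtain ⟨H, hH, hBH, hHG⟩ := (hGmap.trans_le hK hBP).exists_pullback hK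
  have hval : (H ∘ F) b = a := by simp only [Function.comp, hFb, hHG a ha.mem]
  refine ⟨A', P.map H, H ∘ F, hA', hs.mod_map hP hH, hAA', hA'M, hBH,
    hF.comp hK (.of_injOn hK (hs.mem hP) hH), fun x hx => ?_, b, hbA', ?_, ?_⟩
  · have h1 : F x = G (f x) := (hFA hx).trans (hGf x hx).symm
    simp only [Function.comp, h1, hHG _ (hf.mem hK hx)]
  · rw [hval]
    exact ha.mem
  · rw [hval]
    exact ha.notMem

/-- A model that realizes the basic types is model homogeneous. Otherwise the successor step can
be iterated `lam⁺` times, which is impossible by a closure argument. -/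
theorem exists_embedding (hs : s.IsSemiGood lam) (hlam : Cardinal.aleph0 ≤ lam)
    {M N₀ N : Model L} (hM : s.BasicSaturated lam M) (hN₀ : s.Mod N₀) (hN₀M : s.K.le N₀ M)
    (hN : s.Mod N) (hle : s.K.le N₀ N) : ∃ F, s.K.KMap F N M ∧ EqOn F id N₀.carrier := by
  have hK := hs.core
  by_contra! hcon
  have hθ := isSuccLimit_ord_succ hlam
  obtain ⟨c, hc0, hc, hgood, hT⟩ := hK.exists_stateChain (θ := (Order.succ lam).ord)
    (Good := fun _ c => s.K.KMap c.map c.dom c.cod ∧ s.Mod c.dom ∧ s.Mod c.cod ∧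
      s.K.le c.dom M ∧ s.K.le N₀ c.dom ∧ s.K.le N c.cod ∧ EqOn c.map id N₀.carrier)
    (T := fun _ c d => ∃ b ∈ d.dom.carrier, d.map b ∈ c.cod.carrier ∧
      d.map b ∉ (c.dom.map c.map).carrier)
    hθ.bot_lt (s₀ := ⟨N₀, N, id⟩) (fun _ _ h => h.1)
    ⟨.of_le hle, hN₀, hN, hN₀M, hK.le_refl _ (hs.mem hN₀), hK.le_refl _ (hs.mem hN),
      fun _ _ => rfl⟩
    (by
      rintro α ⟨A, B, f⟩ - ⟨hf, hA, hB, hAM, hN₀A, hNB, hfid⟩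
      dsimp only at hf hA hB hAM hN₀A hNB hfid
      have hne : A.map f ≠ B := by
        intro heq
        obtain ⟨g, hg, hgf⟩ := AClass.KMap.exists_factor hf.1 (.of_le hAM)
        refine hcon g (hg.restrict hK (heq ▸ hNB)) fun x hx => ?_
        have := hgf x (hK.subset hN₀A hx)
        rwa [hfid hx] at this
      obtain ⟨A', B', f', hA', hB', hAA', hA'M, hBB', hf', hff', hb⟩ :=
        hs.exists_homogeneity_step hlam hM hA hAM hB hf hne
      exact ⟨⟨A', B', f'⟩, ⟨hf', hA', hB', hA'M, hK.le_trans _ _ _ hN₀A hAA',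
        hK.le_trans _ _ _ hNB hBB', fun x hx => (hff' (hK.subset hN₀A hx)).trans (hfid hx)⟩,
        ⟨hAA', hBB', hff'⟩, hb⟩)
    (by
      intro α hα hα' c t hc hch ht hd hcod hle
      have h0 := hα'.bot_lt
      have hdM := hK.smooth α _ _ M trivial hα' (hch.dom_chain hK) hd fun β hβ =>
        (hc β hβ).2.2.2.1
      have hN₀0 := (hc 0 h0).2.2.2.2.1
      refine ⟨ht, hs.mod_of_le hdM (hd.hasCard hlam h0 hα fun β hβ => hs.card (hc β hβ).2.1),
        (hs.mod_iff _).2 ⟨(hK.le_mem _ _ ht.2).2, hcod.hasCard hlam h0 hα fun β hβ =>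
          hs.card (hc β hβ).2.2.1⟩, hdM, hK.le_trans _ _ _ hN₀0 (hle 0 h0).1,
        hK.le_trans _ _ _ (hc 0 h0).2.2.2.2.2.1 (hle 0 h0).2.1, fun x hx => ?_⟩
      exact ((hle 0 h0).2.2 (hK.subset hN₀0 hx)).trans ((hc 0 h0).2.2.2.2.2.2 hx))
  obtain ⟨α, hα, h⟩ := exists_inter_subset hlam (A := fun α => (c α).cod.carrier)
    (B := fun α => ((c α).dom.map (c α).map).carrier)
    (fun α hα => (hs.card (hgood α hα).2.2.1).le) (fun α hα hα' => (hc.cod_union α hα hα').1)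
    (fun α β hαβ hβ => hK.subset (hc.le α β hαβ hβ).2.1) (fun α β hαβ hβ => by
      rw [Model.map_carrier (hc.kMap α (hαβ.trans hβ)).1, Model.map_carrier (hc.kMap β hβ).1]
      rintro _ ⟨x, hx, rfl⟩
      exact ⟨x, hK.subset (hc.le α β hαβ hβ).1 hx, (hc.le α β hαβ hβ).2.2 hx⟩)
  have hα' := hθ.succ_lt hα
  obtain ⟨b, hb, hb', hb''⟩ := hT α hα'
  exact hb'' (h _ hα' ⟨hb', Model.mem_map (hc.kMap _ hα').1 hb⟩)

/-- Realizing the basic types suffices for saturation: by model homogeneity every extension of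
cardinality `lam` of a small submodel embeds over it, so that all types are realized. -/
theorem isSaturated_iff (hs : s.IsSemiGood lam) (hlam : Cardinal.aleph0 ≤ lam) {M : Model L} :
    s.K.IsSaturated lam M ↔ s.BasicSaturated lam M := by
  have hK := hs.core
  constructor
  · rintro ⟨h1, h2, h3⟩
    exact ⟨h1, h2, fun N hN hNM p _ => h3 N hNM (hs.card hN) p⟩
  · intro hM
    refine ⟨hM.mem, hM.card, fun N hNM hN p => ?_⟩
    have hNmod := hs.mod_of_le hNM hN
    obtain ⟨P, a, ha⟩ := AClass.exists_isTp' p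
    obtain ⟨Q, hQ, hNQ, hQP, haQ⟩ := hs.exists_between_singleton hlam hNmod ha.le ha.mem
    obtain ⟨F, hF, hFN⟩ := hs.exists_embedding hlam hM hNmod hNM hQ hNQ
    exact ⟨F a, ha.of_sameType ((AClass.SameType.of_le hK hNQ hQP haQ ha.notMem).symm.trans
      (.of_kMap_fix hK hNQ hF hFN haQ ha.notMem))⟩

theorem exists_isSaturated (hs : s.IsSemiGood lam) (hlam : Cardinal.aleph0 ≤ lam)
    {M : Model L} (hM : s.K.Mem M) (hc : M.HasCard (Order.succ lam)) :
    ∃ M', s.K.le M M' ∧ s.K.IsSaturated lam M' := by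
  obtain ⟨M', hle, hM'⟩ := hs.exists_basicSaturated hlam hM hc
  exact ⟨M', hle, (hs.isSaturated_iff hlam).2 hM'⟩

/-- A saturated model is universal: embeddings of the members of a filtration are extended by
model homogeneity, starting with joint embedding in cardinality `lam`. -/
theorem exists_kMap_of_isSaturated (hs : s.IsSemiGood lam) (hlam : Cardinal.aleph0 ≤ lam)
    {M₁ M₂ : Model L} (h₁ : s.K.Mem M₁) (hc : M₁.HasCard (Order.succ lam))
    (h₂ : s.K.IsSaturated lam M₂) : ∃ F, s.K.KMap F M₁ M₂ := by
  have hK := hs.core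
  rw [hs.isSaturated_iff hlam] at h₂
  have hθ := isSuccLimit_ord_succ hlam
  obtain ⟨N₁, hN₁, hN₁M⟩ := hs.exists_mod_le hlam h₁ (hc.cardGe.of_le (Order.le_succ lam))
  obtain ⟨N₂, hN₂, hN₂M⟩ := hs.exists_mod_le hlam h₂.mem
    (h₂.card.cardGe.of_le (Order.le_succ lam))
  obtain ⟨f₀, hf₀⟩ : ∃ f, s.K.KMap f N₁ M₂ := by
    obtain ⟨N₃, g₁, g₂, hN₃, ⟨A₁, hA₁, he₁⟩, ⟨A₂, hA₂, he₂⟩⟩ := hs.jep N₁ N₂ ⟨hs.mem hN₁, hN₁⟩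
      ⟨hs.mem hN₂, hN₂⟩
    obtain ⟨G₁, hG₁, -⟩ := AClass.IsEmb.exists_kMap hK (e := g₁) ⟨A₁, hA₁.1, he₁⟩
    obtain ⟨G₂, hG₂, -⟩ := AClass.IsEmb.exists_kMap hK (e := g₂) ⟨A₂, hA₂.1, he₂⟩
    obtain ⟨H, hH, hle, -⟩ := hG₂.exists_pullback hK
    obtain ⟨F, hF, -⟩ := hs.exists_embedding hlam h₂ hN₂ hN₂M (hs.mod_map hN₃.2 hH) hle
    exact ⟨_, (hG₁.comp hK (.of_injOn hK (hs.mem hN₃.2) hH)).comp hK hF⟩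
  obtain ⟨N, hN0, hN, hNM, hU⟩ := hs.aec.exists_filtration hlam hc hN₁M (hs.card hN₁)
  obtain ⟨c, -, hch, hgood, -⟩ := hK.exists_stateChain (θ := (Order.succ lam).ord)
    (Good := fun α c => s.K.KMap c.map c.dom c.cod ∧ c.dom = N α ∧ c.cod = M₂)
    (T := fun _ _ _ => True) hθ.bot_lt (s₀ := ⟨N₁, M₂, f₀⟩) (fun _ _ h => h.1)
    ⟨hf₀, hN0.symm, rfl⟩
    (by
      rintro α ⟨A, B, f⟩ hα ⟨hf, hA, hB⟩
      dsimp only at hf hA hB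
      subst hA
      rw [hB] at hf
      have hα' := (Order.lt_succ α).trans hα
      have hle := hN.2.1 _ _ (Order.lt_succ α) hα
      have := (N α).small
      obtain ⟨G, hG, hGf, -⟩ := exists_injOn_extension (A := (N (Order.succ α)).carrier) (C := ∅)
        hf.1
      have hmod : s.Mod (N (Order.succ α)) := hs.mod_of_le (hNM _ hα).1 (hNM _ hα).2
      have hmod' : s.Mod (N α) := hs.mod_of_le (hNM _ hα').1 (hNM _ hα').2
      have hle' := hK.le_map hle hG
      rw [Model.map_congr (hG.mono (hK.subset hle)) hGf] at hle'
      obtain ⟨F, hF, hFid⟩ := hs.exists_embedding hlam h₂ (hs.mod_map hmod' hf.1) hf.2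
        (hs.mod_map hmod hG) hle'
      refine ⟨⟨N (Order.succ α), M₂, F ∘ G⟩, ⟨(AClass.KMap.of_injOn hK (hs.mem hmod) hG).comp hK hF,
        rfl, rfl⟩, ⟨hle, by
        dsimp only
        rw [hB]
        exact hK.le_refl _ h₂.mem, fun x hx => ?_⟩, trivial⟩
      simp only [Function.comp, hGf hx]
      exact hFid (Model.mem_map hf.1 hx))
    (by
      intro α hα hα' c t hc hch ht hd hcod hle
      refine ⟨ht, hK.isUnion_unique hα' (hN.mono hα.le) (hd.congr fun β hβ => (hc β hβ).2.1)
        (hN.2.2 α hα hα'), hcod.eq_of_const hα'.bot_lt fun β hβ => (hc β hβ).2.2⟩)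
  obtain ⟨t, ht, hd, hcod, hle⟩ := hch.exists_limit hK hθ
  have htM : t.dom = M₁ :=
    hK.isUnion_unique hθ hN (hd.congr fun β hβ => (hgood β hβ).2.1) hU
  have htM₂ : t.cod = M₂ := hcod.eq_of_const hθ.bot_lt fun β hβ => (hgood β hβ).2.2
  rw [htM, htM₂] at ht
  exact ⟨_, ht⟩

/-! ### Local character and continuity over larger models -/

/-- Given a continuous chain of length `δ + 1`, every model `N ≼ M δ` of cardinality `lam` is
contained in the last member of a continuous chain of models of cardinality `lam` of limit length
less than `lam⁺` whose other members are contained in some `M α` with `α < δ`. -/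
theorem exists_cofinal_chain (hs : s.IsSemiGood lam) (hlam : Cardinal.aleph0 ≤ lam)
    {M : Ordinal.{u} → Model L} {δ : Ordinal.{u}} (hδ : Order.IsSuccLimit δ)
    (hM : s.K.IsChain (Order.succ δ) M) {N₀ N : Model L} (hN₀ : s.Mod N₀) (hN₀M : s.K.le N₀ (M 0))
    (hN : s.Mod N) (hNM : s.K.le N (M δ)) :
    ∃ (μ : Ordinal.{u}) (C : Ordinal.{u} → Model L), μ < (Order.succ lam).ord ∧
      Order.IsSuccLimit μ ∧ s.K.IsChain (Order.succ μ) C ∧ C 0 = N₀ ∧ (∀ i ≤ μ, s.Mod (C i)) ∧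
      (∀ i < μ, ∃ α < δ, s.K.le (C i) (M α)) ∧ s.K.le (C μ) (M δ) ∧ s.K.le N (C μ) := by
  classical
  have hK := hs.core
  have : Nonempty N.carrier := by
    rw [← Cardinal.mk_ne_zero_iff, hs.card hN]
    exact (Cardinal.aleph0_pos.trans_le (Cardinal.aleph0_le_lift.2 hlam)).ne'
  obtain ⟨e, he⟩ := exists_enumeration (hs.card hN).le
  have hmem : ∀ j, ∃ α < δ, (e j : ZFSet.{u}) ∈ (M α).carrier := fun j =>
    (hM.2.2 δ (Order.lt_succ δ) hδ).exists_mem (hK.subset hNM (e j).2)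
  choose a ha ha' using hmem
  obtain ⟨μ, h, hμ, hμ', hhδ, hh, hdom⟩ := exists_dominating_sequence hlam hδ fun j _ => ha j
  let h' : Ordinal.{u} → Ordinal.{u} := fun i => if i < μ then h i else δ
  have hlt : ∀ i < μ, h' i = h i := fun i hi => if_pos hi
  have hμδ : h' μ = δ := if_neg (lt_irrefl _)
  have hle_δ : ∀ i, h' i < Order.succ δ := fun i => by
    by_cases hi : i < μ
    · rw [hlt i hi]
      exact (hhδ i hi).trans (Order.lt_succ δ)
    · exact (if_neg hi : h' i = δ) ▸ Order.lt_succ δ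
  have hmono : ∀ i j, i ≤ j → j ≤ μ → h' i ≤ h' j := by
    intro i j hij hj
    rcases hj.eq_or_lt with rfl | hj
    · rw [hμδ]
      exact Order.lt_succ_iff.1 (hle_δ i)
    · rw [hlt i (hij.trans_lt hj), hlt j hj]
      exact hh i j hij hj
  have hMle : ∀ i j, i ≤ j → j ≤ μ → s.K.le (M (h' i)) (M (h' j)) := fun i j hij hj =>
    hM.le hK (hmono i j hij hj) (hle_δ j)
  obtain ⟨C, hC0, hC, hgood, hT⟩ := hK.exists_chain (θ := Order.succ μ)
    (Good := fun i C => s.Mod C ∧ s.K.le C (M (h' i)))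
    (T := fun i _ C => N.carrier ∩ (M (h' i)).carrier ⊆ C.carrier)
    (hμ'.bot_lt.trans (Order.lt_succ μ)) (M₀ := N₀) (fun _ C hC => hs.mem hC.1)
    ⟨hN₀, hK.le_trans _ _ _ hN₀M (hM.le hK bot_le (hle_δ 0))⟩
    (fun i C hi hC => by
      have hle := hMle _ _ (Order.le_succ i) (Order.lt_succ_iff.1 hi)
      obtain ⟨C', hC', hCC', hC'M, hsub⟩ := hs.exists_between hlam hC.1
        (hK.le_trans _ _ _ hC.2 hle) (A := N.carrier ∩ (M (h' i)).carrier)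
        (inter_subset_right.trans (hK.subset hle))
        ((Cardinal.mk_le_mk_of_subset inter_subset_left).trans (hs.card hN).le)
      exact ⟨C', ⟨hC', hC'M⟩, hCC', hsub⟩)
    (fun α hα hα' C U hC hch hU _ hle => by
      have hα := Order.lt_succ_iff.1 hα
      have hUM := hK.smooth α C U (M (h' α)) trivial hα' hch hU fun β hβ =>
        hK.le_trans _ _ _ (hC β hβ).2 (hMle _ _ hβ.le hα)
      exact ⟨hs.mod_of_le hUM (hU.hasCard hlam hα'.bot_lt (hα.trans_lt hμ) fun β hβ =>
        hs.card (hC β hβ).1), hUM⟩)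
  have hCμ := (hgood μ (Order.lt_succ μ)).2
  rw [hμδ] at hCμ
  refine ⟨μ, C, hμ, hμ', hC, hC0, fun i hi => (hgood i (Order.lt_succ_iff.2 hi)).1, fun i hi =>
    ⟨h' i, hlt i hi ▸ hhδ i hi, (hgood i (hi.trans (Order.lt_succ μ))).2⟩, hCμ,
    hK.le_of_subset (fun x hx => ?_) hNM hCμ⟩
  obtain ⟨j, hj, hjx⟩ := he ⟨x, hx⟩
  obtain ⟨i, hi, hai⟩ := hdom j hj
  rw [← hlt i hi] at hai
  have hx' : x ∈ (M (h' i)).carrier := by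
    have := ha' j
    rw [hjx] at this
    exact hK.subset (hM.le hK hai (hle_δ i)) this
  have hi' := hμ'.succ_lt hi
  exact hK.subset (hC.2.1 _ _ hi' (Order.lt_succ μ))
    (hT i (hi'.trans (Order.lt_succ μ)) ⟨hx, hx'⟩)

/-- Local character: a type over `M δ` that does not fork over a model of cardinality `lam` does not
fork over one that is contained in `M α` for some `α < δ`. -/
theorem exists_nonForking_of_isChain (hs : s.IsSemiGood lam) (hlam : Cardinal.aleph0 ≤ lam)
    {M : Ordinal.{u} → Model L} {δ : Ordinal.{u}} (hδ : Order.IsSuccLimit δ)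
    (hM : s.K.IsChain (Order.succ δ) M) (hc : (M 0).CardGe lam) {N₀ N : Model L} {a : ZFSet.{u}}
    (h : s.NonForking N₀ (M δ) N a) :
    ∃ α < δ, ∃ P, s.K.le P (M α) ∧ s.NonForking P (M δ) N a := by
  have hK := hs.core
  obtain ⟨P₀, hP₀, hP₀M⟩ := hs.exists_mod_le hlam
    (hM.1 0 (hδ.bot_lt.trans (Order.lt_succ δ))) hc
  obtain ⟨μ, C, hμ, hμ', hC, -, hmod, hCM, hCμ, hN₀C⟩ := hs.exists_cofinal_chain hlam hδ hM hP₀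
    hP₀M h.mod h.le_base
  have hCmod := hmod μ le_rfl
  have hNF := hs.nonForking_mono_base h hCmod hN₀C hCμ
  obtain ⟨i, hi, hd⟩ := hs.localCharacter hlam hμ hμ' hC hmod
    (hs.basic_of_typeDnf (hNF.typeDnf _ hCmod (hK.le_refl _ (hs.mem hCmod)) hCμ))
  obtain ⟨α, hα, hle⟩ := hCM i hi
  exact ⟨α, hα, C i, hle, hs.nonForking_trans hlam hd hNF⟩

/-- Continuity: if the restriction to each `M α`, `α < δ`, does not fork over some model of
cardinality `lam` inside `M 0`, possibly depending on `α`, then the type over `M δ` does not either.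
-/
theorem nonForking_of_isChain (hs : s.IsSemiGood lam) (hlam : Cardinal.aleph0 ≤ lam)
    {M : Ordinal.{u} → Model L} {δ : Ordinal.{u}} (hδ : Order.IsSuccLimit δ)
    (hM : s.K.IsChain (Order.succ δ) M) {N : Model L} {a : ZFSet.{u}} (hN : s.K.le (M δ) N)
    (ha : a ∈ N.carrier) (ha' : a ∉ (M δ).carrier)
    (h : ∀ α < δ, ∃ P, s.K.le P (M 0) ∧ s.NonForking P (M α) N a) :
    ∃ P, s.K.le P (M 0) ∧ s.NonForking P (M δ) N a := by
  have hK := hs.core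
  obtain ⟨P, hP, hPN⟩ := h 0 hδ.bot_lt
  have hle : ∀ α ≤ δ, s.K.le (M 0) (M α) := fun α hα => hM.le hK bot_le (Order.lt_succ_iff.2 hα)
  -- by transitivity the same `P` works for all `α`
  have hall : ∀ α < δ, s.NonForking P (M α) N a := by
    intro α hα
    obtain ⟨Q, hQ, hQN⟩ := h α hα
    obtain ⟨R, hR, hPR, hQR, hRM⟩ := hs.exists_upper_bound hlam hPN.mod hP hQN.mod hQ
    exact hs.nonForking_trans hlam (hPN.typeDnf R hR hPR hRM)
      (hs.nonForking_mono_base hQN hR hQR (hK.le_trans _ _ _ hRM (hle α hα.le)))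
  refine ⟨P, hP, hs.nonForking_of_cofinal hPN.mod (hK.le_trans _ _ _ hP (hle δ le_rfl)) hN ha ha'
    fun N' hN' _ hN'M => ?_⟩
  obtain ⟨μ, C, hμ, hμ', hC, hC0, hmod, hCM, hCμ, hN'C⟩ := hs.exists_cofinal_chain hlam hδ hM
    hPN.mod hP hN' hN'M
  refine ⟨C μ, hN'C, ?_⟩
  rw [← hC0]
  refine hs.continuity hlam hμ hμ' hC hmod (hK.le_trans _ _ _ hCμ hN) ha
    (fun h => ha' (hK.subset hCμ h)) fun i hi => ?_
  obtain ⟨α, hα, hle'⟩ := hCM i hi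
  rw [hC0]
  exact (hall α hα).typeDnf _ (hmod i hi.le)
    (hC0 ▸ hC.le hK bot_le (hi.trans (Order.lt_succ μ))) hle'

/-! ### The derived frames -/

theorem dnfGe_iff (hs : s.IsSemiGood lam) {M₀ M₁ M₂ : Model L} {a : ZFSet.{u}} :
    s.DnfGe lam M₀ a M₁ M₂ ↔
      s.K.le M₀ M₁ ∧ ∃ N₀, s.K.le N₀ M₀ ∧ s.NonForking N₀ M₁ M₂ a := by
  have hK := hs.core
  constructor
  · rintro ⟨-, -, -, h₀, h₁, ha, ha', N₀, hN₀, hle, h⟩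
    exact ⟨h₀, N₀, hle, hN₀, hK.le_trans _ _ _ hle h₀, h₁, ha, ha', h⟩
  · rintro ⟨h₀, N₀, hle, h⟩
    have hc := (hs.card h.mod).cardGe
    have h₁ := hc.mono (hK.subset h.le_base)
    exact ⟨hc.mono (hK.subset hle), h₁, h₁.mono (hK.subset h.le), h₀, h.le, h.mem, h.notMem, N₀,
      h.mod, hle, h.typeDnf⟩

theorem derived_basic_iff (hs : s.IsSemiGood lam) {P : Model L → Prop} {M N : Model L}
    {a : ZFSet.{u}} : (s.derived lam P).Basic M N a ↔ ∃ N₀, s.NonForking N₀ M N a := by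
  constructor
  · rintro ⟨p, ⟨N₁, -, -, M₂, b, hb, hd⟩, hp⟩
    obtain ⟨-, N₀, -, h⟩ := hs.dnfGe_iff.1 hd
    exact ⟨N₀, hs.nonForking_of_sameType h ⟨p, hb, hp⟩⟩
  · rintro ⟨N₀, h⟩
    obtain ⟨p, hp⟩ := AClass.exists_isTp h.le h.mem h.notMem
    exact ⟨p, ⟨N₀, h.mod, h.le_base, N, a, hp, hs.dnfGe_iff.2 ⟨h.le_base, N₀,
      hs.core.le_refl _ (hs.mem h.mod), h⟩⟩, hp⟩

theorem derived_typeDnf_iff (hs : s.IsSemiGood lam) {P : Model L → Prop} {M₀ M₁ M₂ : Model L}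
    {a : ZFSet.{u}} (hM₂ : P M₂) : (s.derived lam P).TypeDnf M₀ M₁ M₂ a ↔
      P M₀ ∧ P M₁ ∧ s.K.le M₀ M₁ ∧ ∃ N₀, s.K.le N₀ M₀ ∧ s.NonForking N₀ M₁ M₂ a := by
  constructor
  · rintro ⟨N, b, hb, hM₀, hM₁, -, hd⟩
    obtain ⟨hle, N₀, hN₀, h⟩ := hs.dnfGe_iff.1 hd
    exact ⟨hM₀, hM₁, hle, N₀, hN₀, hs.nonForking_of_sameType h hb.symm⟩
  · rintro ⟨hM₀, hM₁, hle, N₀, hN₀, h⟩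
    exact ⟨M₂, a, .refl h.le h.mem h.notMem, hM₀, hM₁, hM₂, hs.dnfGe_iff.2 ⟨hle, N₀, hN₀, h⟩⟩

/-- Tameness, for types realized in models of arbitrary cardinality. -/
theorem sameType_of_tame (hs : s.IsSemiGood lam) (hlam : Cardinal.aleph0 ≤ lam)
    {P : Model L → Prop} (hP : ∀ M, P M → M.HasCard (Order.succ lam)) (ht : s.TameOver lam P)
    {N₀ M N₁ N₂ : Model L} {a₁ a₂ : ZFSet.{u}} (hM : P M) (h₁ : s.NonForking N₀ M N₁ a₁)
    (h₂ : s.NonForking N₀ M N₂ a₂) (h : s.K.SameType N₀ N₁ a₁ N₂ a₂) :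
    s.K.SameType M N₁ a₁ N₂ a₂ := by
  have hK := hs.core
  have hcut : ∀ {N a}, s.NonForking N₀ M N a → ∃ N' : Model L, N'.HasCard (Order.succ lam) ∧
      s.K.SameType M N' a N a := by
    intro N a h
    obtain ⟨N', hMN', hN'N, ha, hc⟩ := hs.aec.exists_between hlam (Order.le_succ lam) h.le (hP M hM)
      (singleton_subset_iff.2 h.mem) (mk_singleton_le (hlam.trans (Order.le_succ lam)) a)
    exact ⟨N', hc, .of_le hK hMN' hN'N (singleton_subset_iff.1 ha) h.notMem⟩
  obtain ⟨N₁', hc₁, e₁⟩ := hcut h₁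
  obtain ⟨N₂', hc₂, e₂⟩ := hcut h₂
  obtain ⟨p₁, hp₁, hp₁'⟩ := e₁
  obtain ⟨p₂, hp₂, hp₂'⟩ := e₂
  have hnf : ∀ {N a} {p : s.K.GType M}, s.K.IsTp p N a → s.NonForking N₀ M N a →
      s.PDnfGe lam N₀ p := fun hp h => ⟨_, _, hp, hs.dnfGe_iff.2 ⟨h.le_base, N₀,
        hK.le_refl _ (hs.mem h.mod), h⟩⟩
  have hle := h₁.le_base
  have := ht M N₁' N₂' hM (hP M hM) hc₁ hc₂ p₁ p₂ a₁ a₂ hp₁ hp₂ ⟨N₀, h₁.mod, hle,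
    (AClass.SameType.restrict hK ⟨p₁, hp₁, hp₁'⟩ hle).trans
      (h.trans (AClass.SameType.restrict hK ⟨p₂, hp₂', hp₂⟩ hle)), hnf hp₁' h₁, hnf hp₂' h₂⟩
  exact ⟨p₁, hp₁', this ▸ hp₂'⟩

/-- By tameness a basic type is determined by its restriction to a member of a filtration over
which it does not fork. -/
theorem derived_stability (hs : s.IsSemiGood lam) (hlam : Cardinal.aleph0 ≤ lam)
    {P : Model L → Prop} (hP : ∀ M, P M → s.K.Mem M ∧ M.HasCard (Order.succ lam))
    (ht : s.TameOver lam P) : (s.derived lam P).BasicStability (Order.succ lam) := by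
  intro M hM
  have hK := hs.core
  obtain ⟨hMK, hc⟩ := hP M hM
  obtain ⟨N₀, hN₀, hN₀M⟩ := hs.exists_mod_le hlam hMK (hc.cardGe.of_le (Order.le_succ lam))
  obtain ⟨N, -, hN, hNM, hU⟩ := hs.aec.exists_filtration hlam hc hN₀M (hs.card hN₀)
  have hNmod : ∀ α < (Order.succ lam).ord, s.Mod (N α) := fun α hα =>
    hs.mod_of_le (hNM α hα).1 (hNM α hα).2
  have key : ∀ p : s.SbsGt lam M, ∃ y : Σ α : Iio (Order.succ lam).ord, s.Sbs (N α),
      ∃ M₂ a, s.K.IsTp p.1 M₂ a ∧ s.NonForking (N y.1) M M₂ a ∧ s.K.IsTp y.2.1 M₂ a := by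
    rintro ⟨p, N₁, -, -, M₂, a, hp, hd⟩
    obtain ⟨-, N₂, -, h⟩ := hs.dnfGe_iff.1 hd
    obtain ⟨α, hα, hle⟩ := hK.exists_le_of_isUnion hlam hN hU (fun α hα => (hNM α hα).1) h.le_base
      (hs.card h.mod)
    have h' := hs.nonForking_mono_base h (hNmod α hα) hle (hNM α hα).1
    obtain ⟨q, hq, hq'⟩ := hs.basic_of_typeDnf (h'.typeDnf _ (hNmod α hα)
      (hK.le_refl _ (hs.mem (hNmod α hα))) (hNM α hα).1)
    exact ⟨⟨⟨α, hα⟩, q, hq⟩, M₂, a, hp, h', hq'⟩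
  choose f hf using key
  refine (Cardinal.mk_le_of_injective (f := f) fun p q hpq => Subtype.ext ?_).trans
    (hs.mk_basic_types_le hlam hNmod)
  obtain ⟨M₁, a₁, hp, hnf₁, h₁⟩ := hf p
  obtain ⟨M₂, a₂, hq, hnf₂, h₂⟩ := hf q
  rw [← hpq] at hnf₂ h₂
  exact hp.eq_of_sameType hq
    (hs.sameType_of_tame hlam (fun M hM => (hP M hM).2) ht hM hnf₁ hnf₂ ⟨_, h₁, h₂⟩)

theorem derived_basicIso (hs : s.IsSemiGood lam) (P : Model L → Prop) :
    (s.derived lam P).BasicIso := by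
  intro M N M' N' e a hMN hMN' him ha
  have hK := hs.core
  obtain ⟨F, hF, hN', hFe⟩ := Model.exists_eq_map e
  have hM' := Model.eq_map_of_imageEq hF (hK.le_sub _ _ hMN.1) hN' (hK.le_sub _ _ hMN'.1) hFe him
  obtain ⟨N₀, h⟩ := hs.derived_basic_iff.1 ha
  refine hs.derived_basic_iff.2 ⟨N₀.map F, ?_⟩
  rw [hFe, hM']
  exact hs.nonForking_map h ⟨hF, hN' ▸ hK.le_refl _ (hK.le_mem _ _ hMN'.1).2⟩

theorem derived_dnfIso (hs : s.IsSemiGood lam) (P : Model L → Prop) :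
    (s.derived lam P).DnfIso := by
  intro M₀ M₁ M₂ M₀' M₁' M₂' e a h₀₁ h₁₂ h₀₁' h₁₂' him₀ him₁ hd
  have hK := hs.core
  obtain ⟨F, hF, hM₂', hFe⟩ := Model.exists_eq_map e
  have h₀₂ := hK.le_trans _ _ _ h₀₁.1 h₁₂.1
  have h₀₂' := hK.le_trans _ _ _ h₀₁'.1 h₁₂'.1
  have hM₁' := Model.eq_map_of_imageEq hF (hK.le_sub _ _ h₁₂.1) hM₂' (hK.le_sub _ _ h₁₂'.1) hFe him₁
  have hM₀' := Model.eq_map_of_imageEq hF (hK.le_sub _ _ h₀₂) hM₂' (hK.le_sub _ _ h₀₂') hFe him₀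
  obtain ⟨-, N₀, hN₀, h⟩ := hs.dnfGe_iff.1 hd.2.2.2
  refine ⟨h₀₁'.2.1, h₀₁'.2.2, h₁₂'.2.2, hs.dnfGe_iff.2 ⟨h₀₁'.1, N₀.map F, ?_, ?_⟩⟩
  · rw [hM₀']
    exact hK.le_map hN₀ (hF.mono (hK.subset h₀₂))
  · rw [hFe, hM₁']
    exact hs.nonForking_map h ⟨hF, hM₂' ▸ hK.le_refl _ (hK.le_mem _ _ h₁₂'.1).2⟩

theorem derived_monotonicity (hs : s.IsSemiGood lam) (P : Model L → Prop) :
    (s.derived lam P).Monotonicity := by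
  intro M₀ M₀' M₁' M₁ M₂ M₂' N a h₀ h₀₁ h₁ h₁₂ h₂ h₂' hsub ha hd
  have hK := hs.core
  obtain ⟨-, N₀, hN₀, h⟩ := hs.dnfGe_iff.1 hd.2.2.2
  have hN₀' := hK.le_trans _ _ _ hN₀ h₀.1
  have h₁'N := hK.le_trans _ _ _ (hK.le_trans _ _ _ h₁.1 h₁₂.1) h₂.1
  have h' := hs.nonForking_mono h (hK.le_trans _ _ _ hN₀' h₀₁.1) h₁.1
  refine ⟨h₀.2.2, h₁.2.1, h₂'.2.1, hs.dnfGe_iff.2 ⟨h₀₁.1, N₀, hN₀',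
    hs.nonForking_of_sameType h' ((AClass.SameType.of_le hK h'.le h₂.1 h'.mem h'.notMem).trans
      (AClass.SameType.of_le hK (hK.le_of_subset hsub h₁'N h₂'.1) h₂'.1 ha h'.notMem).symm)⟩⟩

/-- The axioms of a frame for the extension of `s` to a class `P` of models of cardinality `lam⁺`
that is cofinal in all models of this cardinality. Tameness enters through the bound on the
number of basic types, uniqueness and extension only. -/
theorem derived_axioms (hs : s.IsSemiGood lam) (hlam : Cardinal.aleph0 ≤ lam)
    {P : Model L → Prop} (hP : ∀ M, P M → s.K.Mem M ∧ M.HasCard (Order.succ lam))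
    (hcof : ∀ M, s.K.Mem M → M.HasCard (Order.succ lam) → ∃ M', s.K.le M M' ∧ P M')
    (ht : s.TameOver lam P) (hsymm : (s.derived lam P).Symmetry) :
    (s.derived lam P).Axioms (Order.succ lam) (Order.succ lam) where
  basicIso := hs.derived_basicIso P
  density := by
    intro M N hMN hne
    obtain ⟨N₀, a, h⟩ := hs.exists_nonForking hlam hMN.1 hne
      ((hP M hMN.2.1).2.cardGe.of_le (Order.le_succ lam))
    exact ⟨a, hs.derived_basic_iff.2 ⟨N₀, h⟩⟩
  stability := hs.derived_stability hlam hP ht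
  dnfBasic := by
    rintro M₀ a M₁ M₂ ⟨hM₀, hM₁, hM₂, hd⟩
    obtain ⟨hle, N₀, hN₀, h⟩ := hs.dnfGe_iff.1 hd
    exact ⟨⟨hle, hM₀, hM₁⟩, ⟨h.le, hM₁, hM₂⟩,
      hs.derived_basic_iff.2 ⟨N₀, hs.nonForking_mono h hN₀ hle⟩,
      hs.derived_basic_iff.2 ⟨N₀, h⟩⟩
  dnfIso := hs.derived_dnfIso P
  monotonicity := hs.derived_monotonicity P
  localCharacter := by
    intro δ M N a _ hδ hM hMN ha
    have hK := hs.core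
    have hM' : s.K.IsChain (Order.succ δ) M :=
      ⟨fun α hα => (hM.1 α hα).1, fun α β h hβ => (hM.2.1 α β h hβ).1, hM.2.2⟩
    have hPM : ∀ α ≤ δ, P (M α) := fun α hα => (hM.1 α (Order.lt_succ_iff.2 hα)).2
    obtain ⟨N₀, h⟩ := hs.derived_basic_iff.1 ha
    obtain ⟨α, hα, Q, hQ, h'⟩ := hs.exists_nonForking_of_isChain hlam hδ hM'
      ((hP _ (hPM 0 bot_le)).2.cardGe.of_le (Order.le_succ lam)) h
    exact ⟨α, hα, (hs.derived_typeDnf_iff hMN.2.2).2 ⟨hPM α hα.le, hPM δ le_rfl,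
      hM'.2.1 α δ hα (Order.lt_succ δ), Q, hQ, h'⟩⟩
  uniqueness := by
    intro M N N₁ N₂ a₁ a₂ hMN hN₁ hN₂ h₁ h₂ h
    have hK := hs.core
    obtain ⟨-, -, -, Q₁, hQ₁, h₁⟩ := (hs.derived_typeDnf_iff hN₁.2.2).1 h₁
    obtain ⟨-, -, -, Q₂, hQ₂, h₂⟩ := (hs.derived_typeDnf_iff hN₂.2.2).1 h₂
    obtain ⟨Q, hQ, hQ₁Q, hQ₂Q, hQM⟩ := hs.exists_upper_bound hlam h₁.mod hQ₁ h₂.mod hQ₂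
    have hQN := hK.le_trans _ _ _ hQM hMN.1
    exact hs.sameType_of_tame hlam (fun M hM => (hP M hM).2) ht hMN.2.2
      (hs.nonForking_mono_base h₁ hQ hQ₁Q hQN) (hs.nonForking_mono_base h₂ hQ hQ₂Q hQN)
      (AClass.SameType.restrict hK h hQM)
  symmetry := hsymm
  extension := by
    rintro M N hMN p hp
    have hK := hs.core
    obtain ⟨M₂, a, hpa⟩ := AClass.exists_isTp' p
    obtain ⟨N₀, h⟩ := (hs.derived_basic_iff (P := P)).1 ⟨p, hp, hpa⟩
    have hN₀N := hK.le_trans _ _ _ h.le_base hMN.1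
    obtain ⟨M', b, hM', hb, hsame⟩ := hs.exists_nonForking_extension hlam h.mod hN₀N
      (hP N hMN.2.2).2 (hs.basic_of_typeDnf (h.typeDnf _ h.mod (hK.le_refl _ (hs.mem h.mod))
        h.le_base))
    obtain ⟨M'', hM'', hPM''⟩ := hcof M' (hK.le_mem _ _ hb.le).2 hM'
    have hb' := hs.nonForking_of_sameType hb (.of_le hK hb.le hM'' hb.mem hb.notMem)
    have hsame' := hsame.trans (.of_le hK (hK.le_trans _ _ _ hN₀N hb.le) hM'' hb.mem
      fun h => hb.notMem (hK.subset hN₀N h))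
    refine ⟨M'', b, ⟨hb'.le, hMN.2.2, hPM''⟩, hpa.of_sameType (hs.sameType_of_tame hlam
      (fun M hM => (hP M hM).2) ht hMN.2.1 h (hs.nonForking_mono hb' h.le_base hMN.1) hsame'),
      hs.derived_basic_iff.2 ⟨N₀, hb'⟩, (hs.derived_typeDnf_iff hPM'').2 ⟨hMN.2.1, hMN.2.2, hMN.1,
        N₀, h.le_base, hb'⟩⟩
  continuity := by
    intro δ M N a _ hδ hM hMN ha ha' h
    have hM' : s.K.IsChain (Order.succ δ) M :=
      ⟨fun α hα => (hM.1 α hα).1, fun α β h hβ => (hM.2.1 α β h hβ).1, hM.2.2⟩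
    have hPM : ∀ α ≤ δ, P (M α) := fun α hα => (hM.1 α (Order.lt_succ_iff.2 hα)).2
    obtain ⟨Q, hQ, h'⟩ := hs.nonForking_of_isChain hlam hδ hM' hMN.1 ha ha' fun α hα =>
      ((hs.derived_typeDnf_iff hMN.2.2).1 (h α hα)).2.2.2
    exact ⟨hs.derived_basic_iff.2 ⟨Q, h'⟩, (hs.derived_typeDnf_iff hMN.2.2).2
      ⟨hPM 0 bot_le, hPM δ le_rfl, hM'.2.1 0 δ hδ.bot_lt (Order.lt_succ δ), Q, hQ, h'⟩⟩

theorem derived_noMaximal (hs : s.IsSemiGood lam) (hlam : Cardinal.aleph0 ≤ lam)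
    {P : Model L → Prop} (hP : ∀ M, P M → s.K.Mem M ∧ M.HasCard (Order.succ lam))
    (hcof : ∀ M, s.K.Mem M → M.HasCard (Order.succ lam) → ∃ M', s.K.le M M' ∧ P M') :
    (s.derived lam P).cls.NoMaximal := by
  rintro M ⟨hM, hPM⟩
  have hK := hs.core
  obtain ⟨M', hle, hne, hc⟩ := hs.exists_proper_extension hlam hM (hP M hPM).2
  obtain ⟨M'', hle', hPM''⟩ := hcof M' (hK.le_mem _ _ hle).2 hc
  refine ⟨M'', ⟨hK.le_trans _ _ _ hle hle', hPM, hPM''⟩, ?_⟩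
  rintro rfl
  exact hne ((hK.le_sub _ _ hle).of_subset_eq (hK.subset hle'))

theorem succFrame_isAECIn (hs : s.IsSemiGood lam) (hlam : Cardinal.aleph0 ≤ lam) :
    (s.succFrame lam).cls.IsAECIn (Order.succ lam) := by
  have hK := hs.core
  have hlam' := hlam.trans (Order.le_succ lam)
  have hchain : ∀ {δ M}, (s.succFrame lam).cls.IsChain δ M → s.K.IsChain δ M := fun hM =>
    ⟨fun α hα => (hM.1 α hα).1, fun α β h hβ => (hM.2.1 α β h hβ).1, hM.2.2⟩
  refine ⟨fun M hM => hM.2.2, ?_, ?_, ?_, ?_, ?_, ?_, ?_, ?_, ?_⟩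
  · rintro M N hM ⟨e⟩
    have hN := hK.mem_iso M N hM.1 ⟨e⟩
    exact ⟨hN, hN, (Cardinal.mk_congr e.toEquiv).symm.trans hM.2.2⟩
  · rintro M N M' N' e ⟨hMN, hM, hN⟩ hMN' him
    have hle := hK.le_iso M N M' N' e hMN hMN' him
    obtain ⟨F, hF, hN', hFe⟩ := Model.exists_eq_map e
    have hM' := Model.eq_map_of_imageEq hF (hK.le_sub _ _ hMN) hN' hMN' hFe him
    refine ⟨hle, ⟨(hK.le_mem _ _ hle).1, ?_⟩, (hK.le_mem _ _ hle).2, ?_⟩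
    · rw [hM']
      exact hM.2.map (hF.mono (hK.subset hMN))
    · rw [hN']
      exact hN.2.map hF
  · rintro M N ⟨hMN, hM, hN⟩
    exact ⟨⟨hM.1, hM⟩, hN.1, hN⟩
  · exact fun M N h => hK.le_sub M N h.1
  · exact fun M h => ⟨hK.le_refl M h.1, h.2, h.2⟩
  · exact fun M₀ M₁ M₂ h h' => ⟨hK.le_trans _ _ _ h.1 h'.1, h.2.1, h'.2.2⟩
  · exact fun M₀ M₁ M₂ h h' h'' => ⟨hK.coherence _ _ _ h h'.1 h''.1, h'.2.1, h''.2.1⟩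
  · intro δ M U hδ hδ' hM hU
    obtain ⟨hmem, hle⟩ := hK.union δ M U trivial hδ' (hchain hM) hU
    have hc := hU.hasCard hlam' hδ'.bot_lt hδ fun α hα => (hM.1 α hα).2.2
    exact ⟨⟨hmem, hmem, hc⟩, fun α hα => ⟨hle α hα, (hM.1 α hα).2, hmem, hc⟩⟩
  · intro δ M U N hδ hδ' hM hU hN
    have hle := hK.smooth δ M U N trivial hδ' (hchain hM) hU fun α hα => (hN α hα).1
    exact ⟨hle, ⟨(hK.le_mem _ _ hle).1, hU.hasCard hlam' hδ'.bot_lt hδ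
      fun α hα => (hM.1 α hα).2.2⟩, (hN 0 hδ'.bot_lt).2.2⟩

theorem satFrame_jep (hs : s.IsSemiGood lam) (hlam : Cardinal.aleph0 ≤ lam)
    (haec : (s.satFrame lam).cls.IsAECIn (Order.succ lam)) : (s.satFrame lam).cls.JEP := by
  intro M₁ M₂ h₁ h₂
  obtain ⟨F, hF⟩ := hs.exists_kMap_of_isSaturated hlam h₁.1 h₁.2.2.1 h₂.2
  have hF' : (s.satFrame lam).cls.KMap F M₁ M₂ :=
    ⟨hF.1, hF.2, (haec.2.mem_map h₁ hF.1).2, h₂.2⟩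
  obtain ⟨e₁, he₁, -⟩ := hF'.exists_isEmb haec.2
  obtain ⟨e₂, he₂, -⟩ := (AClass.KMap.of_le (haec.2.le_refl _ h₂)).exists_isEmb haec.2
  exact ⟨M₂, e₁, e₂, h₂, he₁, he₂⟩

end IsSemiGood

end Frame

end AECFrames

theorem mainTheorem7 {L : FirstOrder.Language.{u, u}} (lam : Cardinal.{u})
    (hlam : Cardinal.aleph0 ≤ lam) (s : AECFrames.Frame L) (hs : s.IsSemiGood lam) :
    (s.TameNF lam → (s.succFrame lam).Symmetry →
      (s.succFrame lam).IsGoodMinusJEPAP (Order.succ lam)) ∧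
    ((s.satFrame lam).cls.IsAECIn (Order.succ lam) → s.TameNFSat lam →
      (s.satFrame lam).Symmetry →
      (s.satFrame lam).IsGoodMinusAP (Order.succ lam)) := by
  refine ⟨fun ht hsymm => ?_, fun haec ht hsymm => ?_⟩
  · have hcof : ∀ M, s.K.Mem M → M.HasCard (Order.succ lam) →
        ∃ M', s.K.le M M' ∧ s.K.Mem M' ∧ M'.HasCard (Order.succ lam) :=
      fun M hM hc => ⟨M, hs.core.le_refl M hM, hM, hc⟩
    exact ⟨hs.succFrame_isAECIn hlam, hs.derived_noMaximal hlam (fun _ h => h) hcof,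
      hs.derived_axioms hlam (fun _ h => h) hcof (fun M₀ M₁ M₂ h => ht M₀ M₁ M₂ h.1) hsymm⟩
  · have hP : ∀ M, s.K.IsSaturated lam M → s.K.Mem M ∧ M.HasCard (Order.succ lam) :=
      fun M h => ⟨h.1, h.2.1⟩
    have hcof : ∀ M, s.K.Mem M → M.HasCard (Order.succ lam) →
        ∃ M', s.K.le M M' ∧ s.K.IsSaturated lam M' := fun M => hs.exists_isSaturated hlam
    exact ⟨⟨haec, hs.derived_noMaximal hlam hP hcof, hs.derived_axioms hlam hP hcof ht hsymm⟩,
      hs.satFrame_jep hlam haec⟩
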